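/- Let $V=\mathbb Q^{8}$ with coordinates indexed by $\mathbb F_2^3$ and inner product $(x,y)=\frac12\sum_a x_ay_a$. Let $L=BW_3$ be the Barnes-Wall lattice, the $\mathbb Z$-span of the vectors $2^{\lfloor (3-k)/2\rfloor}\chi_A$, where $A$ ranges over the affine subspaces of $\mathbb F_2^3$, $k=\dim A$ and $\chi_A$ is the characteristic vector of $A$. A root is a vector $r\in L$ with $(r,r)=2$, and $W_{E_8}$ is the group generated by the reflections $x\mapsto x-(x,r)r$ in the roots. For $M\le L$ put $\mathrm{ann}_L(M)=\{x\in L: (x,M)=0\}$. An RSSD (relatively semiselfdual) sublattice of $L$ is a primitive sublattice $M$ (that is, a direct summand of $L$) with $2L\le M+\mathrm{ann}_L(M)$; its associated involution $t_M$ is the linear map which is $-1$ on $M$ and $1$ on $\mathrm{ann}_L(M)$. Let $R\cong 2^{1+6}_+$ be the group generated by the coordinate permutations induced by the translations of $\mathbb F_2^3$ and the sign changes $\mathrm{diag}((-1)^{\lambda(a)})_a$, $\lambda$ a linear functional on $\mathbb F_2^3$, and let $BRW_3\cong 2^{1+6}_+.\Omega^+(6,2)$ be the commutator subgroup of the normalizer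 of $R$ in $GL(8,\mathbb Q)$. Then $L$ has a $\mathbb Z$-basis whose Gram matrix is the Cartan matrix of type $E_8$, and $W_{E_8}$ has exactly eight orbits on the RSSD sublattices of $L$ other than $0$ and $L$, as follows. (i) For even rank there are one orbit of rank 2, two orbits of rank 4 and one orbit of rank 6. These are the orbits coming from $BRW_3$: an RSSD sublattice $M$ has even rank if and only if its $W_{E_8}$-orbit contains an RSSD sublattice $N$ with $t_N\in BRW_3$. Moreover, for each of the ranks 2 and 6, the RSSD sublattices $M$ of this rank with $t_M\in BRW_3$ form a single orbit of $BRW_3$. (ii) For each of the ranks 1, 3, 5, 7 there is exactly one orbit. It consists, respectively, of all sublattices spanned by a root, all sublattices spanned by three mutually orthogonal roots, all annihilators in $L$ of sublattices spanned by three mutually orthogonal roots, and all annihilators in $L$ of sublattices spanned by a root. -/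

import Mathlib

open scoped Pointwise

noncomputable section

namespace BarnesWall

/-- The affine space `𝔽₂³`, which labels the coordinates. -/
abbrev Idx : Type := Fin 3 → ZMod 2

/-- The ambient rational vector space `ℚ⁸`, with coordinates labelled by `𝔽₂³`. -/
abbrev V : Type := Idx → ℚ

/-- The rational inner product `(x, y) = ½ ∑ₐ xₐ yₐ`
(the factor `½` is the usual normalization making the lattice below even unimodular). -/
def form (x y : V) : ℚ := (1 / 2) * ∑ a, x a * y a

/-- The Barnes-Wall lattice `BW₃` of rank `2³`: the `ℤ`-span of the vectors
`2^⌊(3 - k)/2⌋ · χ_A`, where `A` runs through the affine subspaces of `𝔽₂³`, `k = dim A`, and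
`χ_A` is the characteristic vector of `A`. -/
def BW3 : Submodule ℤ V :=
  Submodule.span ℤ {v | ∃ A : AffineSubspace (ZMod 2) Idx, (A : Set Idx).Nonempty ∧
    v = (2 : ℚ) ^ ((3 - Module.finrank (ZMod 2) A.direction) / 2) •
      Set.indicator (A : Set Idx) (1 : V)}

/-- The roots of the lattice: its vectors of norm `(r, r) = 2`. -/
def IsRoot (r : V) : Prop := r ∈ BW3 ∧ form r r = 2

/-- The Weyl group `W_{E₈}`: the group generated by the reflections `x ↦ x - (x, r) r` in the
roots `r`. -/
def weylGroup : Subgroup (V ≃ₗ[ℚ] V) :=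
  Subgroup.closure {s | ∃ r, IsRoot r ∧ ∀ x, s x = x - form x r • r}

/-- The lower group `R ≅ 2^{1+6}₊`, generated by the translations of the coordinates and by the
sign changes along the linear characters of `𝔽₂³`. -/
def lowerGroup : Subgroup (V ≃ₗ[ℚ] V) :=
  Subgroup.closure
    ({g | ∃ b : Idx, ∀ (x : V) (a : Idx), g x a = x (a + b)} ∪
     {g | ∃ b : Idx, ∀ (x : V) (a : Idx),
        g x a = (if ∑ i, b i * a i = 0 then 1 else -1) * x a})

/-- The group `BRW₃ ≅ 2^{1+6}₊.Ω⁺(6,2)`: the commutator subgroup of the normalizer of the lower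
group in `GL(8, ℚ)`. -/
def BRW3 : Subgroup (V ≃ₗ[ℚ] V) :=
  ⁅Subgroup.normalizer (lowerGroup : Set (V ≃ₗ[ℚ] V)),
    Subgroup.normalizer (lowerGroup : Set (V ≃ₗ[ℚ] V))⁆

/-- The annihilator of `M` in the lattice: the lattice vectors orthogonal to `M`. -/
def ann (M : Submodule ℤ V) : Submodule ℤ V where
  carrier := {x | x ∈ BW3 ∧ ∀ y ∈ M, form x y = 0}
  zero_mem' := ⟨BW3.zero_mem, fun y _ => by simp [form]⟩
  add_mem' := by
    rintro x z ⟨hx, hx'⟩ ⟨hz, hz'⟩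
    refine ⟨BW3.add_mem hx hz, fun y hy => ?_⟩
    have h1 := hx' y hy
    have h2 := hz' y hy
    simp only [form, Pi.add_apply, add_mul, Finset.sum_add_distrib, mul_add] at *
    linarith
  smul_mem' := by
    rintro c x ⟨hx, hx'⟩
    refine ⟨BW3.smul_mem c hx, fun y hy => ?_⟩
    have h1 := hx' y hy
    simp only [form, Pi.smul_apply, zsmul_eq_mul, mul_assoc, ← Finset.mul_sum] at *
    rw [mul_left_comm, h1, mul_zero]

/-- `M` is a relatively semiselfdual (RSSD) sublattice of `L = BW₃`: a primitive sublattice (that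
is, a direct summand) with `2L ≤ M + ann_L(M)`. Equivalently, `M` is the `-1`-eigenlattice of an
isometry of `L` of order at most two. -/
structure IsRSSD (M : Submodule ℤ V) : Prop where
  le : M ≤ BW3
  primitive : ∀ (n : ℤ) (x : V), n ≠ 0 → x ∈ BW3 → n • x ∈ M → x ∈ M
  two_smul_mem : ∀ x ∈ BW3, (2 : ℤ) • x ∈ M ⊔ ann M

/-- `t` is the involution associated with `M`: it is `-1` on `M` and `1` on the annihilator. -/
def IsAssociatedInvolution (t : V ≃ₗ[ℚ] V) (M : Submodule ℤ V) : Prop :=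
  (∀ x ∈ M, t x = -x) ∧ ∀ x ∈ ann M, t x = x

/-- The set of `W_{E₈}`-orbits on RSSD sublattices of rank `n`. -/
def orbitsOfRank (n : ℕ) : Set (Set (Submodule ℤ V)) :=
  (fun M => MulAction.orbit weylGroup M) '' {M | IsRSSD M ∧ Module.finrank ℤ M = n}

/-- The set of `W_{E₈}`-orbits on RSSD sublattices other than `0` and the whole lattice. -/
def properOrbits : Set (Set (Submodule ℤ V)) :=
  (fun M => MulAction.orbit weylGroup M) '' {M | IsRSSD M ∧ M ≠ ⊥ ∧ M ≠ BW3}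

end BarnesWall

end

noncomputable section

namespace BarnesWall

/-! ### Finite checks on affine functions of `𝔽₂³` -/

/-! The lattice is Construction A of the extended Hamming code: a vector lies in `BW3` exactly when
its coordinates are integers whose reduction mod 2 is an affine function on `𝔽₂³` (`mem_BW3_iff`).
Hence the lattice is even and integral, and the vectors `axis a` form a frame of eight mutually
orthogonal roots.

Every RSSD sublattice is moved by the Weyl group to a coordinate sublattice `coordLat T`. The
essential point is that a nonzero RSSD sublattice contains a root (`exists_root_mem`). Such a root
can be moved to an axis without disturbing the axes already obtained (`exists_move_root`), and the
part of `M` orthogonal to these axes is again RSSD (`isRSSD_inf_coordLat`), so the process continues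
until `M` is exhausted.

It remains to classify the subsets `T` of `𝔽₂³`. Affine shears act on `V` as products of
reflections, and they carry `T` to any other set of the same size, except that among the 4-sets the
planes are separate from the rest (`linked_of_card_eq`). Rank and the existence of an inner product
1 inside the sublattice tell the resulting eight classes apart (`repOrbit_injective`). The
descriptions in odd rank follow because at most three axes span their coordinate lattice, and
because `ann` is an involution on RSSD sublattices.

For `BRW3`, commutators of shears and of quadratic sign changes with shears show that it contains
all shears and all sign changes on sets of even size. The latter are the involutions of the
coordinate lattices of even rank. Conversely a commutator subgroup has determinant 1, while the
involution of `M` has determinant `(-1)^rank`.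

For the single `BRW3`-orbit in rank 2, let `M` be spanned by orthogonal roots `r`, `s` with `t_M` in
`BRW3`. As `t_M` normalizes `R`, it preserves `lowerLat`, that is `2L + [L, R]`, and this forces `r
+ s` into `lowerLat` (`add_mem_lowerLat`). An element of `BRW3` moves `r` to an axis up to sign
(`exists_move_root_BRW3`), and the congruences valid on `lowerLat` then force `s` to an axis up to
sign as well. Shears in `BRW3` permute the pairs of axes transitively. Rank 6 follows by passing to
annihilators. -/

theorem sum_affine_mul_affine : ∀ (c : ZMod 2) (b : Idx) (c' : ZMod 2) (b' : Idx),
    ∑ a : Idx, (c + b ⬝ᵥ a) * (c' + b' ⬝ᵥ a) = 0 := by decide +kernel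

theorem sum_affine_support : ∀ (c : ZMod 2) (b : Idx),
    ∑ a : Idx, (if c + b ⬝ᵥ a = 1 then 1 else 0 : ZMod 4) = 0 := by decide +kernel

theorem sum_plane_support : ∀ (c : ZMod 2) (b : Idx), b ≠ 0 →
    ∑ a : Idx, (if c + b ⬝ᵥ a = 1 then 1 else 0 : ℤ) = 4 := by decide +kernel

theorem zmod_two_cases (z : ZMod 2) : z = 0 ∨ z = 1 := by
  revert z; decide

/-! ### The form -/

theorem form_comm (x y : V) : form x y = form y x := by
  simp only [form, mul_comm]

theorem form_add_left (x y z : V) : form (x + y) z = form x z + form y z := by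
  simp only [form, Pi.add_apply, add_mul, Finset.sum_add_distrib, mul_add]

theorem form_smul_left (c : ℚ) (x y : V) : form (c • x) y = c * form x y := by
  simp only [form, Pi.smul_apply, smul_eq_mul, mul_assoc, ← Finset.mul_sum]
  ring

theorem form_add_right (x y z : V) : form x (y + z) = form x y + form x z := by
  rw [form_comm, form_add_left, form_comm y, form_comm z]

theorem form_smul_right (c : ℚ) (x y : V) : form x (c • y) = c * form x y := by
  rw [form_comm, form_smul_left, form_comm]

theorem form_neg_left (x y : V) : form (-x) y = -form x y := by
  rw [← neg_one_smul ℚ x, form_smul_left]; ring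

theorem form_neg_right (x y : V) : form x (-y) = -form x y := by
  rw [form_comm, form_neg_left, form_comm]

theorem form_sub_left (x y z : V) : form (x - y) z = form x z - form y z := by
  rw [sub_eq_add_neg, form_add_left, form_neg_left]; ring

theorem form_sub_right (x y z : V) : form x (y - z) = form x y - form x z := by
  rw [form_comm, form_sub_left, form_comm y, form_comm z]

theorem form_zsmul_left (c : ℤ) (x y : V) : form (c • x) y = c * form x y := by
  rw [← Int.cast_smul_eq_zsmul ℚ, form_smul_left]

theorem form_zsmul_right (c : ℤ) (x y : V) : form x (c • y) = c * form x y := by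
  rw [← Int.cast_smul_eq_zsmul ℚ, form_smul_right]

theorem form_zero_left (x : V) : form 0 x = 0 := by simp [form]

theorem form_self_eq_zero {x : V} (h : form x x = 0) : x = 0 := by
  have h' : ∑ a, x a * x a = 0 := by simp only [form] at h; linarith
  rw [Finset.sum_eq_zero_iff_of_nonneg fun a _ => mul_self_nonneg _] at h'
  funext a
  exact mul_self_eq_zero.1 (h' a (Finset.mem_univ a))

/-- The vector `2 eₐ`. -/
def axis (a : Idx) : V := Pi.single a 2

theorem axis_apply (a b : Idx) : axis a b = if b = a then 2 else 0 := by
  simp [axis, Pi.single_apply]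

theorem axis_self (a : Idx) : axis a a = 2 := by simp [axis_apply]

theorem form_axis (x : V) (a : Idx) : form x (axis a) = x a := by
  simp [form, axis_apply]; ring

theorem form_axis_axis (a b : Idx) : form (axis a) (axis b) = if a = b then 2 else 0 := by
  rw [form_axis, axis_apply]; simp [eq_comm]

/-! ### Coordinates of lattice vectors -/

theorem finrank_ker_eq_two {f : Idx →ₗ[ZMod 2] ZMod 2} (hf : f ≠ 0) :
    Module.finrank (ZMod 2) (LinearMap.ker f) = 2 := by
  have h := f.finrank_range_add_finrank_ker
  have h1 : LinearMap.range f = ⊤ := LinearMap.range_eq_top.2 (LinearMap.surjective hf)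
  rw [h1, finrank_top] at h
  simp at h
  omega

theorem linearMap_eq_dotProduct (f : Idx →ₗ[ZMod 2] ZMod 2) :
    ∃ b : Idx, ∀ x, f x = b ⬝ᵥ x := by
  refine ⟨fun i => f (Pi.single i 1), fun x => ?_⟩
  rw [LinearMap.pi_apply_eq_sum_univ f x, dotProduct]
  exact Finset.sum_congr rfl fun i _ => by rw [smul_eq_mul, mul_comm]; congr 2; ext j; simp [Pi.single_apply, eq_comm]

theorem exists_affine_of_two_le_finrank {A : AffineSubspace (ZMod 2) Idx}
    (hA : (A : Set Idx).Nonempty) (h : 2 ≤ Module.finrank (ZMod 2) A.direction) :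
    ∃ (c : ZMod 2) (b : Idx), ∀ a, a ∈ A ↔ c + b ⬝ᵥ a = 1 := by
  obtain ⟨p, hp⟩ := hA
  by_cases ht : A.direction = ⊤
  · refine ⟨1, 0, fun a => ?_⟩
    rw [AffineSubspace.direction_eq_top_iff_of_nonempty ⟨p, hp⟩] at ht
    simp [ht]
  obtain ⟨f, hf0, hf⟩ := Submodule.exists_le_ker_of_lt_top _ (lt_top_iff_ne_top.2 ht)
  have hk : A.direction = LinearMap.ker f :=
    Submodule.eq_of_le_of_finrank_le hf (by rw [finrank_ker_eq_two hf0]; exact h)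
  obtain ⟨b, hb⟩ := linearMap_eq_dotProduct f
  refine ⟨1 + b ⬝ᵥ p, b, fun a => ?_⟩
  rw [← AffineSubspace.vsub_right_mem_direction_iff_mem hp, hk, LinearMap.mem_ker, vsub_eq_sub,
    map_sub, hb, hb]
  generalize b ⬝ᵥ a = u
  generalize b ⬝ᵥ p = v
  revert u v; decide

/-- An integral vector whose reduction mod 2 is an affine function. -/
def IsCode (n : Idx → ℤ) : Prop := ∃ (c : ZMod 2) (b : Idx), ∀ a, (n a : ZMod 2) = c + b ⬝ᵥ a

theorem IsCode.add {m n : Idx → ℤ} (hm : IsCode m) (hn : IsCode n) : IsCode (m + n) := by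
  obtain ⟨c, b, h⟩ := hm
  obtain ⟨c', b', h'⟩ := hn
  refine ⟨c + c', b + b', fun a => ?_⟩
  rw [Pi.add_apply, Int.cast_add, h, h', add_dotProduct]; ring

theorem IsCode.smul {n : Idx → ℤ} (hn : IsCode n) (k : ℤ) : IsCode (k • n) := by
  obtain ⟨c, b, h⟩ := hn
  refine ⟨k * c, (k : ZMod 2) • b, fun a => ?_⟩
  rw [Pi.smul_apply, smul_eq_mul, Int.cast_mul, h, smul_dotProduct, smul_eq_mul]; ring

/-- Planes and the whole space have coefficient 1 and are the supports of nonzero affine functions;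
points and lines have coefficient 2 and vanish mod 2. -/
theorem exists_isCode_of_mem {x : V} (hx : x ∈ BW3) :
    ∃ n : Idx → ℤ, (∀ a, x a = n a) ∧ IsCode n := by
  induction hx using Submodule.span_induction with
  | mem x hx =>
    classical
    obtain ⟨A, hA, rfl⟩ := hx
    rcases le_or_gt 2 (Module.finrank (ZMod 2) A.direction) with h | h
    · obtain ⟨c, b, hcb⟩ := exists_affine_of_two_le_finrank hA h
      refine ⟨fun a => if c + b ⬝ᵥ a = 1 then 1 else 0, fun a => ?_, c, b, fun a => ?_⟩
      · have : (3 - Module.finrank (ZMod 2) A.direction) / 2 = 0 := by omega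
        simp [this, Set.indicator_apply, hcb]
      · rcases zmod_two_cases (c + b ⬝ᵥ a) with h | h <;> simp [h]
    · refine ⟨fun a => if a ∈ A then 2 else 0, fun a => ?_, 0, 0, fun a => ?_⟩
      · have : (3 - Module.finrank (ZMod 2) A.direction) / 2 = 1 := by omega
        simp [this, Set.indicator_apply]
      · by_cases ha : a ∈ A <;> simp [ha]
        decide
  | zero => exact ⟨0, by simp, 0, 0, by simp⟩
  | add x y _ _ hx hy =>
    obtain ⟨m, hm, hm'⟩ := hx
    obtain ⟨n, hn, hn'⟩ := hy
    exact ⟨m + n, fun a => by simp [hm, hn], hm'.add hn'⟩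
  | smul k x _ hx =>
    obtain ⟨m, hm, hm'⟩ := hx
    exact ⟨k • m, fun a => by simp [hm], hm'.smul k⟩

theorem generator_mem {A : AffineSubspace (ZMod 2) Idx} (hA : (A : Set Idx).Nonempty) {k : ℕ}
    (hk : Module.finrank (ZMod 2) A.direction = k) {v : V}
    (hv : ∀ a, (a ∈ A → v a = 2 ^ ((3 - k) / 2)) ∧ (a ∉ A → v a = 0)) : v ∈ BW3 := by
  classical
  refine Submodule.subset_span ⟨A, hA, ?_⟩
  funext a
  by_cases ha : a ∈ A
  · simp [ha, hk, (hv a).1 ha]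
  · simp [ha, (hv a).2 ha]

theorem axis_mem (a : Idx) : axis a ∈ BW3 := by
  refine generator_mem (A := AffineSubspace.mk' a ⊥) ⟨a, by simp⟩ (k := 0) (by simp) fun b => ?_
  simp only [AffineSubspace.mem_mk', vsub_eq_sub, Submodule.mem_bot, sub_eq_zero, axis_apply]
  exact ⟨fun h => by simp [h], fun h => by simp [h]⟩

theorem affine_support_mem (c : ZMod 2) (b : Idx) :
    (fun a => if c + b ⬝ᵥ a = 1 then 1 else 0 : V) ∈ BW3 := by
  by_cases hb : b = 0
  · rcases zmod_two_cases c with rfl | rfl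
    · convert BW3.zero_mem using 1
      funext a; simp [hb]
    · refine generator_mem (A := ⊤) ⟨0, by simp⟩ (k := 3)
        (by rw [AffineSubspace.direction_top, finrank_top]; simp) fun a => ?_
      simp [hb]
  · obtain ⟨p, hp⟩ : ∃ p, c + b ⬝ᵥ p = 1 := by revert c b; decide +kernel
    let f : Idx →ₗ[ZMod 2] ZMod 2 := dotProductBilin (ZMod 2) (ZMod 2) b
    have hfb : ∀ x, f x = b ⬝ᵥ x := fun x => rfl
    have hf : f ≠ 0 := by
      intro h
      apply hb
      funext i
      have := hfb (Pi.single i 1)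
      simpa [h] using this.symm
    refine generator_mem (A := AffineSubspace.mk' p (LinearMap.ker f)) ⟨p, by simp⟩ (k := 2)
      (by rw [AffineSubspace.direction_mk', finrank_ker_eq_two hf]) fun a => ?_
    have : b ⬝ᵥ (a - p) = 0 ↔ c + b ⬝ᵥ a = 1 := by
      rw [← hp, dotProduct_sub]; constructor
      · intro h; linear_combination h
      · intro h; linear_combination h
    simp only [AffineSubspace.mem_mk', LinearMap.mem_ker, vsub_eq_sub, hfb, this]
    exact ⟨fun h => by simp [h], fun h => by simp [h]⟩

/-- Subtracting the characteristic vector of the odd coordinates, which is the support of an affine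
function, leaves an even vector, a combination of the `axis d`. -/
theorem mem_of_isCode {n : Idx → ℤ} (hn : IsCode n) : (fun a => (n a : ℚ)) ∈ BW3 := by
  obtain ⟨c, b, h⟩ := hn
  have hz : ∀ a, ∃ z : ℤ, n a = (if c + b ⬝ᵥ a = 1 then 1 else 0) + 2 * z := by
    intro a
    have : ((n a - (if c + b ⬝ᵥ a = 1 then 1 else 0) : ℤ) : ZMod 2) = 0 := by
      rw [Int.cast_sub, h]
      rcases zmod_two_cases (c + b ⬝ᵥ a) with h | h <;> simp [h]
    obtain ⟨z, hz⟩ := (ZMod.intCast_zmod_eq_zero_iff_dvd _ 2).1 this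
    exact ⟨z, by push_cast at hz; linarith⟩
  choose z hz using hz
  have : (fun a => (n a : ℚ)) =
      (fun a => if c + b ⬝ᵥ a = 1 then 1 else 0 : V) + ∑ d, z d • axis d := by
    funext a
    simp [axis_apply, hz a, mul_comm]
  rw [this]
  exact BW3.add_mem (affine_support_mem c b)
    (BW3.sum_mem fun d _ => BW3.smul_mem _ (axis_mem d))

theorem mem_BW3_iff {x : V} : x ∈ BW3 ↔ ∃ n : Idx → ℤ, (∀ a, x a = n a) ∧ IsCode n := by
  refine ⟨exists_isCode_of_mem, ?_⟩
  rintro ⟨n, hn, h⟩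
  rw [show x = fun a => (n a : ℚ) from funext hn]
  exact mem_of_isCode h

/-- The code of affine functions is self-orthogonal, so the coordinate sum is even and absorbs the
factor `1/2` of the form. -/
theorem exists_form_eq_intCast {x y : V} (hx : x ∈ BW3) (hy : y ∈ BW3) :
    ∃ k : ℤ, form x y = k := by
  obtain ⟨m, hm, c, b, h⟩ := mem_BW3_iff.1 hx
  obtain ⟨n, hn, c', b', h'⟩ := mem_BW3_iff.1 hy
  have : ((∑ a, m a * n a : ℤ) : ZMod 2) = 0 := by
    push_cast
    simp only [h, h', sum_affine_mul_affine]
  obtain ⟨k, hk⟩ := (ZMod.intCast_zmod_eq_zero_iff_dvd _ 2).1 this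
  refine ⟨k, ?_⟩
  have hk' : ((∑ a, m a * n a : ℤ) : ℚ) = 2 * k := by rw [hk]; push_cast; ring
  push_cast at hk'
  simp only [form, hm, hn]
  rw [hk']; ring

theorem sq_zmod_four (n : ℤ) : (n : ZMod 4) * n = if (n : ZMod 2) = 1 then 1 else 0 := by
  have : ∀ z : ZMod 4, z * z = if (z.castHom (by norm_num : 2 ∣ 4) (ZMod 2)) = 1 then 1 else 0 := by
    decide
  simpa using this n

/-- The code is doubly even, and a square mod 4 only depends on parity; so the sum of squares is
divisible by 4. -/
theorem exists_form_self_eq {x : V} (hx : x ∈ BW3) : ∃ k : ℕ, form x x = 2 * k := by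
  obtain ⟨m, hm, c, b, h⟩ := mem_BW3_iff.1 hx
  have : ((∑ a, m a * m a : ℤ) : ZMod 4) = 0 := by
    push_cast
    simp only [sq_zmod_four, h, sum_affine_support]
  obtain ⟨k, hk⟩ := (ZMod.intCast_zmod_eq_zero_iff_dvd _ 4).1 this
  have hk0 : 0 ≤ k := by
    have : 0 ≤ ∑ a, m a * m a := Finset.sum_nonneg fun a _ => mul_self_nonneg _
    push_cast at hk; linarith
  lift k to ℕ using hk0
  refine ⟨k, ?_⟩
  have hk' : ((∑ a, m a * m a : ℤ) : ℚ) = 4 * k := by rw [hk]; push_cast; ring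
  push_cast at hk'
  simp only [form, hm]
  rw [hk']; ring

theorem isRoot_axis (a : Idx) : IsRoot (axis a) :=
  ⟨axis_mem a, by simp [form_axis_axis]⟩

/-! ### Isometries of the lattice -/

/-- The isometries of `V` preserving the lattice. -/
def latticeIsometries : Subgroup (V ≃ₗ[ℚ] V) where
  carrier := {g | (∀ x y, form (g x) (g y) = form x y) ∧ ∀ x, g x ∈ BW3 ↔ x ∈ BW3}
  one_mem' := ⟨fun _ _ => rfl, fun _ => Iff.rfl⟩
  mul_mem' := fun {g h} hg hh =>
    ⟨fun x y => (hg.1 (h x) (h y)).trans (hh.1 x y), fun x => (hg.2 (h x)).trans (hh.2 x)⟩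
  inv_mem' := fun {g} hg => by
    refine ⟨fun x y => ?_, fun x => ?_⟩
    · rw [← hg.1, LinearEquiv.coe_inv, g.apply_symm_apply, g.apply_symm_apply]
    · rw [← hg.2, LinearEquiv.coe_inv, g.apply_symm_apply]

variable {g : V ≃ₗ[ℚ] V} {M : Submodule ℤ V} {S T : Finset Idx} {r s x y : V}

theorem mem_smul_iff : x ∈ g • M ↔ g⁻¹ x ∈ M := by
  rw [Submodule.mem_smul_pointwise_iff_exists]
  constructor
  · rintro ⟨y, hy, rfl⟩
    rwa [LinearEquiv.smul_def, LinearEquiv.coe_inv, g.symm_apply_apply]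
  · intro h
    exact ⟨g⁻¹ x, h, by rw [LinearEquiv.smul_def, LinearEquiv.coe_inv, g.apply_symm_apply]⟩

theorem apply_mem_smul_iff : g x ∈ g • M ↔ x ∈ M := by
  rw [mem_smul_iff, LinearEquiv.coe_inv, g.symm_apply_apply]

theorem finrank_smul (g : V ≃ₗ[ℚ] V) (M : Submodule ℤ V) :
    Module.finrank ℤ (g • M : Submodule ℤ V) = Module.finrank ℤ M :=
  (Submodule.equivMapOfInjective (DistribSMul.toLinearMap ℤ V g) g.injective M).finrank_eq.symm

theorem mem_orbit_iff {H : Subgroup (V ≃ₗ[ℚ] V)} {M N : Submodule ℤ V} :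
    N ∈ MulAction.orbit H M ↔ ∃ g ∈ H, g • M = N :=
  ⟨fun ⟨g, hg⟩ => ⟨g, g.2, hg⟩, fun ⟨g, hg, h⟩ => ⟨⟨g, hg⟩, h⟩⟩

theorem mem_ann_iff : x ∈ ann M ↔ x ∈ BW3 ∧ ∀ y ∈ M, form x y = 0 := Iff.rfl

theorem ann_smul (hg : g ∈ latticeIsometries) (M : Submodule ℤ V) : ann (g • M) = g • ann M := by
  have hg' := latticeIsometries.inv_mem hg
  ext x
  rw [mem_smul_iff, mem_ann_iff, mem_ann_iff, hg'.2]
  refine and_congr Iff.rfl ⟨fun h y hy => ?_, fun h y hy => ?_⟩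
  · rw [← h (g y) (apply_mem_smul_iff.2 hy), ← hg.1, LinearEquiv.coe_inv, g.apply_symm_apply]
  · rw [← h _ (mem_smul_iff.1 hy), hg'.1]

theorem isRSSD_smul (hg : g ∈ latticeIsometries) (hM : IsRSSD M) : IsRSSD (g • M) := by
  have hg' := latticeIsometries.inv_mem hg
  refine ⟨fun x hx => ?_, fun n x hn hx h => ?_, fun x hx => ?_⟩
  · exact (hg'.2 x).1 (hM.le (mem_smul_iff.1 hx))
  · rw [mem_smul_iff] at h ⊢
    rw [map_zsmul] at h
    exact hM.primitive n _ hn ((hg'.2 x).2 hx) h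
  · rw [ann_smul hg]
    obtain ⟨m, hm, a, ha, h⟩ := Submodule.mem_sup.1 (hM.two_smul_mem _ ((hg'.2 x).2 hx))
    refine Submodule.mem_sup.2 ⟨g m, apply_mem_smul_iff.2 hm, g a, apply_mem_smul_iff.2 ha, ?_⟩
    rw [← map_add, h, map_zsmul, LinearEquiv.coe_inv, g.apply_symm_apply]

theorem isRoot_apply (hg : g ∈ latticeIsometries) (hr : IsRoot r) : IsRoot (g r) :=
  ⟨(hg.2 r).2 hr.1, by rw [hg.1, hr.2]⟩

/-! ### Reflections -/

theorem sub_mem_latticeIsometries {r : V} (hr : IsRoot r) {s : V ≃ₗ[ℚ] V}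
    (hs : ∀ x, s x = x - form x r • r) : s ∈ latticeIsometries := by
  have hmem : ∀ x ∈ BW3, s x ∈ BW3 := by
    intro x hx
    obtain ⟨k, hk⟩ := exists_form_eq_intCast hx hr.1
    rw [hs, hk, Int.cast_smul_eq_zsmul]
    exact BW3.sub_mem hx (BW3.smul_mem _ hr.1)
  have hinv : ∀ x, s (s x) = x := by
    intro x
    rw [hs (s x), hs x, form_sub_left, form_smul_left, hr.2]
    module
  refine ⟨fun x y => ?_, fun x => ⟨fun h => hinv x ▸ hmem _ h, hmem x⟩⟩
  rw [hs, hs, form_sub_left, form_sub_right, form_sub_right, form_smul_left, form_smul_right,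
    form_smul_left, form_smul_right, form_comm r y, hr.2]
  ring

theorem weylGroup_le : weylGroup ≤ latticeIsometries :=
  (Subgroup.closure_le _).2 fun _ ⟨_, hr, hs⟩ => sub_mem_latticeIsometries hr hs

theorem exists_reflection (hr : IsRoot r) :
    ∃ s ∈ weylGroup, ∀ x, s x = x - form x r • r := by
  let f : V →ₗ[ℚ] V :=
    { toFun := fun x => x - form x r • r
      map_add' := fun x y => by rw [form_add_left]; module
      map_smul' := fun c x => by rw [form_smul_left, RingHom.id_apply]; module }
  have hf : ∀ x, f x = x - form x r • r := fun _ => rfl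
  have hinv : Function.Involutive f := by
    intro x
    rw [hf (f x), hf x, form_sub_left, form_smul_left, hr.2]
    module
  exact ⟨LinearEquiv.ofInvolutive f hinv, Subgroup.subset_closure ⟨r, hr, fun _ => rfl⟩,
    fun _ => rfl⟩

theorem isRoot_neg (hr : IsRoot r) : IsRoot (-r) :=
  ⟨BW3.neg_mem hr.1, by rw [form_neg_left, form_neg_right, hr.2, neg_neg]⟩

theorem isRoot_sub (hr : IsRoot r) (hs : IsRoot s) (hrs : form r s = 1) : IsRoot (r - s) :=
  ⟨BW3.sub_mem hr.1 hs.1, by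
    rw [form_sub_left, form_sub_right, form_sub_right, form_comm s r, hrs, hr.2, hs.2]; norm_num⟩

/-- If `(r, s) = 1` then the reflection in the root `r - s` exchanges the roots `r` and `s`. -/
theorem exists_swap (hr : IsRoot r) (hs : IsRoot s) (hrs : form r s = 1) :
    ∃ w ∈ weylGroup, w r = s ∧ w s = r ∧ ∀ x, form x r = form x s → w x = x := by
  obtain ⟨w, hw, hw'⟩ := exists_reflection (isRoot_sub hr hs hrs)
  refine ⟨w, hw, ?_, ?_, fun x hx => ?_⟩
  · rw [hw', form_sub_right, hrs, hr.2]; module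
  · rw [hw', form_sub_right, form_comm s r, hrs, hs.2]; module
  · rw [hw', form_sub_right, hx]; module

/-- A root is `±2 eₐ`, or has a coordinate `±1`. -/
theorem root_cases (hr : IsRoot r) :
    (∃ a, r = axis a ∨ r = -axis a) ∨ ∃ a, r a = 1 ∨ r a = -1 := by
  obtain ⟨n, hn, hc⟩ := mem_BW3_iff.1 hr.1
  have hsum : ∑ a, n a * n a = 4 := by
    have h := hr.2
    simp only [form, hn] at h
    have h' : ((∑ a, n a * n a : ℤ) : ℚ) = 4 := by push_cast; linarith
    exact_mod_cast h'
  by_contra! hcon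
  obtain ⟨h1, h2⟩ := hcon
  obtain ⟨a, ha⟩ : ∃ a, n a ≠ 0 := by
    by_contra! h
    simp [h] at hsum
  have hle : n a * n a + ∑ b ∈ Finset.univ.erase a, n b * n b = 4 := by
    rw [Finset.add_sum_erase _ (fun b => n b * n b) (Finset.mem_univ a)]; exact hsum
  have hnn : 0 ≤ ∑ b ∈ Finset.univ.erase a, n b * n b :=
    Finset.sum_nonneg fun b _ => mul_self_nonneg _
  have h3 : n a ≠ 1 := fun h => (h2 a).1 (by rw [hn, h]; norm_num)
  have h4 : n a ≠ -1 := fun h => (h2 a).2 (by rw [hn, h]; norm_num)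
  -- The squares sum to 4, so a nonzero entry other than `±1` is `±2` and leaves nothing for the
  -- other coordinates.
  have h5 : n a ≤ 2 := by nlinarith
  have h6 : -2 ≤ n a := by nlinarith
  have h7 : n a = 2 ∨ n a = -2 := by omega
  have h8 : ∑ b ∈ Finset.univ.erase a, n b * n b = 0 := by
    rcases h7 with h | h <;> rw [h] at hle <;> linarith
  rw [Finset.sum_eq_zero_iff_of_nonneg fun b _ => mul_self_nonneg _] at h8
  have h9 : ∀ b, b ≠ a → n b = 0 := fun b hb =>
    mul_self_eq_zero.1 (h8 b (Finset.mem_erase.2 ⟨hb, Finset.mem_univ b⟩))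
  rcases h7 with h | h
  · refine (h1 a).1 (funext fun b => ?_)
    by_cases hb : b = a
    · subst hb; rw [hn, h, axis_self]; norm_num
    · rw [hn, h9 b hb, axis_apply, if_neg hb]; norm_num
  · refine (h1 a).2 (funext fun b => ?_)
    by_cases hb : b = a
    · subst hb; rw [hn, h, Pi.neg_apply, axis_self]; norm_num
    · rw [hn, h9 b hb, Pi.neg_apply, axis_apply, if_neg hb]; norm_num

/-- A root orthogonal to some of the `2 eₛ` can be moved to some `2 eₐ` by an element of the Weyl
group fixing these vectors. -/
theorem exists_move_root (hr : IsRoot r) (hS : ∀ a ∈ S, r a = 0) :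
    ∃ w ∈ weylGroup, (∀ a ∈ S, w (axis a) = axis a) ∧ ∃ b, b ∉ S ∧ w r = axis b := by
  rcases root_cases hr with ⟨a, h | h⟩ | ⟨a, h | h⟩
  · refine ⟨1, one_mem _, fun _ _ => rfl, a, fun ha => ?_, h⟩
    have := hS a ha
    rw [h, axis_self] at this; norm_num at this
  · obtain ⟨w, hw, hw'⟩ := exists_reflection hr
    have haS : a ∉ S := fun ha => by
      have := hS a ha
      rw [h, Pi.neg_apply, axis_self] at this; norm_num at this
    refine ⟨w, hw, fun b hb => ?_, a, haS, ?_⟩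
    · rw [hw', form_comm, form_axis, hS b hb]; module
    · rw [hw', hr.2, h]; module
  -- The inner product with `axis a` is `r a = 1`, so a reflection exchanges the two roots; it fixes
  -- the axes of `S`, which are orthogonal to both.
  · obtain ⟨w, hw, hw1, -, hw2⟩ := exists_swap hr (isRoot_axis a) (by rw [form_axis, h])
    have haS : a ∉ S := fun ha => by rw [hS a ha] at h; norm_num at h
    refine ⟨w, hw, fun b hb => hw2 _ ?_, a, haS, hw1⟩
    rw [form_comm, form_axis, hS b hb, form_axis_axis, if_neg]
    rintro rfl; exact haS hb
  · obtain ⟨w, hw, hw1, -, hw2⟩ := exists_swap (isRoot_neg hr) (isRoot_axis a)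
      (by rw [form_axis, Pi.neg_apply, h, neg_neg])
    have haS : a ∉ S := fun ha => by rw [hS a ha] at h; norm_num at h
    have hfix : ∀ b ∈ S, w (axis b) = axis b := fun b hb => hw2 _ (by
      rw [form_neg_right, form_comm, form_axis, hS b hb, form_axis_axis, if_neg, neg_zero]
      rintro rfl; exact haS hb)
    -- The exchange applied to `-r` sends `r` to `-axis a`; the reflection in `axis a` repairs the
    -- sign.
    obtain ⟨v, hv, hv'⟩ := exists_reflection (isRoot_axis a)
    refine ⟨v * w, mul_mem hv hw, fun b hb => ?_, a, haS, ?_⟩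
    · rw [LinearEquiv.mul_apply, hfix b hb, hv', form_axis_axis, if_neg]
      · module
      · rintro rfl; exact haS hb
    · have : w r = -axis a := by rw [← hw1, map_neg, neg_neg]
      rw [LinearEquiv.mul_apply, this, hv', form_neg_left, form_axis, axis_self]; module

/-! ### Coordinate sublattices -/

/-- The lattice vectors supported on `S`. -/
def coordLat (S : Finset Idx) : Submodule ℤ V where
  carrier := {x | x ∈ BW3 ∧ ∀ a, a ∉ S → x a = 0}
  zero_mem' := ⟨BW3.zero_mem, fun _ _ => rfl⟩
  add_mem' := fun hx hy => ⟨BW3.add_mem hx.1 hy.1, fun a ha => by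
    rw [Pi.add_apply, hx.2 a ha, hy.2 a ha, add_zero]⟩
  smul_mem' := fun c x hx => ⟨BW3.smul_mem c hx.1, fun a ha => by
    rw [Pi.smul_apply, hx.2 a ha, smul_zero]⟩

theorem mem_coordLat : x ∈ coordLat S ↔ x ∈ BW3 ∧ ∀ a, a ∉ S → x a = 0 := Iff.rfl

theorem axis_mem_coordLat {a : Idx} (ha : a ∈ S) : axis a ∈ coordLat S :=
  ⟨axis_mem a, fun b hb => by rw [axis_apply, if_neg]; rintro rfl; exact hb ha⟩

theorem ann_coordLat (S : Finset Idx) : ann (coordLat S) = coordLat Sᶜ := by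
  ext x
  rw [mem_ann_iff, mem_coordLat]
  refine and_congr Iff.rfl ⟨fun h a ha => ?_, fun h y hy => ?_⟩
  · rw [Finset.mem_compl, not_not] at ha
    rw [← form_axis x a, h _ (axis_mem_coordLat ha)]
  · rw [form, Finset.sum_eq_zero, mul_zero]
    intro a _
    by_cases ha : a ∈ S
    · rw [h a (by simpa using ha), zero_mul]
    · rw [hy.2 a ha, mul_zero]

theorem exists_int_coord (hx : x ∈ BW3) : ∃ n : Idx → ℤ, ∀ a, x a = n a :=
  let ⟨n, hn, _⟩ := mem_BW3_iff.1 hx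
  ⟨n, hn⟩

theorem two_smul_eq_sum {n : Idx → ℤ} (hn : ∀ a, x a = n a) :
    (2 : ℤ) • x = ∑ a, n a • axis a := by
  funext b
  simp [axis_apply, hn, mul_comm]

theorem sum_axis_mem_coordLat (n : Idx → ℤ) (S : Finset Idx) :
    ∑ a ∈ S, n a • axis a ∈ coordLat S :=
  Submodule.sum_mem _ fun _ ha => Submodule.smul_mem _ _ (axis_mem_coordLat ha)

theorem isRSSD_coordLat (S : Finset Idx) : IsRSSD (coordLat S) := by
  refine ⟨fun x hx => hx.1, fun n x hn hx h => ⟨hx, fun a ha => ?_⟩, fun x hx => ?_⟩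
  · have := h.2 a ha
    simpa [hn] using this
  · obtain ⟨n, hn⟩ := exists_int_coord hx
    rw [ann_coordLat, two_smul_eq_sum hn, ← Finset.sum_add_sum_compl S]
    exact Submodule.add_mem_sup (sum_axis_mem_coordLat n S) (sum_axis_mem_coordLat n Sᶜ)

theorem linearIndependent_axis : LinearIndependent ℤ (fun a : S => axis a) := by
  rw [Fintype.linearIndependent_iff]
  intro c hc a
  have := congrFun hc a
  rw [Finset.sum_apply, Finset.sum_eq_single a] at this
  · simpa [axis_self] using this
  · intro b _ hb
    rw [Pi.smul_apply, axis_apply, if_neg, smul_zero]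
    exact fun h => hb (Subtype.ext h.symm)
  · simp

/-- The span of the axes of `S` lies between `2 • coordLat S` and `coordLat S`, so all three have
the same rank. -/
theorem finrank_coordLat (S : Finset Idx) : Module.finrank ℤ (coordLat S) = S.card := by
  have hspan : Module.finrank ℤ (Submodule.span ℤ (Set.range fun a : S => axis a)) = S.card := by
    rw [finrank_span_eq_card linearIndependent_axis, Fintype.card_coe]
  have hle : Submodule.span ℤ (Set.range fun a : S => axis a) ≤ coordLat S := by
    rw [Submodule.span_le]
    rintro _ ⟨a, rfl⟩
    exact axis_mem_coordLat a.2
  -- twice the lattice lies in the span of the `2 eₐ`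
  have hmap : Submodule.map (LinearMap.lsmul ℤ V 2) (coordLat S) ≤
      Submodule.span ℤ (Set.range fun a : S => axis a) := by
    rintro _ ⟨x, hx, rfl⟩
    obtain ⟨n, hn⟩ := exists_int_coord hx.1
    rw [LinearMap.lsmul_apply, two_smul_eq_sum hn, ← Finset.sum_subset (Finset.subset_univ S)]
    · exact Submodule.sum_mem _ fun a ha => Submodule.smul_mem _ _
        (Submodule.subset_span ⟨⟨a, ha⟩, rfl⟩)
    · intro a _ ha
      have : n a = 0 := by
        have := hx.2 a ha
        rw [hn] at this; exact_mod_cast this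
      rw [this, zero_smul]
  have hinj : Function.Injective (LinearMap.lsmul ℤ V 2) := by
    intro x y h
    funext a
    simpa using congrFun h a
  have heq := (Submodule.equivMapOfInjective _ hinj (coordLat S)).finrank_eq
  have : Module.Finite ℤ (Submodule.span ℤ (Set.range fun a : S => axis a)) :=
    Module.Finite.span_of_finite ℤ (Set.finite_range _)
  have : Module.Finite ℤ (Submodule.map (LinearMap.lsmul ℤ V 2) (coordLat S)) :=
    Module.Finite.of_injective (Submodule.inclusion hmap) (Submodule.inclusion_injective hmap)
  have : Module.Finite ℤ (coordLat S) :=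
    Module.Finite.equiv (Submodule.equivMapOfInjective _ hinj (coordLat S)).symm
  apply le_antisymm
  · rw [heq, ← hspan]
    exact Submodule.finrank_mono hmap
  · rw [← hspan]
    exact Submodule.finrank_mono hle

/-! ### Existence of roots -/

theorem exists_split (hM : IsRSSD M) (hx : x ∈ BW3) :
    ∃ m ∈ M, ∃ a ∈ ann M, x + x = m + a := by
  obtain ⟨m, hm, a, ha, h⟩ := Submodule.mem_sup.1 (hM.two_smul_mem x hx)
  exact ⟨m, hm, a, ha, by rw [h, two_smul]⟩

theorem form_eq_zero_of_mem_ann {m a : V} (hm : m ∈ M) (ha : a ∈ ann M) : form m a = 0 := by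
  rw [form_comm]; exact ha.2 m hm

theorem mem_of_add_self_mem (hM : IsRSSD M) (hx : x ∈ BW3) (h : x + x ∈ M) : x ∈ M :=
  hM.primitive 2 x two_ne_zero hx (by rwa [two_smul])

theorem mem_ann_of_add_self_mem (hx : x ∈ BW3) (h : x + x ∈ ann M) : x ∈ ann M := by
  refine ⟨hx, fun y hy => ?_⟩
  have := h.2 y hy
  rw [form_add_left] at this; linarith

/-- The position of a root relative to an RSSD sublattice. -/
theorem root_split_cases (hM : IsRSSD M) (hr : IsRoot r) :
    (∃ s, IsRoot s ∧ form r s = 0 ∧ r + s ∈ ann M) ∨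
    ∃ s, IsRoot s ∧ (s ∈ M ∨ s ∈ ann M) ∧
      ∀ y, y ∈ M ∨ y ∈ ann M → form r y = 0 → form s y = 0 := by
  obtain ⟨m, hm, a, ha, h⟩ := exists_split hM hr.1
  have hma := form_eq_zero_of_mem_ann hm ha
  have ham : form a m = 0 := by rw [form_comm]; exact hma
  obtain ⟨k, hk⟩ := exists_form_self_eq (hM.le hm)
  obtain ⟨l, hl⟩ := exists_form_self_eq ha.1
  have hrm : 2 * form r m = form m m := by
    have : form (r + r) m = form (m + a) m := by rw [h]
    rw [form_add_left, form_add_left, ham] at this; linarith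
  have hra : 2 * form r a = form a a := by
    have : form (r + r) a = form (m + a) a := by rw [h]
    rw [form_add_left, form_add_left, hma] at this; linarith
  have hrr : 2 * form r r = form r m + form r a := by
    have : form r (r + r) = form r (m + a) := by rw [h]
    rw [form_add_right, form_add_right] at this; linarith
  have hkl : k + l = 4 := by
    have : ((k + l : ℕ) : ℚ) = 4 := by push_cast; linarith [hr.2]
    exact_mod_cast this
  have hmy : ∀ y, y ∈ M ∨ y ∈ ann M → form r y = 0 → form m y = 0 ∧ form a y = 0 := by
    intro y hy hry
    have h1 : form (r + r) y = form m y + form a y := by rw [h, form_add_left]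
    rw [form_add_left, hry] at h1
    rcases hy with hy | hy
    · have := ha.2 y hy
      exact ⟨by linarith, this⟩
    · have := form_eq_zero_of_mem_ann hm hy
      exact ⟨this, by linarith⟩
  have hk4 : k ≤ 4 := by omega
  -- Here `2r = m + a` with norms `2k + 2l = 8`. Norm 0 puts `r` itself in `M` or in `ann M`, and
  -- norm 2 makes the corresponding summand a root. In the balanced case `k = l = 2` the vector `s =
  -- r - m` is a root orthogonal to `r`, and `r + s = a`.
  interval_cases k
  · have hm0 : m = 0 := form_self_eq_zero (by rw [hk]; norm_num)
    rw [hm0, zero_add] at h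
    exact Or.inr ⟨r, hr, Or.inr (mem_ann_of_add_self_mem hr.1 (h ▸ ha)), fun _ _ h => h⟩
  · exact Or.inr ⟨m, ⟨hM.le hm, by rw [hk]; norm_num⟩, Or.inl hm, fun y hy hry => (hmy y hy hry).1⟩
  · refine Or.inl ⟨r - m, ⟨BW3.sub_mem hr.1 (hM.le hm), ?_⟩, ?_, ?_⟩
    · rw [form_sub_left, form_sub_right, form_sub_right, form_comm m r, hr.2]
      push_cast at hk
      linarith
    · push_cast at hk
      rw [form_sub_right, hr.2]; linarith
    · rwa [← add_sub_assoc, h, add_sub_cancel_left]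
  · obtain rfl : l = 1 := by omega
    exact Or.inr ⟨a, ⟨ha.1, by rw [hl]; norm_num⟩, Or.inr ha, fun y hy hry => (hmy y hy hry).2⟩
  · obtain rfl : l = 0 := by omega
    have ha0 : a = 0 := form_self_eq_zero (by rw [hl]; norm_num)
    rw [ha0, add_zero] at h
    exact Or.inr ⟨r, hr, Or.inl (mem_of_add_self_mem hM hr.1 (h ▸ hm)), fun _ _ h => h⟩

theorem exists_orthogonal_root (hr : IsRoot r) : ∃ s, IsRoot s ∧ form s r = 0 := by
  obtain ⟨w, hw, -, b, -, hb⟩ := exists_move_root (S := ∅) hr (by simp)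
  have hw' := weylGroup_le (inv_mem hw)
  refine ⟨w⁻¹ (axis (b + 1)), isRoot_apply hw' (isRoot_axis _), ?_⟩
  have hr' : r = w⁻¹ (axis b) := by rw [← hb, LinearEquiv.coe_inv, w.symm_apply_apply]
  rw [hr', hw'.1, form_axis_axis, if_neg]
  simp

/-- A balanced splitting of some root gives the pair at once. Otherwise there is a root in `M` or
`ann M`; a root orthogonal to it is split in turn, and the last clause of `root_split_cases` keeps
the orthogonality. -/
theorem exists_orthogonal_roots_add_mem (hM : IsRSSD M) :
    ∃ r s, IsRoot r ∧ IsRoot s ∧ form r s = 0 ∧ r + s ∈ M ⊔ ann M := by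
  rcases root_split_cases hM (isRoot_axis 0) with ⟨s, hs, h0, h⟩ | ⟨r, hr, hrM, -⟩
  · exact ⟨_, s, isRoot_axis 0, hs, h0, Submodule.mem_sup_right h⟩
  obtain ⟨t, ht, htr⟩ := exists_orthogonal_root hr
  rcases root_split_cases hM ht with ⟨s, hs, h0, h⟩ | ⟨s, hs, hsM, h⟩
  · exact ⟨t, s, ht, hs, h0, Submodule.mem_sup_right h⟩
  · have hmem : ∀ x, x ∈ M ∨ x ∈ ann M → x ∈ M ⊔ ann M := fun x hx =>
      hx.elim (fun h => Submodule.mem_sup_left h) (fun h => Submodule.mem_sup_right h)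
    exact ⟨r, s, hr, hs, by rw [form_comm]; exact h r hrM htr,
      Submodule.add_mem _ (hmem r hrM) (hmem s hsM)⟩

/-! ### Frames of norm 4 vectors congruent modulo `2L`. -/

theorem exists_affine_eq_parallel_lines : ∀ d δ : Idx, ∃ (c : ZMod 2) (b : Idx), ∀ z : Idx,
    (if z = d then 1 else 0) + (if z = d + δ then 1 else 0) + (if z = 0 then 1 else 0) +
      (if z = δ then 1 else 0 : ZMod 2) = c + b ⬝ᵥ z := by decide +kernel

theorem idx_add_self (a : Idx) : a + a = 0 := by
  funext i
  exact CharTwo.add_self_eq_zero (a i)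

theorem idx_add_add_cancel (a b : Idx) : a + (a + b) = b := by
  rw [← add_assoc, idx_add_self, zero_add]

theorem idx_add_eq_zero {a b : Idx} : a + b = 0 ↔ a = b := by
  refine ⟨fun h => ?_, by rintro rfl; exact idx_add_self _⟩
  rw [← zero_add b, ← h, add_assoc, idx_add_self, add_zero]

theorem idx_eq_add_iff (a b c : Idx) : a = b + c ↔ a + b = c := by
  constructor
  · rintro rfl; rw [add_comm b c, add_assoc, idx_add_self, add_zero]
  · rintro rfl; rw [add_comm a b, idx_add_add_cancel]

/-- Sums of parallel pairs `2 e_c ± 2 e_{c+δ}` are congruent modulo `2 L`. -/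
theorem exists_half_sub (a c δ : Idx) {k : ℤ} (hk : k = 1 ∨ k = -1) :
    ∃ z ∈ BW3, axis c + k • axis (c + δ) = axis a + axis (a + δ) + (z + z) := by
  let n : Idx → ℤ := fun x => (if x = c then 1 else 0) + k * (if x = c + δ then 1 else 0) -
    (if x = a then 1 else 0) - (if x = a + δ then 1 else 0)
  refine ⟨fun x => n x, mem_BW3_iff.2 ⟨n, fun _ => rfl, ?_⟩, ?_⟩
  · obtain ⟨u, b, h⟩ := exists_affine_eq_parallel_lines (a + c) δ
    refine ⟨u + b ⬝ᵥ a, b, fun x => ?_⟩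
    have h' := h (x + a)
    have e1 : x + a = a + c ↔ x = c := by rw [add_comm x a, add_right_inj]
    have e2 : x + a = a + c + δ ↔ x = c + δ := by rw [add_comm x a, add_assoc, add_right_inj]
    have e3 : x + a = 0 ↔ x = a := by rw [← idx_eq_add_iff, add_zero]
    have e4 : x + a = δ ↔ x = a + δ := by rw [← idx_eq_add_iff]
    simp only [e1, e2, e3, e4, dotProduct_add] at h'
    rw [show u + b ⬝ᵥ a + b ⬝ᵥ x = u + (b ⬝ᵥ x + b ⬝ᵥ a) by ring, ← h']
    have hk2 : (k : ZMod 2) = 1 := by rcases hk with rfl | rfl <;> decide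
    simp only [n]
    push_cast
    rw [hk2]
    have hneg : ∀ z : ZMod 2, -z = z := by decide
    rw [sub_eq_add_neg, sub_eq_add_neg, hneg, hneg, one_mul]
  · funext x
    rw [Pi.add_apply, Pi.add_apply, Pi.add_apply, Pi.add_apply, Pi.smul_apply, zsmul_eq_mul]
    simp only [axis_apply, n]
    push_cast
    split_ifs <;> ring

theorem exists_dotProduct_eq_one : ∀ δ : Idx, δ ≠ 0 → ∃ b : Idx, b ⬝ᵥ δ = 1 := by
  decide +kernel

/-- The norm 4 vectors `±axis c ± axis (c + δ)` are all congruent mod `2L`, so all lie in `M + ann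
M`, and without roots in `M` each lies in `M` or in `ann M`. Two orthogonal ones in `M` would have
half their sum, a root, in `M`. So either all of them are orthogonal to `M`, which is then 0, or up
to sign a single one `v` is in `M`. The latter is impossible: splitting `2χ` for a lattice vector
`χ` with `(χ, v) = 1` puts `v/2`, of norm 1, in the lattice. -/
theorem eq_bot_of_no_root (hM : IsRSSD M) (hroot : ∀ r, IsRoot r → r ∉ M) {a δ : Idx}
    (hδ : δ ≠ 0) (h : axis a + axis (a + δ) ∈ M ⊔ ann M) : M = ⊥ := by
  let v : Idx → ℤ → V := fun c k => axis c + k • axis (c + δ)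
  have hne : ∀ c : Idx, c ≠ c + δ := fun c hc => hδ (by simpa using hc)
  have hform : ∀ y c k, form y (v c k) = y c + k * y (c + δ) := fun y c k => by
    simp only [v, form_add_right, form_zsmul_right, form_axis]
  have hvv : ∀ c k, k = 1 ∨ k = -1 → form (v c k) (v c k) = 4 := by
    intro c k hk
    rw [hform]
    simp only [v, Pi.add_apply, Pi.smul_apply, axis_apply, if_neg (hne c), if_neg (hne c).symm]
    rcases hk with rfl | rfl <;> norm_num
  have hmem : ∀ c k, k = 1 ∨ k = -1 → v c k ∈ M ⊔ ann M := by
    intro c k hk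
    obtain ⟨z, hz, hzv⟩ := exists_half_sub a c δ hk
    simp only [v]
    rw [hzv]
    refine Submodule.add_mem _ h ?_
    rw [← two_smul ℤ z]
    exact hM.two_smul_mem z hz
  have h1 : ∀ c k, k = 1 ∨ k = -1 → v c k ∈ M ∨ v c k ∈ ann M := by
    intro c k hk
    obtain ⟨m, hm, b, hb, hmb⟩ := Submodule.mem_sup.1 (hmem c k hk)
    have hma := form_eq_zero_of_mem_ann hm hb
    have h4 := hvv c k hk
    rw [← hmb, form_add_left, form_add_right, form_add_right, form_comm b m, hma] at h4
    obtain ⟨p, hp⟩ := exists_form_self_eq (hM.le hm)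
    obtain ⟨q, hq⟩ := exists_form_self_eq hb.1
    -- The norm 4 is split as `2p + 2q`; the case `p = q = 1` would give a root in `M`.
    have hpq : p + q = 2 := by
      have : ((p + q : ℕ) : ℚ) = 2 := by push_cast; linarith
      exact_mod_cast this
    have hp2 : p ≤ 2 := by omega
    interval_cases p
    · have hm0 : m = 0 := form_self_eq_zero (by rw [hp]; norm_num)
      right; rwa [← hmb, hm0, zero_add]
    · exact absurd hm (hroot m ⟨hM.le hm, by rw [hp]; norm_num⟩)
    · obtain rfl : q = 0 := by omega
      have hb0 : b = 0 := form_self_eq_zero (by rw [hq]; norm_num)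
      left; rwa [← hmb, hb0, add_zero]
  by_cases hall : ∀ c k, k = 1 ∨ k = -1 → v c k ∈ ann M
  -- Orthogonality to both `v c 1` and `v c (-1)` kills the coordinate at `c`.
  · rw [Submodule.eq_bot_iff]
    intro m hm
    funext c
    have e1 := form_eq_zero_of_mem_ann hm (hall c 1 (Or.inl rfl))
    have e2 := form_eq_zero_of_mem_ann hm (hall c (-1) (Or.inr rfl))
    rw [hform] at e1 e2
    push_cast at e1 e2
    rw [Pi.zero_apply]; linarith
  exfalso
  push Not at hall
  obtain ⟨c, k, hk, hc⟩ := hall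
  have hcM := (h1 c k hk).resolve_right hc
  have hk' : -k = 1 ∨ -k = -1 := by omega
  -- the other vectors of the frame are orthogonal to `M`
  have h2 : v c (-k) ∈ ann M := by
    -- The sum of `v c k` and `v c (-k)` is twice the root `axis c`.
    refine (h1 c (-k) hk').resolve_left fun hneg => hroot _ (isRoot_axis c) ?_
    refine mem_of_add_self_mem hM (axis_mem c) ?_
    have := M.add_mem hcM hneg
    simp only [v] at this
    convert this using 1
    module
  have h3 : ∀ c', c' ≠ c → c' ≠ c + δ → ∀ k', k' = 1 ∨ k' = -1 → v c' k' ∈ ann M := by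
    intro c' hc1 hc2 k' hk2
    refine (h1 c' k' hk2).resolve_left fun hv' => ?_
    obtain ⟨z, hz, hzv⟩ := exists_half_sub a c δ hk
    obtain ⟨z', hz', hzv'⟩ := exists_half_sub a c' δ hk2
    -- This is half the sum of the orthogonal vectors `v c k` and `v c' k'`, hence a lattice vector
    -- of norm 2.
    let u : V := axis a + axis (a + δ) + (z + z')
    have hu : u ∈ BW3 := BW3.add_mem (BW3.add_mem (axis_mem _) (axis_mem _)) (BW3.add_mem hz hz')
    have huu : u + u = v c k + v c' k' := by
      simp only [v, u]
      rw [hzv, hzv']; abel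
    refine hroot u ⟨hu, ?_⟩ (mem_of_add_self_mem hM hu (huu ▸ M.add_mem hcM hv'))
    have h8 : form (u + u) (u + u) = 8 := by
      have hc3 : c + δ ≠ c' + δ := fun h => hc1 (add_right_cancel h).symm
      have hc4 : c ≠ c' + δ := fun h => hc2 (by
        rw [h, add_assoc, idx_add_self, add_zero])
      have h0 : form (v c k) (v c' k') = 0 := by
        rw [hform]
        simp [v, axis_apply, hc1, hc2, hc3.symm, hc4.symm]
      rw [huu, form_add_left, form_add_right (v c k) (v c k), form_add_right (v c' k') (v c k),
        form_comm (v c' k') (v c k), h0, hvv c k hk, hvv c' k' hk2]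
      norm_num
    rw [form_add_left, form_add_right] at h8
    linarith
  -- a lattice vector with odd inner product with `v c k`
  obtain ⟨u, b, hu, hu'⟩ : ∃ (u : ZMod 2) (b : Idx), u + b ⬝ᵥ c = 1 ∧ u + b ⬝ᵥ (c + δ) = 0 := by
    obtain ⟨b, hb⟩ := exists_dotProduct_eq_one δ hδ
    refine ⟨1 + b ⬝ᵥ c, b, ?_, ?_⟩
    · rw [add_assoc, CharTwo.add_self_eq_zero, add_zero]
    · rw [dotProduct_add, hb, add_add_add_comm, add_comm 1, ← add_assoc, add_assoc, add_assoc]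
      generalize b ⬝ᵥ c = t
      revert t; decide
  obtain ⟨m, hm, d, hd, hmd⟩ := exists_split hM (affine_support_mem u b)
  set χ : V := fun a => if u + b ⬝ᵥ a = 1 then 1 else 0 with hχ
  have hχc : χ c = 1 := by simp [hχ, hu]
  have hχd : χ (c + δ) = 0 := by simp only [hχ]; rw [hu']; simp
  have e1 : form m (v c k) = 2 := by
    have : form (χ + χ) (v c k) = form m (v c k) + 0 := by
      rw [hmd, form_add_left, form_comm d, form_eq_zero_of_mem_ann hcM hd]
    rw [form_add_left, hform, hχc, hχd] at this
    linarith
  have e2 : form m (v c (-k)) = 0 := form_eq_zero_of_mem_ann hm h2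
  -- The component `m` of `2χ` is orthogonal to the rest of the frame and has inner product 2 with
  -- `v c k`, whose norm is 4; so it is half of `v c k` and has the forbidden norm 1.
  have hvm : v c k = m + m := by
    rw [hform] at e1 e2
    push_cast at e2
    have hmc : m c = 1 := by linarith
    have hmd : (k : ℚ) * m (c + δ) = 1 := by linarith
    funext c'
    by_cases hc1 : c' = c
    · subst hc1
      simp only [v, Pi.add_apply, Pi.smul_apply, axis_apply, if_neg (hne c'), hmc]
      norm_num
    by_cases hc2 : c' = c + δ
    · subst hc2
      have : m (c + δ) = k := by
        rcases hk with rfl | rfl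
        · push_cast at hmd ⊢; linarith
        · push_cast at hmd ⊢; linarith
      simp only [v, Pi.add_apply, Pi.smul_apply, axis_apply, if_neg (hne c).symm, this]
      simp; ring
    · have e3 := form_eq_zero_of_mem_ann hm (h3 c' hc1 hc2 1 (Or.inl rfl))
      have e4 := form_eq_zero_of_mem_ann hm (h3 c' hc1 hc2 (-1) (Or.inr rfl))
      rw [hform] at e3 e4
      push_cast at e3 e4
      have : m c' = 0 := by linarith
      simp [v, axis_apply, hc1, hc2, this]
  have h4 := hvv c k hk
  rw [hvm, form_add_left, form_add_right] at h4
  obtain ⟨p, hp⟩ := exists_form_self_eq (hM.le hm)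
  have : ((2 * p : ℕ) : ℚ) = 1 := by push_cast; linarith
  have : 2 * p = 1 := by exact_mod_cast this
  omega

theorem exists_move_two_roots (hr : IsRoot r) (hs : IsRoot s) (hrs : form r s = 0) :
    ∃ w ∈ weylGroup, ∃ a b, a ≠ b ∧ w r = axis a ∧ w s = axis b := by
  obtain ⟨w, hw, -, a, -, ha⟩ := exists_move_root (S := ∅) hr (by simp)
  obtain ⟨w', hw', hfix, b, hab, hb⟩ := exists_move_root (S := {a})
    (isRoot_apply (weylGroup_le hw) hs) (fun c hc => by
      rw [Finset.mem_singleton.1 hc, ← form_axis (w s) a, ← ha, form_comm, (weylGroup_le hw).1, hrs])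
  refine ⟨w' * w, mul_mem hw' hw, a, b, fun h => hab (by simp [h]), ?_, hb⟩
  rw [LinearEquiv.mul_apply, ha, hfix a (by simp)]

theorem exists_root_mem (hM : IsRSSD M) (h0 : M ≠ ⊥) : ∃ r, IsRoot r ∧ r ∈ M := by
  by_contra! hroot
  obtain ⟨r, s, hr, hs, hrs, h⟩ := exists_orthogonal_roots_add_mem hM
  obtain ⟨w, hw, a, b, hab, ha, hb⟩ := exists_move_two_roots hr hs hrs
  have hw' := weylGroup_le hw
  have hbot : w • M = ⊥ := by
    refine eq_bot_of_no_root (a := a) (δ := a + b) (isRSSD_smul hw' hM) (fun t ht htM => ?_)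
      (fun h => hab ?_) ?_
    · exact hroot _ (isRoot_apply (latticeIsometries.inv_mem hw') ht) (mem_smul_iff.1 htM)
    · rw [← add_zero b, idx_eq_add_iff]; exact h
    · rw [idx_add_add_cancel, ← ha, ← hb, ← map_add, ann_smul hw']
      obtain ⟨m, hm, c, hc, hmc⟩ := Submodule.mem_sup.1 h
      rw [← hmc, map_add]
      exact Submodule.add_mem_sup (apply_mem_smul_iff.2 hm) (apply_mem_smul_iff.2 hc)
  apply h0
  rw [Submodule.eq_bot_iff]
  intro x hx
  have : w x ∈ w • M := apply_mem_smul_iff.2 hx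
  rw [hbot, Submodule.mem_bot] at this
  simpa using this

/-! ### Reduction to coordinate sublattices -/

/-- If `2x = m + a`, then `a` vanishes on `S`, so the part of `m` on `S` is the combination `∑ n b •
axis b` with `n` the coordinates of `x`. It lies in `M` and is orthogonal to `coordLat Sᶜ`, so it
may be shifted from `m` to `a`. -/
theorem isRSSD_inf_coordLat (hM : IsRSSD M) (hS : ∀ a ∈ S, axis a ∈ M) :
    IsRSSD (M ⊓ coordLat Sᶜ) := by
  refine ⟨fun x hx => hM.le hx.1, fun n x hn hx h => ⟨hM.primitive n x hn hx h.1,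
    (isRSSD_coordLat _).primitive n x hn hx h.2⟩, fun x hx => ?_⟩
  obtain ⟨m, hm, a, ha, h⟩ := Submodule.mem_sup.1 (hM.two_smul_mem x hx)
  obtain ⟨n, hn⟩ := exists_int_coord hx
  have haS : ∀ b ∈ S, a b = 0 := fun b hb => by
    rw [← form_axis a b, ha.2 _ (hS b hb)]
  have hmS : ∀ b ∈ S, m b = 2 * n b := fun b hb => by
    have := congrFun h b
    rw [Pi.add_apply, haS b hb, Pi.smul_apply, hn] at this
    simpa using this
  have hsum : ∑ b ∈ S, n b • axis b ∈ M :=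
    M.sum_mem fun b hb => M.smul_mem _ (hS b hb)
  have hsupp : ∀ c ∈ S, (∑ b ∈ S, n b • axis b) c = 2 * n c := by
    intro c hc
    simp [axis_apply, hc, mul_comm]
  have hx' : (2 : ℤ) • x = (m - ∑ b ∈ S, n b • axis b) + (a + ∑ b ∈ S, n b • axis b) := by
    rw [← h]; abel
  rw [hx']
  refine Submodule.add_mem_sup ⟨M.sub_mem hm hsum, BW3.sub_mem (hM.le hm) (hM.le hsum), ?_⟩
    ⟨BW3.add_mem ha.1 (hM.le hsum), ?_⟩
  · intro c hc
    have hc' : c ∈ S := by simpa using hc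
    rw [Pi.sub_apply, hsupp c hc', hmS c hc', sub_self]
  · intro y hy
    have hann := (sum_axis_mem_coordLat n S)
    have h0 : form (∑ b ∈ S, n b • axis b) y = 0 :=
      form_eq_zero_of_mem_ann hann (by rw [ann_coordLat]; exact hy.2)
    rw [form_add_left, ha.2 y hy.1, h0, add_zero]

/-- `S` records the axes already inside `M`. If the part of `M` off `S` is nonzero, it contains a
root, which is moved to a new axis while the axes of `S` stay fixed; if it is zero, primitivity
gives `M = coordLat S`. -/
theorem exists_smul_eq_coordLat_aux (k : ℕ) : ∀ (S : Finset Idx) (M : Submodule ℤ V),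
    IsRSSD M → (∀ a ∈ S, axis a ∈ M) → Sᶜ.card = k →
      ∃ w ∈ weylGroup, ∃ T, w • M = coordLat T := by
  induction k with
  | zero =>
    intro S M hM hS hk
    obtain rfl : S = Finset.univ := by simpa using hk
    refine ⟨1, one_mem _, Finset.univ, ?_⟩
    rw [one_smul]
    refine le_antisymm (fun x hx => ⟨hM.le hx, by simp⟩) fun x hx => ?_
    obtain ⟨n, hn⟩ := exists_int_coord hx.1
    refine hM.primitive 2 x two_ne_zero hx.1 ?_
    rw [two_smul_eq_sum hn]
    exact M.sum_mem fun b hb => M.smul_mem _ (hS b hb)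
  | succ k ih =>
    intro S M hM hS hk
    by_cases h0 : M ⊓ coordLat Sᶜ = ⊥
    · refine ⟨1, one_mem _, S, ?_⟩
      rw [one_smul]
      apply le_antisymm
      all_goals intro x hx
      · refine ⟨hM.le hx, fun a ha => ?_⟩
        obtain ⟨n, hn⟩ := exists_int_coord (hM.le hx)
        -- Doubling makes the projection of `x` off `S` a vector of `M`.
        have hmem : (2 : ℤ) • x - ∑ b ∈ S, n b • axis b ∈ M ⊓ coordLat Sᶜ := by
          refine ⟨M.sub_mem (M.smul_mem _ hx) (M.sum_mem fun b hb => M.smul_mem _ (hS b hb)), ?_⟩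
          rw [two_smul_eq_sum hn, ← Finset.sum_add_sum_compl S, add_sub_cancel_left]
          exact sum_axis_mem_coordLat n Sᶜ
        rw [h0, Submodule.mem_bot, sub_eq_zero] at hmem
        have := congrFun hmem a
        simpa [axis_apply, ha] using this
      · obtain ⟨n, hn⟩ := exists_int_coord hx.1
        refine hM.primitive 2 x two_ne_zero hx.1 ?_
        rw [two_smul_eq_sum hn]
        refine M.sum_mem fun b _ => ?_
        by_cases hb : b ∈ S
        · exact M.smul_mem _ (hS b hb)
        · have : n b = 0 := by
            have := hx.2 b hb
            rw [hn] at this; exact_mod_cast this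
          rw [this, zero_smul]; exact M.zero_mem
    · obtain ⟨r, hr, hrM, hrS⟩ := exists_root_mem (isRSSD_inf_coordLat hM hS) h0
      obtain ⟨w, hw, hfix, b, hb, hwr⟩ := exists_move_root (S := S) hr
        (fun a ha => hrS.2 a (by simpa using ha))
      obtain ⟨w', hw', T, hT⟩ := ih (insert b S) (w • M) (isRSSD_smul (weylGroup_le hw) hM) (by
          intro a ha
          rcases Finset.mem_insert.1 ha with rfl | ha
          · rw [← hwr]; exact apply_mem_smul_iff.2 hrM
          · rw [← hfix a ha]; exact apply_mem_smul_iff.2 (hS a ha)) (by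
          rw [Finset.card_compl, Finset.card_insert_of_notMem hb]
          rw [Finset.card_compl] at hk
          omega)
      exact ⟨w' * w, mul_mem hw' hw, T, by rw [mul_smul, hT]⟩

/-- Every RSSD sublattice is equivalent to a coordinate sublattice. -/
theorem exists_smul_eq_coordLat (hM : IsRSSD M) :
    ∃ w ∈ weylGroup, ∃ T, w • M = coordLat T :=
  exists_smul_eq_coordLat_aux _ ∅ M hM (by simp) rfl

/-! ### Shears -/

/-- The involution `a ↦ a + (c + b ⬝ a) δ` of `𝔽₂³`, where `b ⬝ δ = 0`. -/
def shearPerm (c : ZMod 2) (b δ : Idx) (h : b ⬝ᵥ δ = 0) : Equiv.Perm Idx :=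
  Function.Involutive.toPerm (fun a => a + (c + b ⬝ᵥ a) • δ) fun a => by
    simp only [dotProduct_add, dotProduct_smul, h, smul_zero, add_zero]
    rw [add_assoc, idx_add_self, add_zero]

theorem shearPerm_apply {c : ZMod 2} {b δ : Idx} (h : b ⬝ᵥ δ = 0) (a : Idx) :
    shearPerm c b δ h a = a + (c + b ⬝ᵥ a) • δ := rfl

theorem shearPerm_shearPerm {c : ZMod 2} {b δ : Idx} (h : b ⬝ᵥ δ = 0) (a : Idx) :
    shearPerm c b δ h (shearPerm c b δ h a) = a :=
  (shearPerm c b δ h).symm_apply_apply a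

/-- The coordinate permutation of `V` induced by a shear of `𝔽₂³`. -/
def shear (c : ZMod 2) (b δ : Idx) (h : b ⬝ᵥ δ = 0) : V ≃ₗ[ℚ] V :=
  LinearEquiv.funCongrLeft ℚ ℚ (shearPerm c b δ h)

theorem shear_apply {c : ZMod 2} {b δ : Idx} (h : b ⬝ᵥ δ = 0) (x : V) (a : Idx) :
    shear c b δ h x a = x (a + (c + b ⬝ᵥ a) • δ) := rfl

theorem shear_shear {c : ZMod 2} {b δ : Idx} (h : b ⬝ᵥ δ = 0) (x : V) :
    shear c b δ h (shear c b δ h x) = x := by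
  funext a
  exact congrArg x (shearPerm_shearPerm h a)

theorem shear_inv {c : ZMod 2} {b δ : Idx} (h : b ⬝ᵥ δ = 0) :
    (shear c b δ h)⁻¹ = shear c b δ h := by
  rw [inv_eq_iff_mul_eq_one]
  exact LinearEquiv.ext fun x => shear_shear h x

theorem shear_axis {c : ZMod 2} {b δ : Idx} (h : b ⬝ᵥ δ = 0) (a : Idx) :
    shear c b δ h (axis a) = axis (shearPerm c b δ h a) := by
  funext d
  rw [shear_apply, axis_apply, axis_apply, ← shearPerm_apply h]
  congr 1
  rw [eq_iff_iff]
  constructor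
  · intro h'; rw [← h', shearPerm_shearPerm]
  · intro h'; rw [h', shearPerm_shearPerm]

/-! ### Signs -/

/-- The sign `(-1)^z`. -/
def sgn (z : ZMod 2) : ℤ := if z = 0 then 1 else -1

theorem sgn_add (y z : ZMod 2) : sgn (y + z) = sgn y * sgn z := by
  revert y z; decide

theorem sgn_mul_self (z : ZMod 2) : sgn z * sgn z = 1 := by
  revert z; decide

theorem sgn_cases (z : ZMod 2) : sgn z = 1 ∨ sgn z = -1 := by
  revert z; decide

theorem sgn_zmod (z : ZMod 2) : ((sgn z : ℤ) : ZMod 2) = 1 := by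
  revert z; decide

/-- The vector supported on the plane `c + b ⬝ a = 1`, with entries the signs `(-1)^(f a)`. -/
def planeVec (c : ZMod 2) (b : Idx) (f : Idx → ZMod 2) : V :=
  fun a => if c + b ⬝ᵥ a = 1 then (sgn (f a) : ℚ) else 0

theorem isRoot_planeVec (c : ZMod 2) {b : Idx} (hb : b ≠ 0) (f : Idx → ZMod 2) :
    IsRoot (planeVec c b f) := by
  refine ⟨mem_BW3_iff.2 ⟨fun a => if c + b ⬝ᵥ a = 1 then sgn (f a) else 0, fun a => ?_, c, b,
    fun a => ?_⟩, ?_⟩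
  · simp [planeVec]
  · rcases zmod_two_cases (c + b ⬝ᵥ a) with h | h <;> simp [h, sgn_zmod]
  · have h1 : ∀ a, planeVec c b f a * planeVec c b f a =
        ((if c + b ⬝ᵥ a = 1 then 1 else 0 : ℤ) : ℚ) := by
      intro a
      simp only [planeVec]
      split_ifs
      · rw [← Int.cast_mul, sgn_mul_self]
      · simp
    simp only [form, h1]
    rw [← Int.cast_sum, sum_plane_support c b hb]
    norm_num

/-- The vector plane orthogonal to `b` has exactly two characters with value `-1` at `δ`; they agree
at 0 and `δ` and cancel at the other two points. -/
theorem exists_dual_pair : ∀ b δ : Idx, b ≠ 0 → δ ≠ 0 → b ⬝ᵥ δ = 0 → ∃ b₁ b₂ : Idx,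
    ∀ z : Idx, b ⬝ᵥ z = 0 → sgn (b₁ ⬝ᵥ z) + sgn (b₂ ⬝ᵥ z) =
      (if z = 0 then 2 else 0) - (if z = δ then 2 else 0) := by decide +kernel

theorem exists_affine_eq_one : ∀ (c : ZMod 2) (b : Idx), b ≠ 0 → ∃ a, c + b ⬝ᵥ a = 1 := by
  decide +kernel

/-- A shear along a plane is a product of two reflections. -/
theorem shear_mem_weylGroup_of_ne_zero (c : ZMod 2) {b δ : Idx} (h : b ⬝ᵥ δ = 0) (hb : b ≠ 0) :
    shear c b δ h ∈ weylGroup := by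
  by_cases hδ : δ = 0
  · have : shear c b δ h = 1 := LinearEquiv.ext fun x => by
      funext a
      rw [shear_apply, hδ, smul_zero, add_zero]; rfl
    rw [this]; exact one_mem _
  obtain ⟨b₁, b₂, h12⟩ := exists_dual_pair b δ hb hδ h
  obtain ⟨s₁, hs₁, hs₁'⟩ := exists_reflection (isRoot_planeVec c hb fun a => b₁ ⬝ᵥ a)
  obtain ⟨s₂, hs₂, hs₂'⟩ := exists_reflection (isRoot_planeVec c hb fun a => b₂ ⬝ᵥ a)
  set r₁ := planeVec c b fun a => b₁ ⬝ᵥ a with hr₁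
  set r₂ := planeVec c b fun a => b₂ ⬝ᵥ a with hr₂
  -- The rank one kernels of the two roots add up to the kernel of `x ↦ 2 (x a - x (a + δ))` on the
  -- plane; with the factor `1/2` of the form, subtracting it turns `x a` into `x (a + δ)`.
  have key : ∀ d a, r₁ d * r₁ a + r₂ d * r₂ a =
      if c + b ⬝ᵥ a = 1 then (if d = a then 2 else 0) - (if d = a + δ then 2 else 0) else 0 := by
    intro d a
    simp only [hr₁, hr₂, planeVec]
    by_cases ha : c + b ⬝ᵥ a = 1
    · simp only [ha, if_true]
      by_cases hd : c + b ⬝ᵥ d = 1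
      · have hz : b ⬝ᵥ (a + d) = 0 := by
          rw [dotProduct_add]
          have : (c + b ⬝ᵥ a) + (c + b ⬝ᵥ d) = 0 := by rw [ha, hd]; decide
          rw [add_add_add_comm, CharTwo.add_self_eq_zero, zero_add] at this
          exact this
        have h' := h12 (a + d) hz
        rw [dotProduct_add, dotProduct_add, sgn_add, sgn_add] at h'
        have e1 : a + d = 0 ↔ d = a := by rw [← idx_eq_add_iff, add_zero, eq_comm]
        have e2 : a + d = δ ↔ d = a + δ := by
          rw [idx_eq_add_iff d a δ, add_comm d a]
        simp only [e1, e2] at h'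
        simp only [hd, if_true]
        have h'' := congrArg (Int.cast : ℤ → ℚ) h'
        push_cast at h''
        linarith
      · have e1 : d ≠ a := by rintro rfl; exact hd ha
        have e2 : d ≠ a + δ := by
          rintro rfl; apply hd; rw [dotProduct_add, h, add_zero, ha]
        simp [hd, e1, e2]
    · simp [ha]
  have hform : ∀ x a, form x r₁ * r₁ a + form x r₂ * r₂ a =
      if c + b ⬝ᵥ a = 1 then x a - x (a + δ) else 0 := by
    intro x a
    have : form x r₁ * r₁ a + form x r₂ * r₂ a =
        (1 / 2) * ∑ d, x d * (r₁ d * r₁ a + r₂ d * r₂ a) := by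
      simp only [form, mul_add, Finset.sum_add_distrib, mul_assoc, Finset.sum_mul]
    rw [this]
    simp only [key]
    split_ifs with ha
    · simp only [mul_sub, Finset.sum_sub_distrib, mul_ite, mul_zero, Finset.sum_ite_eq',
        Finset.mem_univ, if_true]
      ring
    · simp
  -- Since `r₁ (a + δ) = -r₁ a`, the identity `hform` at `x = r₁` leaves no room for a component
  -- along `r₂`.
  have h21 : form r₂ r₁ = 0 := by
    have h1 : IsRoot r₁ := isRoot_planeVec c hb _
    obtain ⟨a, ha⟩ := exists_affine_eq_one c b hb
    have e := hform r₁ a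
    have e' := hform r₂ a
    have h2 : IsRoot r₂ := isRoot_planeVec c hb _
    have hne : b₁ ⬝ᵥ δ = 1 := by
      have := h12 δ h
      rw [if_neg hδ, if_pos rfl] at this
      rcases zmod_two_cases (b₁ ⬝ᵥ δ) with h0 | h0
      · rcases sgn_cases (b₂ ⬝ᵥ δ) with h3 | h3 <;> rw [h0, h3] at this <;> simp [sgn] at this
      · exact h0
    have hr : r₁ (a + δ) = -r₁ a := by
      simp only [hr₁, planeVec, dotProduct_add, h, add_zero, ha, if_true, hne, sgn_add]
      simp [sgn]
    rw [if_pos ha, hr, h1.2] at e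
    have hr2 : r₂ a ≠ 0 := by
      simp only [hr₂, planeVec, ha, if_true]
      rcases sgn_cases (b₂ ⬝ᵥ a) with h3 | h3 <;> rw [h3] <;> norm_num
    have : form r₁ r₂ * r₂ a = 0 := by linarith
    rw [form_comm]
    exact (mul_eq_zero.1 this).resolve_right hr2
  have : shear c b δ h = s₁ * s₂ := LinearEquiv.ext fun x => by
    funext a
    rw [LinearEquiv.mul_apply, hs₁', hs₂', form_sub_left, form_smul_left, h21, mul_zero, sub_zero,
      shear_apply, Pi.sub_apply, Pi.sub_apply, Pi.smul_apply, Pi.smul_apply, smul_eq_mul,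
      smul_eq_mul, sub_sub, add_comm (form x r₂ * r₂ a), hform]
    rcases zmod_two_cases (c + b ⬝ᵥ a) with ha | ha <;> simp [ha]
  rw [this]
  exact mul_mem hs₁ hs₂

theorem exists_ne_zero_orthogonal : ∀ δ : Idx, ∃ b : Idx, b ≠ 0 ∧ b ⬝ᵥ δ = 0 := by
  decide +kernel

theorem shear_mem_weylGroup (c : ZMod 2) {b δ : Idx} (h : b ⬝ᵥ δ = 0) :
    shear c b δ h ∈ weylGroup := by
  by_cases hb : b = 0
  · obtain ⟨b', hb', h'⟩ := exists_ne_zero_orthogonal δ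
    -- For `b = 0` the shear is the translation by `c • δ`. For `c = 1` it is carried out on a plane
    -- and on the complementary plane; for `c = 0` the two factors cancel.
    have : shear c b δ h = shear (c + 1) b' δ h' * shear 1 b' δ h' := LinearEquiv.ext fun x => by
      funext a
      rw [LinearEquiv.mul_apply, shear_apply, shear_apply, shear_apply, dotProduct_add,
        dotProduct_smul, h', smul_zero, add_zero, hb, zero_dotProduct, add_assoc a, ← add_smul]
      congr 3
      generalize b' ⬝ᵥ a = t
      revert c t; decide
    rw [this]
    exact mul_mem (shear_mem_weylGroup_of_ne_zero _ h' hb')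
      (shear_mem_weylGroup_of_ne_zero _ h' hb')
  · exact shear_mem_weylGroup_of_ne_zero c h hb

/-! ### Equivalence of coordinate sublattices -/

theorem smul_coordLat (hg : g ∈ latticeIsometries) {π : Equiv.Perm Idx}
    (h : ∀ a, g (axis a) = axis (π a)) (hST : ∀ a, a ∈ S ↔ π a ∈ T) :
    g • coordLat S = coordLat T := by
  have hg' := latticeIsometries.inv_mem hg
  ext x
  rw [mem_smul_iff, mem_coordLat, mem_coordLat, hg'.2]
  refine and_congr Iff.rfl ?_
  have hx : ∀ a, g⁻¹ x a = x (π a) := by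
    intro a
    rw [← form_axis (g⁻¹ x) a, ← hg.1, h, LinearEquiv.coe_inv, g.apply_symm_apply, form_axis]
  constructor
  · intro hS b hb
    rw [← π.apply_symm_apply b, ← hx]
    exact hS _ (by rwa [hST, π.apply_symm_apply])
  · intro hT a ha
    rw [hx]
    exact hT _ (by rwa [← hST])

/-- The coordinate sublattices on `S` and `T` are in one orbit of `G`. -/
def Linked (G : Subgroup (V ≃ₗ[ℚ] V)) (S T : Finset Idx) : Prop :=
  ∃ g ∈ G, g • coordLat S = coordLat T

theorem Linked.trans {G : Subgroup (V ≃ₗ[ℚ] V)} {S T U : Finset Idx} (h : Linked G S T)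
    (h' : Linked G T U) : Linked G S U := by
  obtain ⟨g, hg, h⟩ := h
  obtain ⟨g', hg', h'⟩ := h'
  exact ⟨g' * g, mul_mem hg' hg, by rw [mul_smul, h, h']⟩

theorem Linked.compl {G : Subgroup (V ≃ₗ[ℚ] V)} (hG : G ≤ latticeIsometries)
    (h : Linked G S T) : Linked G Sᶜ Tᶜ := by
  obtain ⟨g, hg, h⟩ := h
  exact ⟨g, hg, by rw [← ann_coordLat, ← ann_smul (hG hg), h, ann_coordLat]⟩

theorem linked_of_shear {G : Subgroup (V ≃ₗ[ℚ] V)} (hG : G ≤ latticeIsometries)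
    {c : ZMod 2} {b δ : Idx} {h : b ⬝ᵥ δ = 0} (hshear : shear c b δ h ∈ G)
    (hST : ∀ a, a ∈ S ↔ shearPerm c b δ h a ∈ T) : Linked G S T :=
  ⟨_, hshear, smul_coordLat (hG hshear) (shear_axis h) hST⟩

-- Modulo `δ`, a functional with value 1 at `p`, `q` and `r` exists unless some relation of odd
-- length holds among them, that is, unless one of `p`, `q`, `r`, `p + q + r` is 0 or `δ`. Those
-- cases are excluded, and for such a functional the premises `b ⬝ᵥ p = 0` and so on never occur.
-- Repeated points are allowed, which covers sets with fewer than three elements.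
set_option synthInstance.maxSize 2000 in
set_option synthInstance.maxHeartbeats 400000 in
theorem exists_exchange_shear_aux : ∀ δ p q r : Idx, (p ≠ 0 ∧ p ≠ δ) ∧ (q ≠ 0 ∧ q ≠ δ) ∧
    (r ≠ 0 ∧ r ≠ δ) ∧ (p + q + r ≠ 0 ∧ p + q + r ≠ δ) → ∃ b : Idx, b ⬝ᵥ δ = 0 ∧
      (b ⬝ᵥ p = 0 → p + δ = q ∨ p + δ = r) ∧ (b ⬝ᵥ q = 0 → q + δ = p ∨ q + δ = r) ∧
      (b ⬝ᵥ r = 0 → r + δ = p ∨ r + δ = q) := by decide +kernel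

theorem exists_exchange_shear (δ : Idx) (P : Finset Idx) (h0 : 0 ∉ P) (hδ : δ ∉ P)
    (hP : P.card ≤ 3) (hsum : P.card = 3 → ∑ p ∈ P, p ≠ 0 ∧ ∑ p ∈ P, p ≠ δ) :
    ∃ b : Idx, b ⬝ᵥ δ = 0 ∧ ∀ p ∈ P, b ⬝ᵥ p = 0 → p + δ ∈ P := by
  have aux : ∀ p q r, P = {p, q, r} → p + q + r ≠ 0 → p + q + r ≠ δ →
      ∃ b : Idx, b ⬝ᵥ δ = 0 ∧ ∀ p ∈ P, b ⬝ᵥ p = 0 → p + δ ∈ P := by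
    rintro p q r rfl h1 h2
    simp only [Finset.mem_insert, Finset.mem_singleton, not_or] at h0 hδ
    obtain ⟨b, hb, hp, hq, hr⟩ := exists_exchange_shear_aux δ p q r ⟨⟨Ne.symm h0.1, Ne.symm hδ.1⟩,
      ⟨Ne.symm h0.2.1, Ne.symm hδ.2.1⟩, ⟨Ne.symm h0.2.2, Ne.symm hδ.2.2⟩, h1, h2⟩
    refine ⟨b, hb, fun a ha hba => ?_⟩
    simp only [Finset.mem_insert, Finset.mem_singleton] at ha ⊢
    rcases ha with rfl | rfl | rfl
    · rcases hp hba with h | h <;> simp [h]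
    · rcases hq hba with h | h <;> simp [h]
    · rcases hr hba with h | h <;> simp [h]
  have hcard : P.card = 0 ∨ P.card = 1 ∨ P.card = 2 ∨ P.card = 3 := by omega
  rcases hcard with h | h | h | h
  · rw [Finset.card_eq_zero] at h
    exact ⟨0, by simp, by simp [h]⟩
  · obtain ⟨p, rfl⟩ := Finset.card_eq_one.1 h
    simp only [Finset.mem_singleton] at h0 hδ
    refine aux p p p (by simp) ?_ ?_ <;> rw [idx_add_self, zero_add]
    exacts [Ne.symm h0, Ne.symm hδ]
  · obtain ⟨p, q, -, rfl⟩ := Finset.card_eq_two.1 h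
    simp only [Finset.mem_insert, Finset.mem_singleton, not_or] at h0 hδ
    refine aux p q q (by simp) ?_ ?_ <;> rw [add_assoc, idx_add_self, add_zero]
    exacts [Ne.symm h0.1, Ne.symm hδ.1]
  · obtain ⟨p, q, r, hpq, hpr, hqr, rfl⟩ := Finset.card_eq_three.1 h
    have := hsum h
    rw [Finset.sum_insert (by simp [hpq, hpr]), Finset.sum_insert (by simp [hqr]),
      Finset.sum_singleton, ← add_assoc] at this
    exact aux p q r rfl this.1 this.2

/-- The shear along `d + a` over the plane through `a` and `d` given by `exists_exchange_shear`,
with `a` taken as origin, exchanges `a` and `d` and preserves `P`. The condition on sums says that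
neither 4-set is a plane. -/
theorem linked_exchange {G : Subgroup (V ≃ₗ[ℚ] V)} (hG : G ≤ latticeIsometries)
    (hshear : ∀ (c : ZMod 2) (b δ : Idx) (h : b ⬝ᵥ δ = 0), shear c b δ h ∈ G)
    {P : Finset Idx} {a d : Idx} (ha : a ∉ P) (hd : d ∉ P) (hP : P.card ≤ 3)
    (hsum : P.card = 3 → ∑ p ∈ P, p ≠ a ∧ ∑ p ∈ P, p ≠ d) :
    Linked G (insert a P) (insert d P) := by
  obtain ⟨b, hb, hbP⟩ := exists_exchange_shear (d + a) (P.image (· + a))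
    (by
      simp only [Finset.mem_image, not_exists, not_and]
      rintro p hp h
      exact ha (idx_add_eq_zero.1 h ▸ hp))
    (by simpa using hd)
    (by rwa [Finset.card_image_of_injective _ (add_left_injective a)])
    (by
      rw [Finset.card_image_of_injective _ (add_left_injective a)]
      intro h3
      rw [Finset.sum_image (fun _ _ _ _ h => add_right_cancel h), Finset.sum_add_distrib,
        Finset.sum_const, h3]
      rw [succ_nsmul, two_nsmul, idx_add_self, zero_add]
      exact ⟨fun h => (hsum h3).1 (idx_add_eq_zero.1 h), fun h => (hsum h3).2 (add_right_cancel h)⟩)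
  have hbP' : ∀ p ∈ P, (1 + b ⬝ᵥ a) + b ⬝ᵥ p = 1 → p + (d + a) ∈ P := by
    intro p hp h
    have h' : b ⬝ᵥ (p + a) = 0 := by
      rw [dotProduct_add]
      linear_combination h
    have := hbP (p + a) (Finset.mem_image_of_mem _ hp) h'
    obtain ⟨q, hq, hq'⟩ := Finset.mem_image.1 this
    have : q = p + (d + a) := add_right_cancel (b := a) (by rw [hq']; abel)
    rwa [← this]
  have hda : b ⬝ᵥ d = b ⬝ᵥ a := by
    rw [dotProduct_add] at hb
    exact CharTwo.add_eq_zero.1 hb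
  refine linked_of_shear hG (hshear (1 + b ⬝ᵥ a) b (d + a) hb) fun z => ?_
  rw [shearPerm_apply]
  have h1a : (1 + b ⬝ᵥ a) + b ⬝ᵥ a = 1 := by rw [add_assoc, CharTwo.add_self_eq_zero, add_zero]
  rcases zmod_two_cases (1 + b ⬝ᵥ a + b ⬝ᵥ z) with hz | hz
  · rw [hz, zero_smul, add_zero]
    have h1 : z ≠ a := by rintro rfl; rw [h1a] at hz; exact one_ne_zero hz
    have h2 : z ≠ d := by rintro rfl; rw [hda, h1a] at hz; exact one_ne_zero hz
    simp [h1, h2]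
  · rw [hz, one_smul, Finset.mem_insert, Finset.mem_insert]
    have hz' : 1 + b ⬝ᵥ a + b ⬝ᵥ (z + (d + a)) = 1 := by rw [dotProduct_add, hb, add_zero, hz]
    have e1 : z + (d + a) = d ↔ z = a := by
      rw [add_left_comm, add_eq_left, idx_add_eq_zero]
    rw [e1]
    refine or_congr Iff.rfl ⟨fun h => hbP' z h hz, fun h => ?_⟩
    have := hbP' _ h hz'
    rwa [add_assoc, idx_add_self, add_zero] at this

/-- One point of `S \ T` at a time is exchanged for a point of `T \ S`. Four points form an affine
plane exactly when their sum is 0, and the intermediate 4-sets must avoid this. -/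
theorem linked_of_card_le {G : Subgroup (V ≃ₗ[ℚ] V)} (hG : G ≤ latticeIsometries)
    (hshear : ∀ (c : ZMod 2) (b δ : Idx) (h : b ⬝ᵥ δ = 0), shear c b δ h ∈ G) (k : ℕ) :
    ∀ S T : Finset Idx, S.card = T.card → S.card ≤ 4 →
      (S.card = 4 → ∑ a ∈ S, a ≠ 0 ∧ ∑ a ∈ T, a ≠ 0) → (T \ S).card = k → Linked G S T := by
  induction k with
  | zero =>
    intro S T hST _ _ hk
    rw [Finset.card_eq_zero, Finset.sdiff_eq_empty_iff_subset] at hk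
    rw [Finset.eq_of_subset_of_card_le hk hST.le]
    exact ⟨1, one_mem _, one_smul _ _⟩
  | succ k ih =>
    intro S T hST h4 hsum hk
    have hk' : (S \ T).card = k + 1 := by
      rw [← hk]; exact Finset.card_sdiff_comm hST
    obtain ⟨a, ha⟩ : (S \ T).Nonempty := by rw [← Finset.card_pos]; omega
    rw [Finset.mem_sdiff] at ha
    have hcard : (S.erase a).card + 1 = S.card := Finset.card_erase_add_one ha.1
    have hsumS : ∑ p ∈ S.erase a, p + a = ∑ p ∈ S, p := Finset.sum_erase_add _ _ ha.1
    -- Only one `d` can complete `S.erase a` to a plane. If it were the only point of `T \ S`, then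
    -- `T` itself would be that plane.
    obtain ⟨d, hd, hdsum⟩ : ∃ d ∈ T \ S, S.card = 4 → ∑ p ∈ S.erase a, p ≠ d := by
      by_contra! hcon
      have hall : ∀ d ∈ T \ S, S.card = 4 ∧ ∑ p ∈ S.erase a, p = d := hcon
      obtain ⟨d, hd⟩ : (T \ S).Nonempty := by rw [← Finset.card_pos]; omega
      have hone : T \ S = {d} :=
        Finset.eq_singleton_iff_unique_mem.2 ⟨hd, fun e he => by rw [← (hall e he).2, (hall d hd).2]⟩
      have hone' : S \ T = {a} := by
        obtain ⟨e, he⟩ := Finset.card_eq_one.1 (show (S \ T).card = 1 by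
          rw [Finset.card_sdiff_comm hST, hone, Finset.card_singleton])
        have : a ∈ S \ T := Finset.mem_sdiff.2 ha
        rw [he, Finset.mem_singleton] at this
        rw [he, this]
      refine (hsum (hall d hd).1).2 ?_
      have hdT := Finset.mem_sdiff.1 hd
      have hT : T.erase d = S.erase a := by
        ext z
        have h1 := Finset.ext_iff.1 hone z
        have h2 := Finset.ext_iff.1 hone' z
        simp only [Finset.mem_sdiff, Finset.mem_singleton] at h1 h2
        simp only [Finset.mem_erase]
        by_cases hzS : z ∈ S <;> by_cases hzT : z ∈ T <;> simp_all
      rw [← Finset.sum_erase_add _ _ hdT.1, hT, (hall d hd).2, idx_add_self]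
    rw [Finset.mem_sdiff] at hd
    have hdP : d ∉ S.erase a := fun h => hd.2 (Finset.mem_of_mem_erase h)
    have hlink := linked_exchange hG hshear (Finset.notMem_erase a S) hdP (by omega) (by
      intro h3
      refine ⟨fun h => (hsum (by omega)).1 ?_, hdsum (by omega)⟩
      rw [← hsumS, h, idx_add_self])
    rw [Finset.insert_erase ha.1] at hlink
    have hcard' : (insert d (S.erase a)).card = S.card := by
      rw [Finset.card_insert_of_notMem hdP, hcard]
    refine hlink.trans (ih _ T (hcard'.trans hST) (by omega) (fun h => ?_) ?_)
    · refine ⟨?_, (hsum (by omega)).2⟩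
      rw [Finset.sum_insert hdP]
      intro h0
      apply hdsum (by omega)
      exact (idx_add_eq_zero.1 h0).symm
    · have : T \ insert d (S.erase a) = (T \ S).erase d := by
        ext z
        simp only [Finset.mem_sdiff, Finset.mem_insert, Finset.mem_erase, not_or, not_and]
        constructor
        · rintro ⟨h1, h2, h3⟩
          exact ⟨h2, h1, h3 (by rintro rfl; exact ha.2 h1)⟩
        · rintro ⟨h1, h2, h3⟩
          exact ⟨h2, h1, fun _ => h3⟩
      rw [this, Finset.card_erase_of_mem (Finset.mem_sdiff.2 hd), hk]
      rfl

theorem exists_plane_through : ∀ u v : Idx, u ≠ 0 → v ≠ 0 → u ≠ v → ∃ b : Idx, b ≠ 0 ∧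
    ∀ z : Idx, (z = 0 ∨ z = u ∨ z = v ∨ z = u + v) ↔ b ⬝ᵥ z = 0 := by decide +kernel

theorem exists_affine_of_plane (hS : S.card = 4) (hsum : ∑ a ∈ S, a = 0) :
    ∃ (c : ZMod 2) (b : Idx), b ≠ 0 ∧ ∀ a, a ∈ S ↔ c + b ⬝ᵥ a = 1 := by
  obtain ⟨p, hp⟩ : S.Nonempty := by rw [← Finset.card_pos]; omega
  obtain ⟨q, r, s, hqr, hqs, hrs, h⟩ := Finset.card_eq_three.1
    (show (S.erase p).card = 3 by rw [Finset.card_erase_of_mem hp, hS])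
  have hpn : p ∉ ({q, r, s} : Finset Idx) := h ▸ Finset.notMem_erase p S
  have hS' : S = {p, q, r, s} := by rw [← h, Finset.insert_erase hp]
  simp only [Finset.mem_insert, Finset.mem_singleton, not_or] at hpn
  have hs : s = p + (q + r) := by
    rw [hS', Finset.sum_insert (by simp [hpn]), Finset.sum_insert (by simp [hqr, hqs]),
      Finset.sum_insert (by simp [hrs]), Finset.sum_singleton] at hsum
    rw [← idx_add_eq_zero, ← hsum]; abel
  obtain ⟨b, hb, hbz⟩ := exists_plane_through (p + q) (p + r)
    (fun h => hpn.1 (idx_add_eq_zero.1 h)) (fun h => hpn.2.1 (idx_add_eq_zero.1 h))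
    (fun h => hqr (add_left_cancel h))
  refine ⟨1 + b ⬝ᵥ p, b, hb, fun a => ?_⟩
  have h1 : 1 + b ⬝ᵥ p + b ⬝ᵥ a = 1 ↔ b ⬝ᵥ (p + a) = 0 := by
    rw [add_assoc, add_eq_left, dotProduct_add]
  have h2 : p + q + (p + r) = p + s := by
    rw [add_add_add_comm, idx_add_self, zero_add, hs, idx_add_add_cancel]
  rw [h1, ← hbz, h2, hS', idx_add_eq_zero, add_right_inj, add_right_inj, add_right_inj]
  simp only [Finset.mem_insert, Finset.mem_singleton, eq_comm]

theorem exists_common_dotProduct_eq_one : ∀ b b' : Idx, b ≠ 0 → b' ≠ 0 →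
    ∃ δ : Idx, b ⬝ᵥ δ = 1 ∧ b' ⬝ᵥ δ = 1 := by decide +kernel

theorem exists_shear_plane (c : ZMod 2) {b : Idx} (hb : b ≠ 0) (c' : ZMod 2) {b' : Idx}
    (hb' : b' ≠ 0) : ∃ (δ : Idx) (h : (b + b') ⬝ᵥ δ = 0),
      ∀ a, c' + b' ⬝ᵥ shearPerm (c + c') (b + b') δ h a = c + b ⬝ᵥ a := by
  obtain ⟨δ, h1, h2⟩ := exists_common_dotProduct_eq_one b b' hb hb'
  refine ⟨δ, by rw [add_dotProduct, h1, h2]; decide, fun a => ?_⟩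
  rw [shearPerm_apply, dotProduct_add, dotProduct_smul, h2, add_dotProduct]
  generalize b ⬝ᵥ a = s
  generalize b' ⬝ᵥ a = t
  revert c c' s t
  decide

/-- The coordinate sublattices on two sets of the same size are equivalent, except that for size 4
affine planes have to be distinguished from the other sets. -/
theorem linked_of_card_eq {G : Subgroup (V ≃ₗ[ℚ] V)} (hG : G ≤ latticeIsometries)
    (hshear : ∀ (c : ZMod 2) (b δ : Idx) (h : b ⬝ᵥ δ = 0), shear c b δ h ∈ G)
    (hST : S.card = T.card) (hsum : S.card = 4 → (∑ a ∈ S, a = 0 ↔ ∑ a ∈ T, a = 0)) :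
    Linked G S T := by
  by_cases h4 : S.card = 4
  · by_cases h0 : ∑ a ∈ S, a = 0
    · obtain ⟨c, b, hb, h⟩ := exists_affine_of_plane h4 h0
      obtain ⟨c', b', hb', h'⟩ := exists_affine_of_plane (hST ▸ h4) ((hsum h4).1 h0)
      obtain ⟨δ, hδ, hs⟩ := exists_shear_plane c hb c' hb'
      exact linked_of_shear hG (hshear _ _ _ hδ) fun a => by rw [h, h', hs]
    · exact linked_of_card_le hG hshear _ S T hST h4.le
        (fun _ => ⟨h0, fun h => h0 ((hsum h4).2 h)⟩) rfl
  rcases le_or_gt S.card 4 with h | h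
  · exact linked_of_card_le hG hshear _ S T hST h (fun h' => absurd h' h4) rfl
  -- Sets of more than four points are compared through their complements, that is, through
  -- annihilators.
  · have hc : Fintype.card Idx = 8 := by simp
    have hS := Finset.card_compl S
    have hT := Finset.card_compl T
    have := linked_of_card_le hG hshear _ Sᶜ Tᶜ (by omega) (by omega) (fun h' => by omega) rfl
    simpa using this.compl hG

/-! ### Classification of the orbits -/

theorem exists_smul_eq_coordLat_card (hM : IsRSSD M) :
    ∃ w ∈ weylGroup, ∃ T : Finset Idx, w • M = coordLat T ∧ T.card = Module.finrank ℤ M := by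
  obtain ⟨w, hw, T, hT⟩ := exists_smul_eq_coordLat hM
  exact ⟨w, hw, T, hT, by rw [← finrank_coordLat, ← hT, finrank_smul]⟩

theorem eq_inv_smul {N : Submodule ℤ V} (h : g • M = N) : M = g⁻¹ • N := by
  rw [← h, inv_smul_smul]

/-- All three claims are invariant under isometries of the lattice, and on coordinate sublattices
`ann` is the complement of the index set. -/
theorem ann_properties (hM : IsRSSD M) :
    IsRSSD (ann M) ∧ Module.finrank ℤ (ann M) + Module.finrank ℤ M = 8 ∧ ann (ann M) = M := by
  obtain ⟨w, hw, T, hT⟩ := exists_smul_eq_coordLat hM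
  have hw' := latticeIsometries.inv_mem (weylGroup_le hw)
  have hc : T.card + Tᶜ.card = Fintype.card Idx := Finset.card_add_card_compl T
  have h8 : Fintype.card Idx = 8 := by simp
  rw [eq_inv_smul hT, ann_smul hw', ann_smul hw', ann_coordLat, ann_coordLat, compl_compl,
    finrank_smul, finrank_smul, finrank_coordLat, finrank_coordLat]
  exact ⟨isRSSD_smul hw' (isRSSD_coordLat _), by omega, rfl⟩

/-! ### Coordinate sublattices spanned by axes, and the sublattices of rank 1, 2, 3, 5 and 7. -/

theorem sum_affine_support_eq_zero : ∀ (c : ZMod 2) (b : Idx), b ≠ 0 →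
    ∑ a ∈ Finset.univ.filter (fun a : Idx => c + b ⬝ᵥ a = 1), a = 0 := by decide +kernel

/-- The odd coordinates form the empty set, a plane or the whole space; `S` is too small for the
last and contains no plane, so all coordinates are even. -/
theorem exists_sum_axis_of_mem_coordLat (hS : S.card ≤ 4) (hS' : S.card = 4 → ∑ a ∈ S, a ≠ 0)
    (hx : x ∈ coordLat S) : ∃ z : Idx → ℤ, x = ∑ a ∈ S, z a • axis a := by
  obtain ⟨n, hn, c, b, h⟩ := mem_BW3_iff.1 hx.1
  have hsub : Finset.univ.filter (fun a : Idx => c + b ⬝ᵥ a = 1) ⊆ S := by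
    intro a ha
    by_contra haS
    have h0 := hx.2 a haS
    rw [hn] at h0
    have h0' : n a = 0 := by exact_mod_cast h0
    have := h a
    rw [(Finset.mem_filter.1 ha).2, h0'] at this
    exact absurd this (by decide)
  have heven : ∀ a, c + b ⬝ᵥ a = 0 := by
    by_cases hb : b = 0
    · rcases zmod_two_cases c with hc | hc
      · simp [hb, hc]
      · have hcard := Finset.card_le_card hsub
        have h8 : Fintype.card Idx = 8 := by simp
        simp only [hb, hc, zero_dotProduct, add_zero, Finset.filter_true, Finset.card_univ] at hcard
        omega
    · exfalso
      have hcard : (Finset.univ.filter (fun a : Idx => c + b ⬝ᵥ a = 1)).card = 4 := by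
        have := sum_plane_support c b hb
        rw [Finset.sum_boole] at this
        exact_mod_cast this
      have heq := Finset.eq_of_subset_of_card_le hsub (by omega)
      refine hS' (heq ▸ hcard) ?_
      rw [← heq, sum_affine_support_eq_zero c b hb]
  have hz : ∀ a, ∃ z : ℤ, n a = 2 * z := fun a =>
    (ZMod.intCast_zmod_eq_zero_iff_dvd _ 2).1 ((h a).trans (heven a))
  choose z hz using hz
  refine ⟨z, ?_⟩
  funext d
  by_cases hd : d ∈ S
  · simp [axis_apply, hd, hn, hz, mul_comm]
  · simp [axis_apply, hd, hx.2 d hd]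

theorem coordLat_eq_span (hS : S.card ≤ 3) : coordLat S = Submodule.span ℤ (axis '' S) := by
  apply le_antisymm
  · intro x hx
    obtain ⟨z, rfl⟩ := exists_sum_axis_of_mem_coordLat (by omega) (fun h => by omega) hx
    exact Submodule.sum_mem _ fun a ha =>
      Submodule.smul_mem _ _ (Submodule.subset_span ⟨a, ha, rfl⟩)
  · rw [Submodule.span_le]
    rintro _ ⟨a, ha, rfl⟩
    exact axis_mem_coordLat ha

theorem coordLat_one (a : Idx) : coordLat {a} = Submodule.span ℤ {axis a} := by
  rw [coordLat_eq_span (by simp)]; simp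

theorem coordLat_two {a b : Idx} (hab : a ≠ b) :
    coordLat {a, b} = Submodule.span ℤ {axis a, axis b} := by
  rw [coordLat_eq_span (by rw [Finset.card_pair hab]; norm_num)]
  simp [Set.image_insert_eq]

theorem coordLat_three {a b c : Idx} (h : ({a, b, c} : Finset Idx).card = 3) :
    coordLat {a, b, c} = Submodule.span ℤ {axis a, axis b, axis c} := by
  rw [coordLat_eq_span h.le]
  simp [Set.image_insert_eq]

theorem smul_span_one (g : V ≃ₗ[ℚ] V) (r : V) :
    g • Submodule.span ℤ {r} = Submodule.span ℤ {g r} := by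
  rw [Submodule.smul_span, Set.smul_set_singleton]; rfl

theorem smul_span_two (g : V ≃ₗ[ℚ] V) (r s : V) :
    g • Submodule.span ℤ {r, s} = Submodule.span ℤ {g r, g s} := by
  rw [Submodule.smul_span, Set.smul_set_insert, Set.smul_set_singleton]; rfl

theorem smul_span_three (g : V ≃ₗ[ℚ] V) (r s u : V) :
    g • Submodule.span ℤ {r, s, u} = Submodule.span ℤ {g r, g s, g u} := by
  rw [Submodule.smul_span, Set.smul_set_insert, Set.smul_set_insert, Set.smul_set_singleton]; rfl

theorem rank_one_iff : (IsRSSD M ∧ Module.finrank ℤ M = 1) ↔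
    ∃ r, IsRoot r ∧ M = Submodule.span ℤ {r} := by
  constructor
  · rintro ⟨hM, h1⟩
    obtain ⟨w, hw, T, hT, hc⟩ := exists_smul_eq_coordLat_card hM
    obtain ⟨a, rfl⟩ := Finset.card_eq_one.1 (hc.trans h1)
    refine ⟨w⁻¹ (axis a), isRoot_apply (weylGroup_le (inv_mem hw)) (isRoot_axis a), ?_⟩
    rw [eq_inv_smul hT, coordLat_one, smul_span_one]
  · rintro ⟨r, hr, rfl⟩
    obtain ⟨w, hw, -, a, -, ha⟩ := exists_move_root (S := ∅) hr (by simp)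
    have h : w • Submodule.span ℤ {r} = coordLat {a} := by rw [smul_span_one, ha, coordLat_one]
    rw [eq_inv_smul h, finrank_smul, finrank_coordLat]
    exact ⟨isRSSD_smul (weylGroup_le (inv_mem hw)) (isRSSD_coordLat _), by simp⟩

theorem rank_two_exists (hM : IsRSSD M) (h2 : Module.finrank ℤ M = 2) :
    ∃ r s, IsRoot r ∧ IsRoot s ∧ form r s = 0 ∧ M = Submodule.span ℤ {r, s} := by
  obtain ⟨w, hw, T, hT, hc⟩ := exists_smul_eq_coordLat_card hM
  obtain ⟨a, b, hab, rfl⟩ := Finset.card_eq_two.1 (hc.trans h2)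
  have hw' := weylGroup_le (inv_mem hw)
  refine ⟨w⁻¹ (axis a), w⁻¹ (axis b), isRoot_apply hw' (isRoot_axis a),
    isRoot_apply hw' (isRoot_axis b), ?_, ?_⟩
  · rw [hw'.1, form_axis_axis, if_neg hab]
  · rw [eq_inv_smul hT, coordLat_two hab, smul_span_two]

/-- Orthogonal roots are moved to axes one after another. Three axes span their coordinate lattice
because three points contain no plane, so primitivity is automatic. -/
theorem rank_three_iff : (IsRSSD M ∧ Module.finrank ℤ M = 3) ↔
    ∃ r s u, IsRoot r ∧ IsRoot s ∧ IsRoot u ∧ form r s = 0 ∧ form r u = 0 ∧ form s u = 0 ∧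
      M = Submodule.span ℤ {r, s, u} := by
  constructor
  · rintro ⟨hM, h3⟩
    obtain ⟨w, hw, T, hT, hc⟩ := exists_smul_eq_coordLat_card hM
    obtain ⟨a, b, c, hab, hac, hbc, rfl⟩ := Finset.card_eq_three.1 (hc.trans h3)
    have hw' := weylGroup_le (inv_mem hw)
    refine ⟨w⁻¹ (axis a), w⁻¹ (axis b), w⁻¹ (axis c), isRoot_apply hw' (isRoot_axis a),
      isRoot_apply hw' (isRoot_axis b), isRoot_apply hw' (isRoot_axis c), ?_, ?_, ?_, ?_⟩
    · rw [hw'.1, form_axis_axis, if_neg hab]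
    · rw [hw'.1, form_axis_axis, if_neg hac]
    · rw [hw'.1, form_axis_axis, if_neg hbc]
    · rw [eq_inv_smul hT, coordLat_three (hc.trans h3), smul_span_three]
  · rintro ⟨r, s, u, hr, hs, hu, hrs, hru, hsu, rfl⟩
    obtain ⟨w, hw, a, b, hab, ha, hb⟩ := exists_move_two_roots hr hs hrs
    have hw0 := weylGroup_le hw
    obtain ⟨w', hw', hfix, c, hc, hc'⟩ := exists_move_root (S := {a, b}) (isRoot_apply hw0 hu) (by
      intro d hd
      rw [Finset.mem_insert, Finset.mem_singleton] at hd
      rcases hd with rfl | rfl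
      · rw [← form_axis (w u) d, ← ha, form_comm, hw0.1, hru]
      · rw [← form_axis (w u) d, ← hb, form_comm, hw0.1, hsu])
    simp only [Finset.mem_insert, Finset.mem_singleton, not_or] at hc
    have hcard : ({a, b, c} : Finset Idx).card = 3 :=
      Finset.card_eq_three.2 ⟨a, b, c, hab, Ne.symm hc.1, Ne.symm hc.2, rfl⟩
    have h : (w' * w) • Submodule.span ℤ {r, s, u} = coordLat {a, b, c} := by
      rw [smul_span_three, coordLat_three hcard, LinearEquiv.mul_apply, LinearEquiv.mul_apply,
        LinearEquiv.mul_apply, ha, hb, hc', hfix a (by simp), hfix b (by simp)]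
    rw [eq_inv_smul h, finrank_smul, finrank_coordLat]
    exact ⟨isRSSD_smul (weylGroup_le (inv_mem (mul_mem hw' hw))) (isRSSD_coordLat _), hcard⟩

theorem rank_compl_iff {k l : ℕ} (hkl : k + l = 8) : (IsRSSD M ∧ Module.finrank ℤ M = k) ↔
    ∃ N, (IsRSSD N ∧ Module.finrank ℤ N = l) ∧ M = ann N := by
  constructor
  · rintro ⟨hM, hk⟩
    obtain ⟨h1, h2, h3⟩ := ann_properties hM
    exact ⟨ann M, ⟨h1, by omega⟩, h3.symm⟩
  · rintro ⟨N, ⟨hN, hl⟩, rfl⟩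
    obtain ⟨h1, h2, -⟩ := ann_properties hN
    exact ⟨h1, by omega⟩

theorem rank_five_iff : (IsRSSD M ∧ Module.finrank ℤ M = 5) ↔
    ∃ r s u, IsRoot r ∧ IsRoot s ∧ IsRoot u ∧ form r s = 0 ∧ form r u = 0 ∧ form s u = 0 ∧
      M = ann (Submodule.span ℤ {r, s, u}) := by
  rw [rank_compl_iff (l := 3) rfl]
  simp only [rank_three_iff]
  constructor
  · rintro ⟨N, ⟨r, s, u, hr, hs, hu, hrs, hru, hsu, rfl⟩, rfl⟩
    exact ⟨r, s, u, hr, hs, hu, hrs, hru, hsu, rfl⟩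
  · rintro ⟨r, s, u, hr, hs, hu, hrs, hru, hsu, rfl⟩
    exact ⟨_, ⟨r, s, u, hr, hs, hu, hrs, hru, hsu, rfl⟩, rfl⟩

theorem rank_seven_iff : (IsRSSD M ∧ Module.finrank ℤ M = 7) ↔
    ∃ r, IsRoot r ∧ M = ann (Submodule.span ℤ {r}) := by
  rw [rank_compl_iff (l := 1) rfl]
  simp only [rank_one_iff]
  constructor
  · rintro ⟨N, ⟨r, hr, rfl⟩, rfl⟩
    exact ⟨r, hr, rfl⟩
  · rintro ⟨r, hr, rfl⟩
    exact ⟨_, ⟨r, hr, rfl⟩, rfl⟩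

/-! ### Counting the orbits -/

/-- Representatives of the nonempty proper subsets of `𝔽₂³` up to equivalence: `repSet i` for `i ≠ 7`
has `i + 1` elements, with a plane for `i = 3`, and `repSet 7` has four elements not in a plane. -/
def repSet (i : Fin 8) : Finset Idx :=
  Finset.univ.filter fun a =>
    if i = 7 then a 0 + a 1 + a 2 = 1 ∧ (a 0).val + (a 1).val + (a 2).val = 1 ∨ a = 0
    else (a 0).val + 2 * (a 1).val + 4 * (a 2).val ≤ i.val

theorem card_repSet : ∀ i : Fin 8, (repSet i).card = if i = 7 then 4 else i.val + 1 := by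
  decide +kernel

theorem sum_repSet : ∀ i : Fin 8, (repSet i).card = 4 → (∑ a ∈ repSet i, a = 0 ↔ i ≠ 7) := by
  decide +kernel

theorem exists_linked_repSet (h1 : 1 ≤ T.card) (h7 : T.card ≤ 7) :
    ∃ i, (repSet i).card = T.card ∧ Linked weylGroup T (repSet i) := by
  obtain ⟨i, hi, hi'⟩ : ∃ i, (repSet i).card = T.card ∧
      (T.card = 4 → (∑ a ∈ T, a = 0 ↔ ∑ a ∈ repSet i, a = 0)) := by
    by_cases h : T.card = 4 ∧ ∑ a ∈ T, a ≠ 0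
    · refine ⟨7, by rw [h.1, card_repSet, if_pos rfl], fun h4 => ?_⟩
      rw [sum_repSet 7 (by rw [card_repSet, if_pos rfl])]
      simp [h.2]
    · have hcard : (repSet ⟨T.card - 1, by omega⟩).card = T.card := by
        rw [card_repSet, if_neg]
        · simp only; omega
        · rw [Fin.ext_iff]; simp; omega
      refine ⟨⟨T.card - 1, by omega⟩, hcard, fun h4 => ?_⟩
      rw [sum_repSet _ (hcard.trans h4)]
      have h0 : ∑ a ∈ T, a = 0 := by
        by_contra h0; exact h ⟨h4, h0⟩
      simp only [h0, true_iff]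
      rw [ne_eq, Fin.ext_iff]; simp; omega
  exact ⟨i, hi, linked_of_card_eq weylGroup_le (fun c b δ h => shear_mem_weylGroup c h) hi.symm hi'⟩

/-- The orbit of the coordinate sublattice on `repSet i`. -/
def repOrbit (i : Fin 8) : Set (Submodule ℤ V) := MulAction.orbit weylGroup (coordLat (repSet i))

/-- Such a lattice is an orthogonal sum of root lines, so all inner products are even. Over a plane
the value 1 does occur, and this separates the two orbits of rank 4. -/
theorem not_exists_form_eq_one (hS : S.card ≤ 4) (hS' : S.card = 4 → ∑ a ∈ S, a ≠ 0) :
    ¬∃ x ∈ coordLat S, ∃ y ∈ coordLat S, form x y = 1 := by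
  rintro ⟨x, hx, y, hy, h⟩
  obtain ⟨z, rfl⟩ := exists_sum_axis_of_mem_coordLat hS hS' hx
  obtain ⟨z', rfl⟩ := exists_sum_axis_of_mem_coordLat hS hS' hy
  have hz : ∀ (z : Idx → ℤ) a, (∑ d ∈ S, z d • axis d) a = 2 * (if a ∈ S then z a else 0 : ℤ) := by
    intro z a
    by_cases ha : a ∈ S <;> simp [axis_apply, ha, mul_comm]
  simp only [form, hz] at h
  have h' : 2 * ∑ a, (if a ∈ S then z a else 0) * (if a ∈ S then z' a else 0) = 1 := by
    have : ((2 * ∑ a, (if a ∈ S then z a else 0) * (if a ∈ S then z' a else 0) : ℤ) : ℚ) = 1 := by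
      rw [← h]
      push_cast
      rw [Finset.mul_sum, Finset.mul_sum]
      exact Finset.sum_congr rfl fun a _ => by ring
    exact_mod_cast this
  omega

theorem exists_form_eq_one_of_plane (hS : S.card = 4) (hsum : ∑ a ∈ S, a = 0) :
    ∃ x ∈ coordLat S, ∃ y ∈ coordLat S, form x y = 1 := by
  obtain ⟨c, b, hb, h⟩ := exists_affine_of_plane hS hsum
  obtain ⟨a, ha⟩ := exists_affine_eq_one c b hb
  refine ⟨_, ⟨affine_support_mem c b, fun d hd => ?_⟩, axis a, axis_mem_coordLat ((h a).2 ha), ?_⟩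
  · exact if_neg (by rwa [← h])
  · rw [form_axis, if_pos ha]

theorem repOrbit_injective : Function.Injective repOrbit := by
  have hkey : ∀ i j, repOrbit i = repOrbit j → (repSet i).card = (repSet j).card ∧
      ((∃ x ∈ coordLat (repSet i), ∃ y ∈ coordLat (repSet i), form x y = 1) →
        ∃ x ∈ coordLat (repSet j), ∃ y ∈ coordLat (repSet j), form x y = 1) := by
    intro i j h
    have : coordLat (repSet j) ∈ repOrbit i := by rw [h]; exact MulAction.mem_orbit_self _
    obtain ⟨w, hw, hw'⟩ := mem_orbit_iff.1 this
    refine ⟨by rw [← finrank_coordLat, ← finrank_coordLat, ← hw', finrank_smul], ?_⟩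
    rintro ⟨x, hx, y, hy, hxy⟩
    rw [← hw']
    exact ⟨w x, apply_mem_smul_iff.2 hx, w y, apply_mem_smul_iff.2 hy,
      by rw [(weylGroup_le hw).1, hxy]⟩
  have hne : ∀ i, i ≠ 7 → repOrbit i ≠ repOrbit 7 := by
    intro i hi h
    obtain ⟨h1, h2⟩ := hkey i 7 h
    have h4 : (repSet 7).card = 4 := by rw [card_repSet, if_pos rfl]
    refine not_exists_form_eq_one h4.le (fun _ h0 => ?_)
      (h2 (exists_form_eq_one_of_plane (h1.trans h4) ((sum_repSet i (h1.trans h4)).2 hi)))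
    exact (sum_repSet 7 h4).1 h0 rfl
  intro i j h
  by_cases hi : i = 7
  · by_contra hij
    exact hne j (fun hj => hij (by rw [hi, hj])) (by rw [← h, hi])
  by_cases hj : j = 7
  · exact absurd (by rw [h, hj]) (hne i hi)
  have := (hkey i j h).1
  rw [card_repSet, card_repSet, if_neg hi, if_neg hj] at this
  exact Fin.ext (by omega)

theorem exists_orbit_eq_repOrbit (hM : IsRSSD M) (h1 : 1 ≤ Module.finrank ℤ M)
    (h7 : Module.finrank ℤ M ≤ 7) :
    ∃ i, (repSet i).card = Module.finrank ℤ M ∧ MulAction.orbit weylGroup M = repOrbit i := by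
  obtain ⟨w, hw, T, hT, hc⟩ := exists_smul_eq_coordLat_card hM
  obtain ⟨i, hi, v, hv, hv'⟩ := exists_linked_repSet (T := T) (by omega) (by omega)
  refine ⟨i, hi.trans hc, ?_⟩
  rw [repOrbit, MulAction.orbit_eq_iff, MulAction.mem_orbit_symm]
  exact mem_orbit_iff.2 ⟨v * w, mul_mem hv hw, by rw [mul_smul, hT, hv']⟩

theorem orbitsOfRank_ncard {n : ℕ} (h1 : 1 ≤ n) (h7 : n ≤ 7) :
    (orbitsOfRank n).ncard = (Finset.univ.filter fun i => (repSet i).card = n).card := by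
  have : orbitsOfRank n =
      repOrbit '' (Finset.univ.filter fun i => (repSet i).card = n : Finset (Fin 8)) := by
    ext O
    constructor
    · rintro ⟨M, ⟨hM, rfl⟩, rfl⟩
      obtain ⟨i, hi, h⟩ := exists_orbit_eq_repOrbit hM h1 h7
      exact ⟨i, by simpa using hi, h.symm⟩
    · rintro ⟨i, hi, rfl⟩
      refine ⟨coordLat (repSet i), ⟨isRSSD_coordLat _, ?_⟩, rfl⟩
      rw [finrank_coordLat]
      simpa using hi
  rw [this, Set.ncard_image_of_injective _ repOrbit_injective, Set.ncard_coe_finset]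

theorem coordLat_empty : coordLat ∅ = ⊥ := by
  rw [Submodule.eq_bot_iff]
  intro x hx
  funext a
  exact hx.2 a (by simp)

theorem coordLat_univ : coordLat Finset.univ = BW3 :=
  le_antisymm (fun _ hx => hx.1) fun _ hx => ⟨hx, by simp⟩

theorem finrank_BW3 : Module.finrank ℤ BW3 = 8 := by
  rw [← coordLat_univ, finrank_coordLat]; simp

theorem properOrbits_eq : properOrbits = Set.range repOrbit := by
  ext O
  constructor
  · rintro ⟨M, ⟨hM, h0, hL⟩, rfl⟩
    obtain ⟨w, hw, T, hT, hc⟩ := exists_smul_eq_coordLat_card hM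
    have hc8 : T.card ≤ 8 := (Finset.card_le_univ T).trans (by simp)
    have hT0 : T.card ≠ 0 := fun h => h0 (by
      rw [Finset.card_eq_zero] at h
      rw [eq_inv_smul hT, h, coordLat_empty, Submodule.smul_bot'])
    have hT8 : T.card ≠ 8 := fun h => hL (by
      have : T = Finset.univ := (Finset.card_eq_iff_eq_univ T).1 (by rw [h]; simp)
      rw [this, coordLat_univ] at hT
      ext x
      rw [← (weylGroup_le hw).2 x, ← apply_mem_smul_iff (g := w), hT])
    obtain ⟨i, -, h⟩ := exists_orbit_eq_repOrbit hM (by omega) (by omega)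
    exact ⟨i, h.symm⟩
  · rintro ⟨i, rfl⟩
    refine ⟨coordLat (repSet i), ⟨isRSSD_coordLat _, fun h => ?_, fun h => ?_⟩, rfl⟩
    · have := finrank_coordLat (repSet i)
      rw [h, finrank_bot, card_repSet] at this
      split_ifs at this
    · have := finrank_coordLat (repSet i)
      rw [h, finrank_BW3, card_repSet] at this
      split_ifs at this with h7
      · omega
      · exact h7 (Fin.ext (by simp; omega))

theorem properOrbits_ncard : properOrbits.ncard = 8 := by
  rw [properOrbits_eq, ← Set.image_univ, Set.ncard_image_of_injective _ repOrbit_injective,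
    Set.ncard_univ, Nat.card_eq_fintype_card, Fintype.card_fin]

theorem repSet_count : ∀ n : Fin 8, n ≠ 0 →
    (Finset.univ.filter fun i : Fin 8 => (repSet i).card = n.val).card = if n = 4 then 2 else 1 := by
  decide +kernel

/-! ### Sign changes -/

theorem sgn_mul_sgn_cast (z : ZMod 2) : (sgn z : ℚ) * sgn z = 1 := by
  exact_mod_cast sgn_mul_self z

theorem sgn_add_cast (y z : ZMod 2) : (sgn (y + z) : ℚ) = sgn y * sgn z := by
  exact_mod_cast sgn_add y z

theorem sgn_zero : sgn 0 = 1 := rfl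

theorem sgn_one : sgn 1 = -1 := rfl

/-- The sign change `x ↦ ((-1)^(f a) xₐ)ₐ`. -/
def signMap (f : Idx → ZMod 2) : V ≃ₗ[ℚ] V :=
  LinearEquiv.ofInvolutive
    { toFun := fun x a => (sgn (f a) : ℚ) * x a
      map_add' := fun x y => by funext a; simp [mul_add]
      map_smul' := fun c x => by funext a; simp [mul_left_comm] }
    fun x => by
      funext a
      simp only [LinearMap.coe_mk, AddHom.coe_mk]
      rw [← mul_assoc, sgn_mul_sgn_cast, one_mul]

theorem signMap_apply (f : Idx → ZMod 2) (x : V) (a : Idx) :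
    signMap f x a = sgn (f a) * x a := rfl

theorem signMap_add (f f' : Idx → ZMod 2) : signMap (f + f') = signMap f * signMap f' :=
  LinearEquiv.ext fun x => by
    funext a
    rw [LinearEquiv.mul_apply, signMap_apply, signMap_apply, signMap_apply, Pi.add_apply,
      sgn_add_cast, mul_assoc]

theorem signMap_zero : signMap 0 = 1 := LinearEquiv.ext fun x => by
  funext a
  rw [signMap_apply, Pi.zero_apply, sgn_zero]; simp

theorem signMap_inv (f : Idx → ZMod 2) : (signMap f)⁻¹ = signMap f := by
  rw [inv_eq_iff_mul_eq_one, ← signMap_add]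
  have : f + f = 0 := funext fun a => CharTwo.add_self_eq_zero (f a)
  rw [this, signMap_zero]

theorem signMap_sum_mem {H : Subgroup (V ≃ₗ[ℚ] V)} {ι : Type*} (t : Finset ι)
    (f : ι → Idx → ZMod 2) (h : ∀ i ∈ t, signMap (f i) ∈ H) : signMap (∑ i ∈ t, f i) ∈ H := by
  classical
  induction t using Finset.induction_on with
  | empty => rw [Finset.sum_empty, signMap_zero]; exact one_mem H
  | insert i t hi ih =>
    rw [Finset.sum_insert hi, signMap_add]
    exact mul_mem (h i (Finset.mem_insert_self i t))
      (ih fun j hj => h j (Finset.mem_insert_of_mem hj))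

theorem signMap_smul_mem {H : Subgroup (V ≃ₗ[ℚ] V)} {f : Idx → ZMod 2} (h : signMap f ∈ H)
    (c : ZMod 2) : signMap (c • f) ∈ H := by
  rcases zmod_two_cases c with rfl | rfl
  · rw [zero_smul, signMap_zero]; exact one_mem H
  · rwa [one_smul]

theorem signMap_mem_weylGroup (f : Idx → ZMod 2) : signMap f ∈ weylGroup := by
  have hf : f = ∑ a, f a • (Pi.single a 1 : Idx → ZMod 2) := by
    funext d
    simp [Finset.sum_apply, Pi.single_apply]
  rw [hf]
  refine signMap_sum_mem _ _ fun a _ => signMap_smul_mem ?_ _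
  obtain ⟨w, hw, hw'⟩ := exists_reflection (isRoot_axis a)
  have : signMap (Pi.single a 1) = w := LinearEquiv.ext fun x => by
    funext d
    rw [signMap_apply, hw', form_axis, Pi.sub_apply, Pi.smul_apply, axis_apply, Pi.single_apply]
    by_cases hd : d = a
    · subst hd; simp [sgn_one]; ring
    · simp [hd, sgn_zero]
  rwa [this]

/-! ### The lower group -/

/-- The translation of the coordinates by `δ`. -/
def transl (δ : Idx) : V ≃ₗ[ℚ] V := shear 1 0 δ (zero_dotProduct δ)

theorem transl_apply (δ : Idx) (x : V) (a : Idx) : transl δ x a = x (a + δ) := by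
  rw [transl, shear_apply, zero_dotProduct, add_zero, one_smul]

theorem transl_mem_lowerGroup (δ : Idx) : transl δ ∈ lowerGroup :=
  Subgroup.subset_closure (Or.inl ⟨δ, fun x a => transl_apply δ x a⟩)

theorem signMap_dotProduct_mem_lowerGroup (b : Idx) : signMap (fun a => b ⬝ᵥ a) ∈ lowerGroup :=
  Subgroup.subset_closure (Or.inr ⟨b, fun x a => by
    rw [signMap_apply]
    change _ = (if b ⬝ᵥ a = 0 then (1 : ℚ) else -1) * x a
    unfold sgn
    split_ifs <;> simp⟩)

theorem signMap_affine_mem_lowerGroup (c : ZMod 2) (b : Idx) :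
    signMap (fun a => c + b ⬝ᵥ a) ∈ lowerGroup := by
  have h : (fun a => c + b ⬝ᵥ a) = c • (1 : Idx → ZMod 2) + fun a => b ⬝ᵥ a := by
    funext a; simp
  rw [h, signMap_add]
  refine mul_mem (signMap_smul_mem ?_ c) (signMap_dotProduct_mem_lowerGroup b)
  -- The scalar `-1` is the commutator of a translation and a sign change that anticommute.
  have : signMap 1 = transl 1 * signMap (fun a => (Pi.single 0 1 : Idx) ⬝ᵥ a) * transl 1 *
      signMap (fun a => (Pi.single 0 1 : Idx) ⬝ᵥ a) := LinearEquiv.ext fun x => by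
    funext a
    simp only [LinearEquiv.mul_apply, transl_apply, signMap_apply]
    rw [← mul_assoc, add_assoc, idx_add_self, add_zero, ← sgn_add_cast, dotProduct_add]
    have : (Pi.single 0 1 : Idx) ⬝ᵥ (1 : Idx) = 1 := by simp
    rw [this, add_right_comm, CharTwo.add_self_eq_zero, zero_add]
    rfl
  rw [this]
  exact mul_mem (mul_mem (mul_mem (transl_mem_lowerGroup _) (signMap_dotProduct_mem_lowerGroup _))
    (transl_mem_lowerGroup _)) (signMap_dotProduct_mem_lowerGroup _)

theorem lowerGroup_induction {P : (V ≃ₗ[ℚ] V) → Prop} (ht : ∀ δ, P (transl δ))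
    (hs : ∀ b : Idx, P (signMap fun a => b ⬝ᵥ a)) (h1 : P 1)
    (hmul : ∀ g ∈ lowerGroup, ∀ h ∈ lowerGroup, P g → P h → P (g * h))
    (hinv : ∀ g ∈ lowerGroup, P g → P g⁻¹) {k : V ≃ₗ[ℚ] V} (hk : k ∈ lowerGroup) : P k := by
  induction hk using Subgroup.closure_induction with
  | mem g hg =>
    rcases hg with ⟨δ, h⟩ | ⟨b, h⟩
    · have : g = transl δ := LinearEquiv.ext fun x => by
        funext a; rw [h, transl_apply]
      rw [this]; exact ht δ
    · have : g = signMap fun a => b ⬝ᵥ a := LinearEquiv.ext fun x => by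
        funext a
        rw [h, signMap_apply]
        change (if b ⬝ᵥ a = 0 then (1 : ℚ) else -1) * x a = _
        unfold sgn
        split_ifs <;> simp
      rw [this]; exact hs b
  | one => exact h1
  | mul g h hg hh hg' hh' => exact hmul g hg h hh hg' hh'
  | inv g hg hg' => exact hinv g hg hg'

theorem lowerGroup_le_weylGroup : lowerGroup ≤ weylGroup := fun _ hk =>
  lowerGroup_induction (P := (· ∈ weylGroup)) (fun _ => shear_mem_weylGroup _ _)
    (fun _ => signMap_mem_weylGroup _) (one_mem _) (fun _ _ _ _ => mul_mem) (fun _ _ => inv_mem) hk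

/-! ### Elements of the normalizer of the lower group -/

/-- The normalizer of the lower group. -/
abbrev lowerNormalizer : Subgroup (V ≃ₗ[ℚ] V) :=
  Subgroup.normalizer (lowerGroup : Set (V ≃ₗ[ℚ] V))

/-- An element whose square is a scalar normalizes the lower group if it conjugates the generators
into it. -/
theorem mem_lowerNormalizer {c : ℚ} (hgg : ∀ x, g (g x) = c • x)
    (ht : ∀ δ, ∃ k ∈ lowerGroup, ∀ x, g (transl δ x) = k (g x))
    (hs : ∀ b : Idx, ∃ k ∈ lowerGroup, ∀ x, g (signMap (fun a => b ⬝ᵥ a) x) = k (g x)) :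
    g ∈ lowerNormalizer := by
  have hconj : ∀ k ∈ lowerGroup, g * k * g⁻¹ ∈ lowerGroup := by
    intro k hk
    refine lowerGroup_induction (P := fun k => g * k * g⁻¹ ∈ lowerGroup) ?_ ?_ ?_ ?_ ?_ hk
    · intro δ
      obtain ⟨k, hk, h⟩ := ht δ
      have : g * transl δ = k * g := LinearEquiv.ext h
      rwa [this, mul_inv_cancel_right]
    · intro b
      obtain ⟨k, hk, h⟩ := hs b
      have : g * signMap (fun a => b ⬝ᵥ a) = k * g := LinearEquiv.ext h
      rwa [this, mul_inv_cancel_right]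
    · simp
    · intro k _ l _ hk hl
      rw [← conj_mul]
      exact mul_mem hk hl
    · intro k _ hk
      rw [← conj_inv]
      exact inv_mem hk
  -- The square of `g` is central, so conjugating twice by `g` is trivial and the inclusion `hconj`
  -- can be reversed.
  have hcomm : ∀ k : V ≃ₗ[ℚ] V, g * g * k = k * (g * g) := fun k => LinearEquiv.ext fun x => by
    simp only [LinearEquiv.mul_apply, hgg, map_smul]
  rw [Subgroup.mem_normalizer_iff]
  intro k
  refine ⟨hconj k, fun h => ?_⟩
  have h' := hconj _ h
  have : g * (g * k * g⁻¹) * g⁻¹ = k := by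
    rw [mul_inv_eq_iff_eq_mul, ← mul_assoc, mul_inv_eq_iff_eq_mul, ← mul_assoc, hcomm, mul_assoc]
  rwa [this] at h'

theorem shear_mem_lowerNormalizer (c : ZMod 2) {b δ : Idx} (h : b ⬝ᵥ δ = 0) :
    shear c b δ h ∈ lowerNormalizer := by
  refine mem_lowerNormalizer (c := 1) (fun x => by rw [shear_shear, one_smul]) (fun ε => ?_)
    fun b' => ?_
  · refine ⟨_, transl_mem_lowerGroup (ε + (b ⬝ᵥ ε) • δ), fun x => ?_⟩
    funext a
    simp only [shear_apply, transl_apply, dotProduct_add, dotProduct_smul, h, smul_zero, add_zero]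
    congr 1
    rw [← add_assoc c, add_smul (c + b ⬝ᵥ a)]
    have : (b ⬝ᵥ ε) • δ + (b ⬝ᵥ ε) • δ = 0 := idx_add_self _
    calc a + (c + b ⬝ᵥ a) • δ + ε
        = a + (c + b ⬝ᵥ a) • δ + ε + ((b ⬝ᵥ ε) • δ + (b ⬝ᵥ ε) • δ) := by rw [this, add_zero]
      _ = _ := by abel
  · refine ⟨_, signMap_affine_mem_lowerGroup ((b' ⬝ᵥ δ) * c) (b' + (b' ⬝ᵥ δ) • b), fun x => ?_⟩
    funext a
    simp only [shear_apply, signMap_apply, dotProduct_add, dotProduct_smul, add_dotProduct,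
      smul_dotProduct, smul_eq_mul]
    congr 3
    ring

/-- A function is quadratic if its differences are affine. -/
def IsQuadratic (q : Idx → ZMod 2) : Prop :=
  ∀ ε : Idx, ∃ (c : ZMod 2) (b : Idx), ∀ a, q (a + ε) = q a + (c + b ⬝ᵥ a)

theorem isQuadratic_mul (c : ZMod 2) (b : Idx) (c' : ZMod 2) (b' : Idx) :
    IsQuadratic fun a => (c + b ⬝ᵥ a) * (c' + b' ⬝ᵥ a) := by
  intro ε
  refine ⟨(b ⬝ᵥ ε) * c' + c * (b' ⬝ᵥ ε) + (b ⬝ᵥ ε) * (b' ⬝ᵥ ε), (b ⬝ᵥ ε) • b' + (b' ⬝ᵥ ε) • b,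
    fun a => ?_⟩
  simp only [dotProduct_add, add_dotProduct, smul_dotProduct, smul_eq_mul]
  ring

/-- Conjugation multiplies a translation by the sign change along the corresponding difference of
`q`, which is affine and so belongs to the lower group. -/
theorem signMap_mem_lowerNormalizer {q : Idx → ZMod 2} (hq : IsQuadratic q) :
    signMap q ∈ lowerNormalizer := by
  have hqq : signMap q * signMap q = 1 := by
    rw [mul_eq_one_iff_eq_inv, signMap_inv]
  refine mem_lowerNormalizer (c := 1) (fun x => by
    rw [← LinearEquiv.mul_apply, hqq, one_smul]; rfl) (fun ε => ?_) fun b => ?_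
  · obtain ⟨c, b, h⟩ := hq ε
    refine ⟨_, mul_mem (signMap_affine_mem_lowerGroup c b) (transl_mem_lowerGroup ε), fun x => ?_⟩
    funext a
    simp only [LinearEquiv.mul_apply, signMap_apply, transl_apply, h, sgn_add_cast]
    rw [← sgn_add_cast c]
    linear_combination (-(sgn (q a) : ℚ) * x (a + ε)) * sgn_mul_sgn_cast (c + b ⬝ᵥ a)
  · refine ⟨_, signMap_dotProduct_mem_lowerGroup b, fun x => ?_⟩
    funext a
    simp only [signMap_apply]
    ring

/-- The transformation `x ↦ ((-1)^(b ⬝ a) xₐ + x_{a+δ})ₐ`, where `b ⬝ δ = 1`. -/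
def hadamardFun (b δ : Idx) : V →ₗ[ℚ] V where
  toFun := fun x a => sgn (b ⬝ᵥ a) * x a + x (a + δ)
  map_add' := fun x y => by funext a; simp; ring
  map_smul' := fun c x => by funext a; simp; ring

theorem hadamardFun_apply (b δ : Idx) (x : V) (a : Idx) :
    hadamardFun b δ x a = sgn (b ⬝ᵥ a) * x a + x (a + δ) := rfl

/-- The map is the sum of two anticommuting involutions of the lower group, a sign change and a
translation. -/
theorem hadamardFun_hadamardFun {b δ : Idx} (h : b ⬝ᵥ δ = 1) (x : V) :
    hadamardFun b δ (hadamardFun b δ x) = (2 : ℚ) • x := by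
  funext a
  simp only [hadamardFun_apply, dotProduct_add, h, sgn_add_cast, sgn_one, Pi.smul_apply,
    smul_eq_mul]
  rw [add_assoc a, idx_add_self, add_zero]
  push_cast
  linear_combination (x a) * sgn_mul_sgn_cast (b ⬝ᵥ a)

/-- `hadamardFun` as an automorphism of `V`. -/
def hadamard (b δ : Idx) (h : b ⬝ᵥ δ = 1) : V ≃ₗ[ℚ] V :=
  LinearEquiv.ofLinearMap (hadamardFun b δ) ((1 / 2 : ℚ) • hadamardFun b δ)
    (LinearMap.ext fun x => by
      simp only [LinearMap.comp_apply, LinearMap.smul_apply, map_smul, hadamardFun_hadamardFun h,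
        LinearMap.id_apply, smul_smul]
      norm_num)
    (LinearMap.ext fun x => by
      simp only [LinearMap.comp_apply, LinearMap.smul_apply, hadamardFun_hadamardFun h,
        LinearMap.id_apply, smul_smul]
      norm_num)

theorem hadamard_apply {b δ : Idx} (h : b ⬝ᵥ δ = 1) (x : V) (a : Idx) :
    hadamard b δ h x a = sgn (b ⬝ᵥ a) * x a + x (a + δ) := rfl

/-- Let `Z` be the sign change and `X` the translation whose sum is the Hadamard map. A generator
commuting with both is fixed under conjugation; one that anticommutes with exactly one of them is
multiplied by `XZ` or `ZX`. -/
theorem hadamard_mem_lowerNormalizer {b δ : Idx} (h : b ⬝ᵥ δ = 1) :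
    hadamard b δ h ∈ lowerNormalizer := by
  refine mem_lowerNormalizer (c := 2) (hadamardFun_hadamardFun h) (fun ε => ?_) fun b' => ?_
  · rcases zmod_two_cases (b ⬝ᵥ ε) with hε | hε
    · refine ⟨_, transl_mem_lowerGroup ε, fun x => ?_⟩
      funext a
      simp only [hadamard_apply, transl_apply, dotProduct_add, hε, add_zero]
      rw [add_right_comm]
    · refine ⟨_, mul_mem (transl_mem_lowerGroup (ε + δ)) (signMap_dotProduct_mem_lowerGroup b),
        fun x => ?_⟩
      funext a
      simp only [LinearEquiv.mul_apply, hadamard_apply, transl_apply, signMap_apply,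
        dotProduct_add, hε, h, CharTwo.add_self_eq_zero, add_zero]
      rw [show a + δ + ε = a + (ε + δ) by abel,
        show a + (ε + δ) + δ = a + ε by rw [add_assoc, add_assoc, idx_add_self, add_zero]]
      linear_combination (-x (a + (ε + δ))) * sgn_mul_sgn_cast (b ⬝ᵥ a)
  · rcases zmod_two_cases (b' ⬝ᵥ δ) with hδ | hδ
    · refine ⟨_, signMap_dotProduct_mem_lowerGroup b', fun x => ?_⟩
      funext a
      simp only [hadamard_apply, signMap_apply, dotProduct_add, hδ, add_zero]
      ring
    · refine ⟨_, mul_mem (signMap_dotProduct_mem_lowerGroup (b' + b)) (transl_mem_lowerGroup δ),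
        fun x => ?_⟩
      funext a
      simp only [LinearEquiv.mul_apply, hadamard_apply, transl_apply, signMap_apply,
        dotProduct_add, add_dotProduct, hδ, h, sgn_add_cast, sgn_one]
      rw [add_assoc a, idx_add_self, add_zero]
      push_cast
      linear_combination ((sgn (b' ⬝ᵥ a) : ℚ) * x (a + δ)) * sgn_mul_sgn_cast (b ⬝ᵥ a)

/-! ### Elements of `BRW₃` -/

theorem commutator_mem_BRW3 {h : V ≃ₗ[ℚ] V} (hg : g ∈ lowerNormalizer)
    (hh : h ∈ lowerNormalizer) : g * h * g⁻¹ * h⁻¹ ∈ BRW3 :=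
  Subgroup.commutator_mem_commutator hg hh

theorem BRW3_le : BRW3 ≤ lowerNormalizer := by
  refine Subgroup.commutator_le.2 ?_
  intro g hg h hh
  exact mul_mem (mul_mem (mul_mem hg hh) (inv_mem hg)) (inv_mem hh)

theorem conj_mem_BRW3 {k : V ≃ₗ[ℚ] V} (hg : g ∈ lowerNormalizer) (hk : k ∈ BRW3) :
    g * k * g⁻¹ ∈ BRW3 := by
  have : g * k * g⁻¹ = g * k * g⁻¹ * k⁻¹ * k := by rw [inv_mul_cancel_right]
  rw [this]
  exact mul_mem (commutator_mem_BRW3 hg (BRW3_le hk)) hk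

theorem exists_shear_commutator : ∀ b δ : Idx, b ⬝ᵥ δ = 0 → δ ≠ 0 →
    ∃ ε m : Idx, b ⬝ᵥ ε = 0 ∧ m ⬝ᵥ δ = 0 ∧ m ⬝ᵥ ε = 1 := by decide +kernel

/-- As for elementary matrices, the shear along `δ` is the commutator of a shear along `ε` with one
from `ε` to `δ`, where `m ⬝ᵥ ε = 1`. -/
theorem shear_mem_BRW3 (c : ZMod 2) {b δ : Idx} (h : b ⬝ᵥ δ = 0) : shear c b δ h ∈ BRW3 := by
  by_cases hδ : δ = 0
  · have : shear c b δ h = 1 := LinearEquiv.ext fun x => by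
      funext a
      rw [shear_apply, hδ, smul_zero, add_zero]; rfl
    rw [this]; exact one_mem _
  obtain ⟨ε, m, h1, h2, h3⟩ := exists_shear_commutator b δ h hδ
  have : shear c b δ h = shear c b ε h1 * shear 0 m δ h2 * (shear c b ε h1)⁻¹ *
      (shear 0 m δ h2)⁻¹ := LinearEquiv.ext fun x => by
    rw [shear_inv, shear_inv]
    funext a
    simp only [LinearEquiv.mul_apply, shear_apply, dotProduct_add, dotProduct_smul, h, h1, h2, h3,
      smul_zero, add_zero, zero_add]
    congr 1
    generalize c + b ⬝ᵥ a = u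
    generalize m ⬝ᵥ a = v
    funext i
    simp only [Pi.add_apply, Pi.smul_apply, smul_eq_mul]
    generalize a i = p
    generalize δ i = q
    generalize ε i = w
    revert u v p q w
    decide
  rw [this]
  exact commutator_mem_BRW3 (shear_mem_lowerNormalizer _ _) (shear_mem_lowerNormalizer _ _)

theorem exists_signMap_commutator : ∀ b b' : Idx,
    ∃ δ m : Idx, b ⬝ᵥ δ = 0 ∧ b' ⬝ᵥ δ = 0 ∧ m ⬝ᵥ δ = 1 := by decide +kernel

/-- A shear along `δ` over the second affine function adds that function to `m ⬝ᵥ a` and leaves the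
first factor alone. So its commutator with the sign change of (first factor) times `m ⬝ᵥ a` is the
sign change of the product. -/
theorem signMap_mul_mem_BRW3 (c : ZMod 2) (b : Idx) (c' : ZMod 2) (b' : Idx) :
    signMap (fun a => (c + b ⬝ᵥ a) * (c' + b' ⬝ᵥ a)) ∈ BRW3 := by
  obtain ⟨δ, m, h1, h2, h3⟩ := exists_signMap_commutator b b'
  have : signMap (fun a => (c + b ⬝ᵥ a) * (c' + b' ⬝ᵥ a)) =
      shear c' b' δ h2 * (signMap fun a => (c + b ⬝ᵥ a) * (0 + m ⬝ᵥ a)) * (shear c' b' δ h2)⁻¹ *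
        (signMap fun a => (c + b ⬝ᵥ a) * (0 + m ⬝ᵥ a))⁻¹ :=
    LinearEquiv.ext fun x => by
      rw [shear_inv, signMap_inv]
      funext a
      simp only [LinearEquiv.mul_apply, shear_apply, signMap_apply, dotProduct_add,
        dotProduct_smul, h1, h2, h3, smul_zero, add_zero, zero_add]
      rw [add_assoc a, idx_add_self, add_zero, ← mul_assoc, ← sgn_add_cast]
      congr 3
      generalize c + b ⬝ᵥ a = u
      generalize c' + b' ⬝ᵥ a = v
      generalize m ⬝ᵥ a = w
      rw [smul_eq_mul, mul_one]
      revert u v w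
      decide
  rw [this]
  exact commutator_mem_BRW3 (shear_mem_lowerNormalizer _ _)
    (signMap_mem_lowerNormalizer (isQuadratic_mul _ _ _ _))

theorem exists_pair_eq_mul : ∀ d : Idx, d ≠ 0 → ∃ b b' : Idx, ∀ a : Idx,
    (if a = d then 1 else 0) + (if a = 0 then 1 else 0 : ZMod 2) =
      (1 + b ⬝ᵥ a) * (1 + b' ⬝ᵥ a) := by decide +kernel

/-- Sets of even size are sums of pairs `{0, d}`, and each such line is the intersection of two
planes, hence the support of a product of two affine functions. -/
theorem signMap_mem_BRW3 {f : Idx → ZMod 2} (hf : ∑ a, f a = 0) : signMap f ∈ BRW3 := by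
  have hsum : f = ∑ d, f d • fun a : Idx =>
      ((if a = d then 1 else 0) + (if a = 0 then 1 else 0 : ZMod 2)) := by
    funext a
    simp only [Finset.sum_apply, Pi.smul_apply, smul_eq_mul, mul_add, Finset.sum_add_distrib,
      ← Finset.sum_mul, hf]
    simp
  rw [hsum]
  refine signMap_sum_mem _ _ fun d _ => signMap_smul_mem ?_ _
  by_cases hd : d = 0
  · convert one_mem BRW3
    rw [← signMap_zero]
    congr 1
    funext a
    simp only [hd, CharTwo.add_self_eq_zero, Pi.zero_apply]
  · obtain ⟨b, b', h⟩ := exists_pair_eq_mul d hd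
    simp only [h]
    exact signMap_mul_mem_BRW3 1 b 1 b'

/-! ### The sublattice `2 L + [L, R]` -/

/-- The sublattice `2 L + [L, R]`. -/
def lowerLat : Submodule ℤ V :=
  Submodule.span ℤ ({u | ∃ x ∈ BW3, u = x + x} ∪ {u | ∃ x ∈ BW3, ∃ k ∈ lowerGroup, u = x - k x})

theorem add_self_mem_lowerLat (hx : x ∈ BW3) : x + x ∈ lowerLat :=
  Submodule.subset_span (Or.inl ⟨x, hx, rfl⟩)

theorem sub_mem_lowerLat {k : V ≃ₗ[ℚ] V} (hx : x ∈ BW3) (hk : k ∈ lowerGroup) :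
    x - k x ∈ lowerLat :=
  Submodule.subset_span (Or.inr ⟨x, hx, k, hk, rfl⟩)

theorem apply_mem_lowerLat (hg : g ∈ lowerNormalizer) (hL : ∀ x ∈ BW3, g x ∈ BW3) {u : V}
    (hu : u ∈ lowerLat) : g u ∈ lowerLat := by
  induction hu using Submodule.span_induction with
  | mem u hu =>
    rcases hu with ⟨x, hx, rfl⟩ | ⟨x, hx, k, hk, rfl⟩
    · rw [map_add]; exact add_self_mem_lowerLat (hL x hx)
    · have hk' := (Subgroup.mem_normalizer_iff.1 hg k).1 hk
      have : g (x - k x) = g x - (g * k * g⁻¹) (g x) := by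
        rw [map_sub, LinearEquiv.mul_apply, LinearEquiv.mul_apply, LinearEquiv.coe_inv,
          g.symm_apply_apply]
      rw [this]
      exact sub_mem_lowerLat (hL x hx) hk'
  | zero => rw [map_zero]; exact Submodule.zero_mem _
  | add x y _ _ hx hy => rw [map_add]; exact Submodule.add_mem _ hx hy
  | smul c x _ hx => rw [map_zsmul]; exact Submodule.smul_mem _ c hx

/-- Integral vectors with coordinates of constant parity and sum divisible by 4. -/
def constLat : Submodule ℤ V where
  carrier := {x | ∃ n : Idx → ℤ, (∀ a, x a = n a) ∧ (∃ c : ZMod 2, ∀ a, (n a : ZMod 2) = c) ∧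
    ((∑ a, n a : ℤ) : ZMod 4) = 0}
  zero_mem' := ⟨0, by simp, ⟨0, by simp⟩, by simp⟩
  add_mem' := by
    rintro x y ⟨m, hm, ⟨c, hc⟩, hs⟩ ⟨n, hn, ⟨d, hd⟩, ht⟩
    refine ⟨m + n, fun a => by simp [hm, hn], ⟨c + d, fun a => by simp [hc, hd]⟩, ?_⟩
    simp only [Pi.add_apply, Finset.sum_add_distrib, Int.cast_add, hs, ht, add_zero]
  smul_mem' := by
    rintro k x ⟨m, hm, ⟨c, hc⟩, hs⟩
    refine ⟨k • m, fun a => by simp [hm], ⟨k * c, fun a => by simp [hc]⟩, ?_⟩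
    simp only [Pi.smul_apply, smul_eq_mul, ← Finset.mul_sum, Int.cast_mul, hs, mul_zero]

theorem sum_affine_mul_dotProduct_add : ∀ (c : ZMod 2) (b b' : Idx),
    ∑ a : Idx, (c + b ⬝ᵥ a) * (if b' ⬝ᵥ a = 0 then 0 else 1) = 0 := by decide +kernel

theorem sum_affine : ∀ (c : ZMod 2) (b : Idx), ∑ a : Idx, (c + b ⬝ᵥ a) = 0 := by decide +kernel

theorem two_mul_zmod_four {k : ℤ} (h : (k : ZMod 2) = 0) : ((2 * k : ℤ) : ZMod 4) = 0 := by
  obtain ⟨l, rfl⟩ := (ZMod.intCast_zmod_eq_zero_iff_dvd _ 2).1 h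
  rw [ZMod.intCast_zmod_eq_zero_iff_dvd]
  exact ⟨l, by push_cast; ring⟩

theorem add_self_mem_constLat (hx : x ∈ BW3) : x + x ∈ constLat := by
  obtain ⟨n, hn, c, b, h⟩ := mem_BW3_iff.1 hx
  refine ⟨fun a => 2 * n a, fun a => by simp [hn]; ring, ⟨0, fun a => ?_⟩, ?_⟩
  · rw [Int.cast_mul, show ((2 : ℤ) : ZMod 2) = 0 from rfl, zero_mul]
  · rw [← Finset.mul_sum]
    apply two_mul_zmod_four
    push_cast
    simp only [h, sum_affine]

/-- A translation changes an affine function by a constant and preserves the coordinate sum. A sign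
change alters `x` by twice its restriction to a plane or to nothing, and that restriction has even
sum because affine functions are mutually orthogonal. -/
theorem sub_mem_constLat {k : V ≃ₗ[ℚ] V} (hk : k ∈ lowerGroup) :
    ∀ x ∈ BW3, x - k x ∈ constLat := by
  have hL : ∀ k ∈ lowerGroup, ∀ x, k x ∈ BW3 ↔ x ∈ BW3 := fun k hk =>
    (weylGroup_le (lowerGroup_le_weylGroup hk)).2
  refine lowerGroup_induction (P := fun k => ∀ x ∈ BW3, x - k x ∈ constLat) ?_ ?_ ?_ ?_ ?_ hk
  · intro δ x hx
    obtain ⟨n, hn, c, b, h⟩ := mem_BW3_iff.1 hx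
    refine ⟨fun a => n a - n (a + δ), fun a => ?_, ⟨b ⬝ᵥ δ, fun a => ?_⟩, ?_⟩
    · rw [Pi.sub_apply, transl_apply, hn, hn, Int.cast_sub]
    · rw [Int.cast_sub, h, h, dotProduct_add]
      rw [← add_assoc, sub_add_cancel_left, CharTwo.neg_eq]
    · have : ∑ a, n (a + δ) = ∑ a, n a := Equiv.sum_comp (Equiv.addRight δ) n
      rw [Finset.sum_sub_distrib, this, sub_self, Int.cast_zero]
  · intro b' x hx
    obtain ⟨n, hn, c, b, h⟩ := mem_BW3_iff.1 hx
    refine ⟨fun a => 2 * (n a * if b' ⬝ᵥ a = 0 then 0 else 1), fun a => ?_, ⟨0, fun a => ?_⟩, ?_⟩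
    · rw [Pi.sub_apply, signMap_apply, hn, sgn]
      by_cases hb : b' ⬝ᵥ a = 0
      · simp [hb]
      · simp only [hb, if_false]; push_cast; ring
    · rw [Int.cast_mul, show ((2 : ℤ) : ZMod 2) = 0 from rfl, zero_mul]
    · rw [← Finset.mul_sum]
      apply two_mul_zmod_four
      push_cast
      simp only [h, sum_affine_mul_dotProduct_add]
  · intro x _
    simp
  · intro g hg h hh hg' hh' x hx
    have := constLat.add_mem (hh' x hx) (hg' (h x) ((hL h hh x).2 hx))
    rwa [sub_add_sub_cancel] at this
  · intro g hg hg' x hx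
    have hx' : g⁻¹ x ∈ BW3 := (hL _ (inv_mem hg) x).2 hx
    have := constLat.neg_mem (hg' _ hx')
    rwa [neg_sub, LinearEquiv.coe_inv, g.apply_symm_apply] at this

theorem lowerLat_le : lowerLat ≤ constLat := by
  refine Submodule.span_le.2 ?_
  rintro u (⟨x, hx, rfl⟩ | ⟨x, hx, k, hk, rfl⟩)
  · exact add_self_mem_constLat hx
  · exact sub_mem_constLat hk x hx

/-! ### The shape of the roots -/

/-- The roots are the vectors `±2 eₐ` and the sign changes of the characteristic functions of
planes. -/
theorem root_shape (hr : IsRoot r) : (∃ a, r = axis a ∨ r = -axis a) ∨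
    ∃ (c : ZMod 2) (b : Idx) (f : Idx → ZMod 2), b ≠ 0 ∧ r = planeVec c b f := by
  rcases root_cases hr with h | ⟨a₀, ha₀⟩
  · exact Or.inl h
  right
  obtain ⟨n, hn, c, b, h⟩ := mem_BW3_iff.1 hr.1
  have hsum : ∑ a, n a * n a = 4 := by
    have h := hr.2
    simp only [form, hn] at h
    have h' : ((∑ a, n a * n a : ℤ) : ℚ) = 4 := by push_cast; linarith
    exact_mod_cast h'
  have hodd : ∀ a, c + b ⬝ᵥ a = 1 → 1 ≤ n a * n a := by
    intro a ha
    have : n a ≠ 0 := by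
      intro h0
      have := h a
      rw [h0, ha] at this
      exact absurd this (by decide)
    have := mul_self_pos.2 this
    omega
  -- Every odd coordinate uses at least 1 of the total 4. Eight odd coordinates are too many, and
  -- the four on a plane must all be `±1` with zeros elsewhere.
  have hle : ∀ a, (if c + b ⬝ᵥ a = 1 then 1 else 0 : ℤ) ≤ n a * n a := by
    intro a
    split_ifs with ha
    · exact hodd a ha
    · exact mul_self_nonneg _
  have hn0 : (n a₀ : ZMod 2) = 1 := by
    rcases ha₀ with h1 | h1
    · have : n a₀ = 1 := by rw [hn] at h1; exact_mod_cast h1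
      rw [this]; rfl
    · have : n a₀ = -1 := by rw [hn] at h1; exact_mod_cast h1
      rw [this]; rfl
  have hb : b ≠ 0 := by
    rintro rfl
    have hc : c = 1 := by rw [← hn0, h]; simp
    have h8 := Finset.sum_le_sum fun a (_ : a ∈ Finset.univ) => hle a
    rw [hsum] at h8
    simp [hc] at h8
  have heq : ∀ a, n a * n a = if c + b ⬝ᵥ a = 1 then 1 else 0 := by
    have := (Finset.sum_eq_sum_iff_of_le fun a (_ : a ∈ Finset.univ) => hle a).1
      (by rw [hsum, sum_plane_support c b hb])
    exact fun a => (this a (Finset.mem_univ a)).symm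
  refine ⟨c, b, fun a => if n a = 1 then 0 else 1, hb, ?_⟩
  funext a
  rw [hn, planeVec]
  have h' := heq a
  split_ifs at h' ⊢ with h1 h2
  · rw [h2]; simp [sgn_zero]
  · rcases Int.isUnit_iff.1 (IsUnit.of_mul_eq_one _ h') with h3 | h3
    · exact absurd h3 h2
    · rw [h3]; simp [sgn_one]
  · rw [mul_self_eq_zero.1 h']; simp

theorem planeVec_notMem_constLat (c : ZMod 2) {b : Idx} (hb : b ≠ 0) (f : Idx → ZMod 2)
    (hx : ∀ a, ∃ k : ℤ, x a = 2 * k) : x + planeVec c b f ∉ constLat := by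
  rintro ⟨n, hn, ⟨d, hd⟩, -⟩
  obtain ⟨a, ha⟩ := exists_affine_eq_one c b hb
  obtain ⟨δ, hδ⟩ : ∃ δ, b ⬝ᵥ δ = 1 := by
    obtain ⟨δ, h, -⟩ := exists_common_dotProduct_eq_one b b hb hb
    exact ⟨δ, h⟩
  obtain ⟨k, hk⟩ := hx a
  obtain ⟨l, hl⟩ := hx (a + δ)
  have h1 : n a = 2 * k + sgn (f a) := by
    have := hn a
    rw [Pi.add_apply, hk, planeVec, if_pos ha] at this
    exact_mod_cast this.symm
  have h2 : n (a + δ) = 2 * l := by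
    have := hn (a + δ)
    have h0 : ¬c + b ⬝ᵥ (a + δ) = 1 := by
      rw [dotProduct_add, hδ, ← add_assoc, ha]; decide
    rw [Pi.add_apply, hl, planeVec, if_neg h0, add_zero] at this
    exact_mod_cast this.symm
  have e1 := hd a
  have e2 := hd (a + δ)
  rw [h1] at e1
  rw [h2] at e2
  push_cast at e1 e2
  rw [sgn_zmod, show (2 : ZMod 2) = 0 from rfl] at e1
  rw [show (2 : ZMod 2) = 0 from rfl, zero_mul] at e2
  rw [← e2, zero_mul, zero_add] at e1
  exact absurd e1 (by decide)

theorem axis_even (a d : Idx) : ∃ k : ℤ, axis a d = 2 * k := by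
  refine ⟨if d = a then 1 else 0, ?_⟩
  rw [axis_apply]; split_ifs <;> simp

/-- Both conditions in `constLat` are used: `±axis a` has coordinate sum `±2`, and a plane root has
coordinates of both parities. -/
theorem root_notMem_lowerLat (hr : IsRoot r) : r ∉ lowerLat := by
  intro h
  have h' := lowerLat_le h
  have key : ∀ a, axis a ∉ constLat := by
    rintro a ⟨n, hn, -, hs⟩
    have : ((∑ d, n d : ℤ) : ℚ) = (2 : ℤ) := by
      push_cast
      simp only [← hn, axis_apply]
      simp
    rw [Int.cast_inj] at this
    rw [this] at hs
    exact absurd hs (by decide)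
  rcases root_shape hr with ⟨a, rfl | rfl⟩ | ⟨c, b, f, hb, rfl⟩
  · exact key a h'
  · exact key a (by simpa using constLat.neg_mem h')
  · refine planeVec_notMem_constLat (x := 0) c hb f (fun a => ⟨0, by simp⟩) ?_
    rwa [zero_add]

/-- No root is orthogonal to `lowerLat` modulo 2. -/
theorem exists_odd_form (hr : IsRoot r) : ∃ u ∈ lowerLat, form u r = 1 ∨ form u r = -1 := by
  have haxis : ∀ a, ∃ u ∈ lowerLat, form u (axis a) = 1 := by
    intro a
    obtain ⟨b, hb⟩ := exists_dotProduct_eq_one 1 (by decide)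
    refine ⟨_, sub_mem_lowerLat (affine_support_mem (1 + b ⬝ᵥ a) b) (transl_mem_lowerGroup 1), ?_⟩
    rw [form_sub_left, form_axis, form_axis, transl_apply, dotProduct_add, hb]
    generalize b ⬝ᵥ a = t
    have h1 : 1 + t + t = 1 := by revert t; decide
    have h2 : ¬1 + t + (t + 1) = 1 := by revert t; decide
    rw [if_pos h1, if_neg h2]; norm_num
  rcases root_shape hr with ⟨a, rfl | rfl⟩ | ⟨c, b, f, hb, rfl⟩
  · obtain ⟨u, hu, h⟩ := haxis a
    exact ⟨u, hu, Or.inl h⟩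
  · obtain ⟨u, hu, h⟩ := haxis a
    exact ⟨u, hu, Or.inr (by rw [form_neg_right, h])⟩
  · obtain ⟨a, ha⟩ := exists_affine_eq_one c b hb
    obtain ⟨δ, hδ, -⟩ := exists_common_dotProduct_eq_one b b hb hb
    refine ⟨_, sub_mem_lowerLat (axis_mem a) (transl_mem_lowerGroup δ), ?_⟩
    have h0 : ¬c + b ⬝ᵥ (a + δ) = 1 := by
      rw [dotProduct_add, hδ, ← add_assoc, ha]; decide
    have ht : transl δ (axis a) = axis (a + δ) := by
      rw [transl, shear_axis, shearPerm_apply, zero_dotProduct, add_zero, one_smul]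
    rw [form_comm, form_sub_right, ht, form_axis, form_axis, planeVec, planeVec, if_pos ha,
      if_neg h0, sub_zero]
    rcases sgn_cases (f a) with h | h <;> rw [h] <;> simp

/-! ### Sublattices of rank 2 -/

/-- The vector `2x` splits into `(x, r) r + (x, s) s` and a vector of the annihilator, so `t` acts
as the product of the two reflections. -/
theorem associatedInvolution_apply {t : V ≃ₗ[ℚ] V} (hr : IsRoot r) (hs : IsRoot s)
    (hrs : form r s = 0) (ht : IsAssociatedInvolution t (Submodule.span ℤ {r, s}))
    (hx : x ∈ BW3) : t x = x - form x r • r - form x s • s := by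
  obtain ⟨k, hk⟩ := exists_form_eq_intCast hx hr.1
  obtain ⟨l, hl⟩ := exists_form_eq_intCast hx hs.1
  have hmem : k • r + l • s ∈ Submodule.span ℤ {r, s} :=
    Submodule.mem_span_pair.2 ⟨k, l, rfl⟩
  have hann : x + x - (k • r + l • s) ∈ ann (Submodule.span ℤ {r, s}) := by
    refine ⟨BW3.sub_mem (BW3.add_mem hx hx)
      (BW3.add_mem (BW3.smul_mem _ hr.1) (BW3.smul_mem _ hs.1)), fun y hy => ?_⟩
    obtain ⟨p, q, rfl⟩ := Submodule.mem_span_pair.1 hy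
    simp only [form_sub_left, form_add_left, form_add_right, form_zsmul_left, form_zsmul_right,
      hk, hl, hr.2, hs.2, hrs, form_comm s r]
    ring
  have h1 := ht.1 _ hmem
  have h2 := ht.2 _ hann
  rw [map_sub, h1, map_add] at h2
  have h3 : (2 : ℚ) • t x = (2 : ℚ) • (x - form x r • r - form x s • s) := by
    rw [sub_neg_eq_add] at h2
    rw [hk, hl, two_smul, Int.cast_smul_eq_zsmul, Int.cast_smul_eq_zsmul, two_smul,
      eq_sub_of_add_eq h2]
    abel
  exact smul_right_injective V (two_ne_zero' ℚ) h3

/-- For `u` in `lowerLat` the difference `u - t u = (u, r) r + (u, s) s` is again there, since `t`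
normalizes the lower group. With `(u, r) = ±1` and modulo `2L` this is `r` or `r + s`, and the
former is excluded because no root lies in `lowerLat`. -/
theorem add_mem_lowerLat {t : V ≃ₗ[ℚ] V} (hr : IsRoot r) (hs : IsRoot s)
    (hrs : form r s = 0) (ht : IsAssociatedInvolution t (Submodule.span ℤ {r, s}))
    (htB : t ∈ BRW3) (hU : ∀ u ∈ lowerLat, u ∈ BW3) : r + s ∈ lowerLat := by
  obtain ⟨u, hu, hur⟩ := exists_odd_form hr
  have htx := fun x hx => associatedInvolution_apply (x := x) hr hs hrs ht hx
  have hL : ∀ x ∈ BW3, t x ∈ BW3 := by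
    intro x hx
    obtain ⟨k, hk⟩ := exists_form_eq_intCast hx hr.1
    obtain ⟨l, hl⟩ := exists_form_eq_intCast hx hs.1
    rw [htx x hx, hk, hl, Int.cast_smul_eq_zsmul, Int.cast_smul_eq_zsmul]
    exact BW3.sub_mem (BW3.sub_mem hx (BW3.smul_mem _ hr.1)) (BW3.smul_mem _ hs.1)
  have h1 : form u r • r + form u s • s ∈ lowerLat := by
    have := lowerLat.sub_mem hu (apply_mem_lowerLat (BRW3_le htB) hL hu)
    rw [htx u (hU u hu)] at this
    convert this using 1
    abel
  obtain ⟨l, hl⟩ := exists_form_eq_intCast (hU u hu) hs.1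
  have h2 : r + form u s • s ∈ lowerLat := by
    rcases hur with h | h
    · rwa [h, one_smul] at h1
    · have := lowerLat.add_mem h1 (add_self_mem_lowerLat hr.1)
      rw [h] at this
      convert this using 1
      module
  rw [hl, Int.cast_smul_eq_zsmul] at h2
  rcases Int.even_or_odd' l with ⟨m, rfl | rfl⟩
  · exfalso
    refine root_notMem_lowerLat hr ?_
    have := lowerLat.sub_mem h2 (add_self_mem_lowerLat (BW3.smul_mem m hs.1))
    convert this using 1
    module
  · have := lowerLat.sub_mem h2 (add_self_mem_lowerLat (BW3.smul_mem m hs.1))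
    convert this using 1
    module

theorem lowerLat_le_BW3 : lowerLat ≤ BW3 := by
  refine Submodule.span_le.2 ?_
  rintro u (⟨x, hx, rfl⟩ | ⟨x, hx, k, hk, rfl⟩)
  · exact BW3.add_mem hx hx
  · exact BW3.sub_mem hx (((weylGroup_le (lowerGroup_le_weylGroup hk)).2 x).2 hx)

theorem form_hadamard {b δ : Idx} (h : b ⬝ᵥ δ = 1) (x y : V) :
    form (hadamard b δ h x) (hadamard b δ h y) = 2 * form x y := by
  have h1 : ∑ a, x (a + δ) * y (a + δ) = ∑ a, x a * y a :=
    Equiv.sum_comp (Equiv.addRight δ) fun a => x a * y a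
  -- The mixed terms change sign under `a ↦ a + δ`.
  have h2 : ∑ a, (sgn (b ⬝ᵥ a) : ℚ) * (x a * y (a + δ) + x (a + δ) * y a) = 0 := by
    have h3 := Equiv.sum_comp (Equiv.addRight δ)
      fun a => (sgn (b ⬝ᵥ a) : ℚ) * (x a * y (a + δ) + x (a + δ) * y a)
    have h4 : ∀ a, (sgn (b ⬝ᵥ (a + δ)) : ℚ) * (x (a + δ) * y (a + δ + δ) + x (a + δ + δ) * y (a + δ))
        = -((sgn (b ⬝ᵥ a) : ℚ) * (x a * y (a + δ) + x (a + δ) * y a)) := by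
      intro a
      rw [dotProduct_add, h, sgn_add_cast, sgn_one, add_assoc, idx_add_self, add_zero]
      push_cast; ring
    simp only [Equiv.coe_addRight, h4, Finset.sum_neg_distrib] at h3
    linarith
  have h5 : ∀ a, hadamard b δ h x a * hadamard b δ h y a = x a * y a + x (a + δ) * y (a + δ) +
      (sgn (b ⬝ᵥ a) : ℚ) * (x a * y (a + δ) + x (a + δ) * y a) := by
    intro a
    rw [hadamard_apply, hadamard_apply]
    linear_combination (x a * y a) * sgn_mul_sgn_cast (b ⬝ᵥ a)
  simp only [form, h5, Finset.sum_add_distrib, h1, h2]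
  ring

theorem hadamard_hadamard_axis : ∀ a : Idx,
    (sgn (Pi.single 0 1 ⬝ᵥ a) * (sgn (Pi.single 1 1 ⬝ᵥ a) * (if a = 0 then 2 else 0) +
      (if a + Pi.single 1 1 = 0 then 2 else 0)) +
      (sgn (Pi.single 1 1 ⬝ᵥ (a + Pi.single 0 1)) * (if a + Pi.single 0 1 = 0 then 2 else 0) +
      (if a + Pi.single 0 1 + Pi.single 1 1 = 0 then 2 else 0)) =
      2 * (if 1 + Pi.single 2 1 ⬝ᵥ a = (1 : ZMod 2) then sgn 0 else 0)) ∧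
    (sgn (Pi.single 0 1 ⬝ᵥ a) * (sgn (Pi.single 1 1 ⬝ᵥ a) * (if a = Pi.single 2 1 then 2 else 0) +
      (if a + Pi.single 1 1 = Pi.single 2 1 then 2 else 0)) +
      (sgn (Pi.single 1 1 ⬝ᵥ (a + Pi.single 0 1)) *
        (if a + Pi.single 0 1 = Pi.single 2 1 then 2 else 0) +
      (if a + Pi.single 0 1 + Pi.single 1 1 = Pi.single 2 1 then 2 else 0)) =
      2 * (if 0 + Pi.single 2 1 ⬝ᵥ a = (1 : ZMod 2) then sgn 0 else 0)) := by decide +kernel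

/-- The product of the reflections in the characteristic functions of a plane and its complement
lies in `BRW₃`. -/
theorem exists_mem_BRW3_reflections : ∃ g ∈ BRW3 ⊓ weylGroup, ∀ x : V,
    g x = x - form x (planeVec 1 (Pi.single 2 1) 0) • planeVec 1 (Pi.single 2 1) 0 -
      form x (planeVec 0 (Pi.single 2 1) 0) • planeVec 0 (Pi.single 2 1) 0 := by
  have h0 : (Pi.single 0 1 : Idx) ⬝ᵥ Pi.single 0 1 = 1 := by simp
  have h1 : (Pi.single 1 1 : Idx) ⬝ᵥ Pi.single 1 1 = 1 := by simp
  have h2 : (Pi.single 2 1 : Idx) ≠ 0 := by simp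
  set r := planeVec 1 (Pi.single 2 1) 0 with hr
  set s := planeVec 0 (Pi.single 2 1) 0 with hs
  have hrR : IsRoot r := isRoot_planeVec _ h2 _
  have hsR : IsRoot s := isRoot_planeVec _ h2 _
  obtain ⟨w, hw, hw'⟩ := exists_reflection hrR
  obtain ⟨v, hv, hv'⟩ := exists_reflection hsR
  have hrs : form r s = 0 := by
    rw [form, Finset.sum_eq_zero, mul_zero]
    intro a _
    simp only [hr, hs, planeVec]
    rcases zmod_two_cases ((Pi.single 2 1 : Idx) ⬝ᵥ a) with h | h <;> rw [h] <;> simp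
  have hwv : ∀ x, (v * w) x = x - form x r • r - form x s • s := by
    intro x
    rw [LinearEquiv.mul_apply, hv', hw', form_sub_left, form_smul_left, hrs, mul_zero, sub_zero]
  -- Two Hadamard maps spread a single point over a plane: `K` is twice an isometry and sends the
  -- axes at 0 and `Pi.single 2 1` to twice the two plane roots. Conjugating the sign change at
  -- these two points by `K` gives the product of reflections, and `BRW3` is normal in the
  -- normalizer.
  let K := hadamard _ _ h0 * hadamard _ _ h1
  have hK : K ∈ lowerNormalizer :=
    mul_mem (hadamard_mem_lowerNormalizer h0) (hadamard_mem_lowerNormalizer h1)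
  have hform : ∀ x y, form (K x) (K y) = 4 * form x y := by
    intro x y
    rw [LinearEquiv.mul_apply, LinearEquiv.mul_apply, form_hadamard, form_hadamard]; ring
  have hK0 : K (axis 0) = (2 : ℚ) • r := by
    funext a
    have := congrArg (Int.cast : ℤ → ℚ) (hadamard_hadamard_axis a).1
    push_cast at this
    simp only [K, LinearEquiv.mul_apply, hadamard_apply, axis_apply, Pi.smul_apply, hr, planeVec,
      smul_eq_mul, Pi.zero_apply]
    exact this
  have hK2 : K (axis (Pi.single 2 1)) = (2 : ℚ) • s := by
    funext a
    have := congrArg (Int.cast : ℤ → ℚ) (hadamard_hadamard_axis a).2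
    push_cast at this
    simp only [K, LinearEquiv.mul_apply, hadamard_apply, axis_apply, Pi.smul_apply, hs, planeVec,
      smul_eq_mul, Pi.zero_apply]
    exact this
  let f : Idx → ZMod 2 := fun a => if a = 0 ∨ a = Pi.single 2 1 then 1 else 0
  have hf : ∑ a, f a = 0 := by decide +kernel
  have hfx : ∀ x, signMap f x = x - x 0 • axis 0 - x (Pi.single 2 1) • axis (Pi.single 2 1) := by
    intro x
    funext a
    rw [signMap_apply, Pi.sub_apply, Pi.sub_apply, Pi.smul_apply, Pi.smul_apply, axis_apply,
      axis_apply]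
    by_cases ha : a = 0
    · subst ha
      simp [f, sgn_one, h2.symm]; ring
    · by_cases hb : a = Pi.single 2 1
      · subst hb; simp [f, sgn_one]; ring
      · simp [f, ha, hb, sgn_zero]
  have hconj : K * signMap f * K⁻¹ = v * w := by
    rw [mul_inv_eq_iff_eq_mul]
    refine LinearEquiv.ext fun x => ?_
    rw [LinearEquiv.mul_apply K, LinearEquiv.mul_apply (v * w) K, hwv, hfx, map_sub, map_sub, map_smul,
      map_smul, hK0, hK2]
    have e1 : form (K x) r = 2 * x 0 := by
      have := hform x (axis 0)
      rw [hK0, form_smul_right, form_axis] at this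
      linarith
    have e2 : form (K x) s = 2 * x (Pi.single 2 1) := by
      have := hform x (axis (Pi.single 2 1))
      rw [hK2, form_smul_right, form_axis] at this
      linarith
    rw [e1, e2, smul_smul, smul_smul, mul_comm, mul_comm (x (Pi.single 2 1))]
  refine ⟨v * w, ⟨?_, mul_mem hv hw⟩, hwv⟩
  rw [← hconj]
  exact conj_mem_BRW3 hK (signMap_mem_BRW3 hf)

theorem shear_planeVec {c c' : ZMod 2} {b b' m δ : Idx} {d : ZMod 2} (h : m ⬝ᵥ δ = 0)
    (hs : ∀ a, c' + b' ⬝ᵥ shearPerm d m δ h a = c + b ⬝ᵥ a) (f : Idx → ZMod 2) :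
    shear d m δ h (planeVec c' b' f) = planeVec c b fun a => f (shearPerm d m δ h a) := by
  funext a
  rw [shear_apply, ← shearPerm_apply h, planeVec, planeVec, hs]

/-- The signs of a vector on a plane can be changed arbitrarily. -/
theorem exists_signMap_planeVec (c : ZMod 2) {b : Idx} (hb : b ≠ 0) (f f' : Idx → ZMod 2) :
    ∃ h : Idx → ZMod 2, ∑ a, h a = 0 ∧ signMap h (planeVec c b f) = planeVec c b f' := by
  obtain ⟨p, hp⟩ := exists_affine_eq_one (c + 1) b hb
  have hp' : c + b ⬝ᵥ p = 0 := by
    rw [add_right_comm] at hp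
    exact add_eq_right.1 hp
  let k : Idx → ZMod 2 := fun a => if c + b ⬝ᵥ a = 1 then f a + f' a else 0
  -- A sign at the point `p` off the plane makes the total even without affecting the vector.
  refine ⟨fun a => k a + if a = p then ∑ d, k d else 0, ?_, ?_⟩
  · rw [Finset.sum_add_distrib, Finset.sum_ite_eq', if_pos (Finset.mem_univ p),
      CharTwo.add_self_eq_zero]
  · funext a
    rw [signMap_apply, planeVec, planeVec]
    by_cases ha : c + b ⬝ᵥ a = 1
    · have hap : a ≠ p := by
        rintro rfl
        rw [hp'] at ha; exact absurd ha (by decide)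
      simp only [k, if_pos ha, if_neg hap, add_zero]
      rw [sgn_add_cast]
      linear_combination (sgn (f' a) : ℚ) * sgn_mul_sgn_cast (f a)
    · rw [if_neg ha, if_neg ha, mul_zero]

theorem sub_planeVec : ∀ a : Idx, (if a = 0 then 2 else 0) -
    (if 1 + (Pi.single 2 1 : Idx) ⬝ᵥ a = (1 : ZMod 2) then sgn 0 else 0) =
    if 1 + (Pi.single 2 1 : Idx) ⬝ᵥ a = (1 : ZMod 2) then sgn (if a = 0 then 0 else 1) else 0 := by
  decide +kernel

/-- A shear brings the plane of the root to a fixed plane, and an even sign change brings its signs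
to those of `axis 0 - χ`, with `χ` the characteristic vector of the plane. The reflection in `χ`
sends this to `axis 0`; the reflection in the complementary plane, needed to stay in `BRW3`, acts
trivially on it. -/
theorem exists_move_root_BRW3 (hr : IsRoot r) :
    ∃ g ∈ BRW3 ⊓ weylGroup, ∃ a, g r = axis a ∨ g r = -axis a := by
  rcases root_shape hr with ⟨a, h⟩ | ⟨c, b, f, hb, rfl⟩
  · exact ⟨1, one_mem _, a, h⟩
  have h2 : (Pi.single 2 1 : Idx) ≠ 0 := by simp
  obtain ⟨δ, hδ, hs⟩ := exists_shear_plane 1 h2 c hb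
  have h1 := shear_planeVec hδ hs f
  obtain ⟨k, hk, hk'⟩ := exists_signMap_planeVec 1 h2
    (fun a => f (shearPerm (1 + c) (Pi.single 2 1 + b) δ hδ a)) (fun a => if a = 0 then 0 else 1)
  obtain ⟨g, hg, hg'⟩ := exists_mem_BRW3_reflections
  have h3 : planeVec 1 (Pi.single 2 1) (fun a => if a = 0 then 0 else 1) =
      axis 0 - planeVec 1 (Pi.single 2 1) 0 := by
    funext a
    have := congrArg (Int.cast : ℤ → ℚ) (sub_planeVec a)
    push_cast at this
    rw [Pi.sub_apply, axis_apply, planeVec, planeVec]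
    exact this.symm
  refine ⟨g * (signMap k * shear (1 + c) (Pi.single 2 1 + b) δ hδ), mul_mem hg (mul_mem
    ⟨signMap_mem_BRW3 hk, signMap_mem_weylGroup k⟩ ⟨shear_mem_BRW3 _ _, shear_mem_weylGroup _ _⟩),
    0, Or.inl ?_⟩
  rw [LinearEquiv.mul_apply, LinearEquiv.mul_apply, h1, hk', h3, hg']
  have hrR : IsRoot (planeVec 1 (Pi.single 2 1) 0) := isRoot_planeVec 1 h2 0
  have e1 : form (axis 0) (planeVec 1 (Pi.single 2 1) 0) = 1 := by
    rw [form_comm, form_axis, planeVec]; simp [sgn_zero]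
  have e2 : form (axis 0) (planeVec 0 (Pi.single 2 1) 0) = 0 := by
    rw [form_comm, form_axis, planeVec]; simp
  have e3 : form (planeVec 1 (Pi.single 2 1) 0) (planeVec 0 (Pi.single 2 1) 0) = 0 := by
    rw [form, Finset.sum_eq_zero, mul_zero]
    intro a _
    simp only [planeVec]
    rcases zmod_two_cases ((Pi.single 2 1 : Idx) ⬝ᵥ a) with h | h <;> rw [h] <;> simp
  rw [form_sub_left, form_sub_left, e1, e2, e3, hrR.2]
  module

/-- Once `r` is an axis up to sign, the sum `r + s` lies in `constLat`, so all coordinates of `s`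
have the same parity. This excludes plane roots and leaves an axis up to sign. -/
theorem exists_BRW3_smul_eq_coordLat (hM : IsRSSD M) (h2 : Module.finrank ℤ M = 2)
    (ht : ∃ t ∈ BRW3, IsAssociatedInvolution t M) :
    ∃ g ∈ BRW3 ⊓ weylGroup, ∃ a b, a ≠ b ∧ g • M = coordLat {a, b} := by
  obtain ⟨r, s, hr, hs, hrs, rfl⟩ := rank_two_exists hM h2
  obtain ⟨t, htB, ht⟩ := ht
  have hadd := add_mem_lowerLat hr hs hrs ht htB fun u hu => lowerLat_le_BW3 hu
  obtain ⟨g, hg, a, ha⟩ := exists_move_root_BRW3 hr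
  have hgL := weylGroup_le hg.2
  have hgs : IsRoot (g s) := isRoot_apply hgL hs
  have hadd' := lowerLat_le (apply_mem_lowerLat (BRW3_le hg.1) (fun x hx => (hgL.2 x).2 hx) hadd)
  rw [map_add] at hadd'
  have heven : ∀ d, ∃ k : ℤ, g r d = 2 * k := by
    intro d
    rcases ha with h | h
    · rw [h]; exact axis_even a d
    · obtain ⟨k, hk⟩ := axis_even a d
      exact ⟨-k, by rw [h, Pi.neg_apply, hk]; push_cast; ring⟩
  have horth : form (g r) (g s) = 0 := by rw [hgL.1, hrs]
  obtain ⟨b, hb⟩ : ∃ b, g s = axis b ∨ g s = -axis b := by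
    rcases root_shape hgs with h | ⟨c, b, f, hb, h⟩
    · exact h
    · rw [h] at hadd'
      exact absurd hadd' (planeVec_notMem_constLat c hb f heven)
  have hab : a ≠ b := by
    rintro rfl
    rcases ha with ha | ha <;> rcases hb with hb | hb <;>
      simp [ha, hb, form_neg_left, form_neg_right, form_axis_axis] at horth
  refine ⟨g, hg, a, b, hab, ?_⟩
  have hspan : ∀ x y : V, Submodule.span ℤ {-x, y} = Submodule.span ℤ {x, y} := fun x y => by
    rw [Submodule.span_insert, Submodule.span_insert, ← Set.neg_singleton, Submodule.span_neg]
  have hspan' : ∀ x y : V, Submodule.span ℤ {x, -y} = Submodule.span ℤ {x, y} := fun x y => by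
    rw [Set.pair_comm, hspan, Set.pair_comm]
  rw [smul_span_two, coordLat_two hab]
  rcases ha with ha | ha <;> rcases hb with hb | hb <;> simp only [ha, hb, hspan, hspan']

theorem rank_two_orbit {N : Submodule ℤ V} (hM : IsRSSD M) (hM2 : Module.finrank ℤ M = 2)
    (htM : ∃ t ∈ BRW3, IsAssociatedInvolution t M) (hN : IsRSSD N)
    (hN2 : Module.finrank ℤ N = 2) (htN : ∃ t ∈ BRW3, IsAssociatedInvolution t N) :
    ∃ g ∈ BRW3 ⊓ weylGroup, g • M = N := by
  obtain ⟨g, hg, a, b, hab, h⟩ := exists_BRW3_smul_eq_coordLat hM hM2 htM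
  obtain ⟨g', hg', a', b', hab', h'⟩ := exists_BRW3_smul_eq_coordLat hN hN2 htN
  obtain ⟨k, hk, hkk⟩ := linked_of_card_eq (G := BRW3 ⊓ weylGroup) (S := {a, b}) (T := {a', b'})
    (fun g hg => weylGroup_le hg.2)
    (fun c b δ h => ⟨shear_mem_BRW3 c h, shear_mem_weylGroup c h⟩)
    (by rw [Finset.card_pair hab, Finset.card_pair hab'])
    (by rw [Finset.card_pair hab]; norm_num)
  exact ⟨g'⁻¹ * (k * g), mul_mem (inv_mem hg') (mul_mem hk hg),
    by rw [mul_smul, mul_smul, h, hkk, ← h', inv_smul_smul]⟩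

/-! ### Sublattices of rank 6 -/

/-- The involution of the annihilator is `-t`, and `-1` is a sign change on all eight points, an
even number. -/
theorem exists_associatedInvolution_ann (hM : IsRSSD M)
    (ht : ∃ t ∈ BRW3, IsAssociatedInvolution t M) :
    ∃ t ∈ BRW3, IsAssociatedInvolution t (ann M) := by
  obtain ⟨t, htB, ht1, ht2⟩ := ht
  have hneg : ∀ x, signMap 1 x = -x := fun x => by
    funext a
    rw [signMap_apply, Pi.one_apply, sgn_one]; simp
  refine ⟨signMap 1 * t, mul_mem (signMap_mem_BRW3 (by decide +kernel)) htB, fun x hx => ?_,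
    fun x hx => ?_⟩
  · rw [LinearEquiv.mul_apply, hneg, ht2 x hx]
  · rw [(ann_properties hM).2.2] at hx
    rw [LinearEquiv.mul_apply, hneg, ht1 x hx, neg_neg]

theorem rank_two_or_six_orbit {n : ℕ} (hn : n = 2 ∨ n = 6) {N : Submodule ℤ V} (hM : IsRSSD M)
    (hMn : Module.finrank ℤ M = n) (htM : ∃ t ∈ BRW3, IsAssociatedInvolution t M)
    (hN : IsRSSD N) (hNn : Module.finrank ℤ N = n)
    (htN : ∃ t ∈ BRW3, IsAssociatedInvolution t N) : N ∈ MulAction.orbit BRW3 M := by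
  rw [mem_orbit_iff]
  rcases hn with rfl | rfl
  · obtain ⟨g, hg, h⟩ := rank_two_orbit hM hMn htM hN hNn htN
    exact ⟨g, hg.1, h⟩
  · obtain ⟨hM1, hM2, hM3⟩ := ann_properties hM
    obtain ⟨hN1, hN2, hN3⟩ := ann_properties hN
    obtain ⟨g, hg, h⟩ := rank_two_orbit hM1 (by omega) (exists_associatedInvolution_ann hM htM)
      hN1 (by omega) (exists_associatedInvolution_ann hN htN)
    exact ⟨g, hg.1, by rw [← hM3, ← ann_smul (weylGroup_le hg.2), h, hN3]⟩

/-! ### Even rank -/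

theorem isAssociatedInvolution_signMap (S : Finset Idx) :
    IsAssociatedInvolution (signMap fun a => if a ∈ S then 1 else 0) (coordLat S) := by
  refine ⟨fun x hx => ?_, fun x hx => ?_⟩
  · funext a
    rw [signMap_apply, Pi.neg_apply]
    by_cases ha : a ∈ S
    · simp [ha, sgn_one]
    · simp [hx.2 a ha]
  · rw [ann_coordLat] at hx
    funext a
    rw [signMap_apply]
    by_cases ha : a ∈ S
    · simp [hx.2 a (by simpa using ha)]
    · simp [ha, sgn_zero]

theorem ext_axis {f f' : V →ₗ[ℚ] V} (h : ∀ a, f (axis a) = f' (axis a)) : f = f' := by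
  refine (Pi.basisFun ℚ Idx).ext fun a => ?_
  have : Pi.basisFun ℚ Idx a = (1 / 2 : ℚ) • axis a := by
    funext d
    rw [Pi.basisFun_apply, Pi.smul_apply, axis_apply, Pi.single_apply]
    split_ifs <;> norm_num
  rw [this, map_smul, map_smul, h]

theorem eq_signMap {t : V ≃ₗ[ℚ] V} (ht : IsAssociatedInvolution t (coordLat S)) :
    t = signMap fun a => if a ∈ S then 1 else 0 := by
  have h' := isAssociatedInvolution_signMap S
  refine LinearEquiv.toLinearMap_injective (ext_axis fun a => ?_)
  change t (axis a) = signMap _ (axis a)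
  by_cases ha : a ∈ S
  · rw [ht.1 _ (axis_mem_coordLat ha), h'.1 _ (axis_mem_coordLat ha)]
  · have hmem : axis a ∈ ann (coordLat S) := by
      rw [ann_coordLat]
      exact axis_mem_coordLat (by simpa using ha)
    rw [ht.2 _ hmem, h'.2 _ hmem]

theorem det_signMap (f : Idx → ZMod 2) :
    LinearMap.det (signMap f : V →ₗ[ℚ] V) = ∏ a, (sgn (f a) : ℚ) := by
  have : (signMap f : V →ₗ[ℚ] V) = Matrix.toLin' (Matrix.diagonal fun a => (sgn (f a) : ℚ)) := by
    refine LinearMap.ext fun x => ?_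
    funext a
    rw [Matrix.toLin'_apply, Matrix.mulVec_diagonal]
    rfl
  rw [this, LinearMap.det_toLin', Matrix.det_diagonal]

theorem det_of_mem_BRW3 {t : V ≃ₗ[ℚ] V} (ht : t ∈ BRW3) : LinearEquiv.det t = 1 := by
  have : BRW3 ≤ (LinearEquiv.det (R := ℚ) (M := V)).ker := by
    refine Subgroup.commutator_le.2 fun g _ h _ => ?_
    rw [MonoidHom.mem_ker, map_commutatorElement, commutatorElement_eq_one_iff_mul_comm, mul_comm]
  exact this ht

theorem isAssociatedInvolution_conj (hg : g ∈ latticeIsometries) {t : V ≃ₗ[ℚ] V}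
    (ht : IsAssociatedInvolution t M) : IsAssociatedInvolution (g * t * g⁻¹) (g • M) := by
  refine ⟨fun x hx => ?_, fun x hx => ?_⟩
  · rw [LinearEquiv.mul_apply, LinearEquiv.mul_apply, ht.1 _ (mem_smul_iff.1 hx), map_neg,
      LinearEquiv.coe_inv, g.apply_symm_apply]
  · rw [ann_smul hg] at hx
    rw [LinearEquiv.mul_apply, LinearEquiv.mul_apply, ht.2 _ (mem_smul_iff.1 hx),
      LinearEquiv.coe_inv, g.apply_symm_apply]

/-- Elements of a commutator subgroup have determinant 1. After conjugation to a coordinate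
sublattice the involution is a sign change, with determinant `(-1)^rank`. -/
theorem even_finrank_of_mem_BRW3 {t : V ≃ₗ[ℚ] V} (hM : IsRSSD M) (htB : t ∈ BRW3)
    (ht : IsAssociatedInvolution t M) : Even (Module.finrank ℤ M) := by
  obtain ⟨w, hw, T, hT, hc⟩ := exists_smul_eq_coordLat_card hM
  have h := isAssociatedInvolution_conj (weylGroup_le hw) ht
  rw [hT] at h
  have hdet : LinearEquiv.det (w * t * w⁻¹) = 1 := by
    rw [map_mul, map_mul, det_of_mem_BRW3 htB, mul_one, ← map_mul, mul_inv_cancel, map_one]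
  rw [eq_signMap h] at hdet
  have hdet' := congrArg (Units.val) hdet
  rw [LinearEquiv.coe_det, det_signMap] at hdet'
  have hprod : ∏ a, (sgn (if a ∈ T then 1 else 0) : ℚ) = (-1) ^ T.card := by
    rw [← Finset.prod_const, ← Finset.prod_subset (Finset.subset_univ T)]
    · exact Finset.prod_congr rfl fun a ha => by simp [ha, sgn_one]
    · intro a _ ha
      simp [ha, sgn_zero]
  rw [hprod, Units.val_one] at hdet'
  rw [← hc]
  exact (neg_one_pow_eq_one_iff_even (by norm_num)).1 hdet'

theorem even_finrank_iff (hM : IsRSSD M) : Even (Module.finrank ℤ M) ↔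
    ∃ N ∈ MulAction.orbit weylGroup M, ∃ t ∈ BRW3, IsAssociatedInvolution t N := by
  constructor
  · intro h
    obtain ⟨w, hw, T, hT, hc⟩ := exists_smul_eq_coordLat_card hM
    refine ⟨coordLat T, mem_orbit_iff.2 ⟨w, hw, hT⟩, _, signMap_mem_BRW3 ?_,
      isAssociatedInvolution_signMap T⟩
    rw [Finset.sum_boole, Finset.filter_mem_eq_inter, Finset.univ_inter, hc]
    exact (ZMod.natCast_eq_zero_iff_even).2 h
  · rintro ⟨N, hN, t, htB, ht⟩
    obtain ⟨w, hw, rfl⟩ := mem_orbit_iff.1 hN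
    have := even_finrank_of_mem_BRW3 (isRSSD_smul (weylGroup_le hw) hM) htB ht
    rwa [finrank_smul] at this

/-! ### The basis of type `E₈` -/

/-- The position of a point of `𝔽₂³` in the lexicographic order. -/
def position (a : Idx) : Fin 8 :=
  Fin.ofNat 8 ((a 0).val + 2 * (a 1).val + 4 * (a 2).val)

/-- Simple roots of type `E₈`. -/
def simpleRoot (i : Fin 8) (a : Idx) : ℤ :=
  (!![2, 0, 0, 0, 0, 0, 0, 0;
     0, 2, 0, 0, 0, 0, 0, 0;
     -1, 0, 1, 0, 1, 0, 1, 0;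
     0, -1, -1, 0, 0, 1, -1, 0;
     0, 0, 0, 0, 0, -2, 0, 0;
     0, 0, 0, 0, -1, 1, 1, 1;
     0, 0, 0, 0, 0, 0, 0, -2;
     0, 0, 1, 1, 0, 0, -1, 1] : Matrix (Fin 8) (Fin 8) ℤ) i (position a)

/-- The fundamental weights dual to the simple roots. -/
def fundamentalWeight (i : Fin 8) (a : Idx) : ℤ :=
  (!![1, 0, -1, 2, 1, 0, 1, 0;
     0, 1, -2, 3, 1, 0, 1, 0;
     0, 0, -2, 4, 2, 0, 2, 0;
     0, 0, -4, 6, 2, 0, 2, 0;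
     0, 0, -3, 5, 1, -1, 2, 0;
     0, 0, -2, 4, 0, 0, 2, 0;
     0, 0, -1, 3, 0, 0, 1, -1;
     0, 0, 0, 2, 0, 0, 0, 0] : Matrix (Fin 8) (Fin 8) ℤ) i (position a)

theorem isCode_simpleRoot : ∀ i : Fin 8, ∃ (c : ZMod 2) (b : Idx), ∀ a,
    (simpleRoot i a : ZMod 2) = c + b ⬝ᵥ a := by decide +kernel

theorem isCode_fundamentalWeight : ∀ i : Fin 8, ∃ (c : ZMod 2) (b : Idx), ∀ a,
    (fundamentalWeight i a : ZMod 2) = c + b ⬝ᵥ a := by decide +kernel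

theorem sum_simpleRoot_simpleRoot : ∀ i j : Fin 8,
    ∑ a, simpleRoot i a * simpleRoot j a = 2 * CartanMatrix.E₈ i j := by decide +kernel

theorem sum_simpleRoot_fundamentalWeight : ∀ i j : Fin 8,
    ∑ a, simpleRoot i a * fundamentalWeight j a = if i = j then 2 else 0 := by decide +kernel

theorem sum_fundamentalWeight_mul_simpleRoot : ∀ a d : Idx,
    ∑ i, fundamentalWeight i a * simpleRoot i d = if d = a then 2 else 0 := by decide +kernel

/-- A simple root as an element of the lattice. -/
def simpleVec (i : Fin 8) : BW3 := ⟨fun a => simpleRoot i a, mem_of_isCode (isCode_simpleRoot i)⟩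

/-- A fundamental weight as a vector. -/
def weightVec (i : Fin 8) : V := fun a => fundamentalWeight i a

theorem form_simpleVec_weightVec (i j : Fin 8) :
    form (simpleVec i) (weightVec j) = if i = j then 1 else 0 := by
  have := congrArg (Int.cast : ℤ → ℚ) (sum_simpleRoot_fundamentalWeight i j)
  push_cast at this
  simp only [form, simpleVec, weightVec, this]
  split_ifs <;> norm_num

/-- Duality read the other way: the matrices of simple roots and weights are inverse to each other
up to the factor 2 that the form absorbs. -/
theorem eq_sum_form_weightVec (x : V) :
    x = ∑ i, form x (weightVec i) • (simpleVec i : V) := by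
  funext d
  have h : ∀ a, ∑ i, (fundamentalWeight i a : ℚ) * simpleRoot i d = if d = a then 2 else 0 := by
    intro a
    have := congrArg (Int.cast : ℤ → ℚ) (sum_fundamentalWeight_mul_simpleRoot a d)
    push_cast at this
    exact this
  have h2 : ∑ i, form x (weightVec i) * (simpleRoot i d : ℚ) =
      (1 / 2) * ∑ a, x a * ∑ i, (fundamentalWeight i a : ℚ) * simpleRoot i d := by
    simp only [form, weightVec, Finset.mul_sum, Finset.sum_mul]
    rw [Finset.sum_comm]
    exact Finset.sum_congr rfl fun a _ => Finset.sum_congr rfl fun i _ => by ring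
  simp only [h] at h2
  rw [Finset.sum_apply]
  simp only [Pi.smul_apply, smul_eq_mul, simpleVec]
  rw [h2]
  simp
  ring

/-- Pairing with the weights gives independence. The weights themselves lie in the lattice, so the
coefficients of a lattice vector in the simple roots are integers, and the simple roots span. -/
theorem exists_basis_E8 : ∃ b : Module.Basis (Fin 8) ℤ BW3,
    ∀ i j, form (b i : V) (b j : V) = (CartanMatrix.E₈ i j : ℚ) := by
  have hli : LinearIndependent ℤ simpleVec := by
    rw [Fintype.linearIndependent_iff]
    intro c hc j
    have h := congrArg (fun y : BW3 => form (y : V) (weightVec j)) hc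
    have hlin : form ((∑ i, c i • simpleVec i : BW3) : V) (weightVec j) =
        ∑ i, (c i : ℚ) * form (simpleVec i) (weightVec j) := by
      induction (Finset.univ : Finset (Fin 8)) using Finset.induction_on with
      | empty => simp [form_zero_left]
      | insert i t hi ih =>
        rw [Finset.sum_insert hi, Finset.sum_insert hi, Submodule.coe_add, form_add_left, ih,
          Submodule.coe_smul, form_zsmul_left]
    simp only [hlin, form_simpleVec_weightVec] at h
    simpa [form_zero_left] using h
  have hsp : ⊤ ≤ Submodule.span ℤ (Set.range simpleVec) := by
    rintro ⟨x, hx⟩ -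
    have hk : ∀ i, ∃ k : ℤ, form x (weightVec i) = k := fun i =>
      exists_form_eq_intCast hx (mem_of_isCode (isCode_fundamentalWeight i))
    choose k hk using hk
    have : (⟨x, hx⟩ : BW3) = ∑ i, k i • simpleVec i := by
      apply Subtype.ext
      rw [AddSubmonoidClass.coe_finsetSum]
      refine (eq_sum_form_weightVec x).trans ?_
      exact Finset.sum_congr rfl fun i _ => by
        rw [hk, Int.cast_smul_eq_zsmul, Submodule.coe_smul]
    rw [this]
    exact Submodule.sum_mem _ fun i _ => Submodule.smul_mem _ _ (Submodule.subset_span ⟨i, rfl⟩)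
  refine ⟨Module.Basis.mk hli hsp, fun i j => ?_⟩
  rw [Module.Basis.mk_apply, Module.Basis.mk_apply]
  have := congrArg (Int.cast : ℤ → ℚ) (sum_simpleRoot_simpleRoot i j)
  push_cast at this
  simp only [form, simpleVec, this]
  ring

end BarnesWall

end

open BarnesWall in
theorem proposition4p2 :
    -- the lattice is the root lattice of type `E₈`
    (∃ b : Module.Basis (Fin 8) ℤ BW3,
      ∀ i j, form (b i : V) (b j : V) = (CartanMatrix.E₈ i j : ℚ)) ∧
    -- there are eight orbits in all
    properOrbits.ncard = 8 ∧
    -- even ranks: the numbers of orbits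
    (orbitsOfRank 2).ncard = 1 ∧ (orbitsOfRank 4).ncard = 2 ∧ (orbitsOfRank 6).ncard = 1 ∧
    -- the orbits of even rank are those coming from involutions of `BRW₃`
    (∀ M, IsRSSD M → (Even (Module.finrank ℤ M) ↔
      ∃ N ∈ MulAction.orbit weylGroup M, ∃ t ∈ BRW3, IsAssociatedInvolution t N)) ∧
    -- in ranks 2 and 6, the sublattices coming from `BRW₃` form a single orbit of `BRW₃`
    (∀ n : ℕ, n = 2 ∨ n = 6 → ∀ M N : Submodule ℤ V,
      IsRSSD M → Module.finrank ℤ M = n → (∃ t ∈ BRW3, IsAssociatedInvolution t M) →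
      IsRSSD N → Module.finrank ℤ N = n → (∃ t ∈ BRW3, IsAssociatedInvolution t N) →
      N ∈ MulAction.orbit BRW3 M) ∧
    -- odd ranks: one orbit each
    (orbitsOfRank 1).ncard = 1 ∧ (orbitsOfRank 3).ncard = 1 ∧
    (orbitsOfRank 5).ncard = 1 ∧ (orbitsOfRank 7).ncard = 1 ∧
    -- rank 1: generated by a root
    (∀ M, (IsRSSD M ∧ Module.finrank ℤ M = 1) ↔
      ∃ r, IsRoot r ∧ M = Submodule.span ℤ {r}) ∧
    -- rank 3: generated by three mutually orthogonal roots
    (∀ M, (IsRSSD M ∧ Module.finrank ℤ M = 3) ↔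
      ∃ r s u, IsRoot r ∧ IsRoot s ∧ IsRoot u ∧
        form r s = 0 ∧ form r u = 0 ∧ form s u = 0 ∧ M = Submodule.span ℤ {r, s, u}) ∧
    -- rank 5: the annihilators of the sublattices of rank 3
    (∀ M, (IsRSSD M ∧ Module.finrank ℤ M = 5) ↔
      ∃ r s u, IsRoot r ∧ IsRoot s ∧ IsRoot u ∧
        form r s = 0 ∧ form r u = 0 ∧ form s u = 0 ∧ M = ann (Submodule.span ℤ {r, s, u})) ∧
    -- rank 7: the annihilators of the sublattices of rank 1
    (∀ M, (IsRSSD M ∧ Module.finrank ℤ M = 7) ↔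
      ∃ r, IsRoot r ∧ M = ann (Submodule.span ℤ {r})) := by
  refine ⟨exists_basis_E8, properOrbits_ncard, ?_, ?_, ?_, fun M hM => even_finrank_iff hM,
    fun n hn M N hM hMn htM hN hNn htN => rank_two_or_six_orbit hn hM hMn htM hN hNn htN,
    ?_, ?_, ?_, ?_, fun M => rank_one_iff, fun M => rank_three_iff, fun M => rank_five_iff,
    fun M => rank_seven_iff⟩
  · rw [orbitsOfRank_ncard (by norm_num) (by norm_num)]; exact repSet_count 2 (by decide)
  · rw [orbitsOfRank_ncard (by norm_num) (by norm_num)]; exact repSet_count 4 (by decide)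
  · rw [orbitsOfRank_ncard (by norm_num) (by norm_num)]; exact repSet_count 6 (by decide)
  · rw [orbitsOfRank_ncard (by norm_num) (by norm_num)]; exact repSet_count 1 (by decide)
  · rw [orbitsOfRank_ncard (by norm_num) (by norm_num)]; exact repSet_count 3 (by decide)
  · rw [orbitsOfRank_ncard (by norm_num) (by norm_num)]; exact repSet_count 5 (by decide)
  · rw [orbitsOfRank_ncard (by norm_num) (by norm_num)]; exact repSet_count 7 (by decide)
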